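/- Let $n,m\ge 0$ and $k\ge 1$ be integers. For each $i\in[m]$ let $\mathcal S_i$ be a finite collection of subsets of $[n]$ (the same set may occur several times, within one collection or in different ones), and let $f_i(T)=\sum_{S\in\mathcal S_i}\min\{|S\cap T|,1\}$ for $T\subseteq[n]$ be the corresponding coverage function. The family $\mathcal F=\{f_1,\dots,f_m\}$ is called $t$-sparse if every item $j\in[n]$ lies in at most $t$ of the sets in $\mathcal S_1,\dots,\mathcal S_m$, counted with multiplicity over all $m$ collections. For a $k$-colouring $\chi:[n]\to[k]$ let $$\operatorname{disc}(\mathcal F,\chi)=\max_{i\in[m]}\ \max_{\ell,\ell'\in[k]}\big|f_i(\chi^{-1}(\ell))-f_i(\chi^{-1}(\ell'))\big|.$$ For every constant $c\in\mathbb N$ there are a randomized algorithm, a polynomial $p$ and a constant $C$ such that the following holds. Given the sets of any such family $\mathcal F$ and any $k\ge 1$, the algorithm, using fair coin flips, always outputs a $k$-colouring $\chi:[n]\to[k]$ within $p\big(n+m+\sum_i|\mathcal S_i|+b(k)\big)$ bit operations, where $b(k)$ is the binary length of $k$. If $\mathcal F$ is $t$-sparse, then with probability at least $1-n^{-c}$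 $$\operatorname{disc}(\mathcal F,\chi)\ \le\ C\,\sqrt{t^{3}k}\,\ln(ntk),$$ where the right-hand side is read as $0$ if $nt=0$ (and $n^{-c}$ is read as $0$ if $n=0$ and $c\ge 1$). Bit operations are counted on a random access machine with logarithmic cost. -/

import Mathlib

namespace SparseCoverage

/-! ### Coverage functions and discrepancy -/

/-- A family of `m` coverage functions on the items `Fin n`, given by dual sets.
The universes of the `m` functions are put side by side: `numElems` elements in total, the
element `u` belongs to the universe of the function `owner u`, and `dual u` is the set of items
covering `u`.  Thus the collection `𝒮 i` of dual sets of the `i`-th function is the indexed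
collection of all `dual u` with `owner u = i` (a set may occur several times). -/
structure CoverageFamily (n m : ℕ) where
  numElems : ℕ
  owner : Fin numElems → Fin m
  dual : Fin numElems → Finset (Fin n)

/-- The `i`-th coverage function `T ↦ ∑_{S ∈ 𝒮 i} min {|S ∩ T|, 1}`. -/
def CoverageFamily.value {n m : ℕ} (F : CoverageFamily n m) (i : Fin m)
    (T : Finset (Fin n)) : ℝ :=
  ((∑ u ∈ Finset.univ.filter (fun u => F.owner u = i), min (F.dual u ∩ T).card 1 : ℕ) : ℝ)

/-- Every item covers at most `t` elements across all functions. -/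
def CoverageFamily.Sparse {n m : ℕ} (F : CoverageFamily n m) (t : ℕ) : Prop :=
  ∀ j : Fin n, (Finset.univ.filter (fun u => j ∈ F.dual u)).card ≤ t

/-- The items of colour `l`. -/
def colorClass {n k : ℕ} (χ : Fin n → Fin k) (l : Fin k) : Finset (Fin n) :=
  Finset.univ.filter (fun j => χ j = l)

/-- The discrepancy `max_i max_{l, l'} |f i (χ⁻¹ l) - f i (χ⁻¹ l')|` of a colouring (a supremum
over a finite index set; it is `0` if there are no functions). -/
noncomputable def disc {n m k : ℕ} (f : Fin m → Finset (Fin n) → ℝ) (χ : Fin n → Fin k) : ℝ :=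
  ⨆ p : Fin m × Fin k × Fin k,
    |f p.1 (colorClass χ p.2.1) - f p.1 (colorClass χ p.2.2)|

/-! ### Randomized random access machine with bit costs

A machine has arrays `0, 1, 2, …` of natural numbers, of which a program mentions finitely many.
Time is logarithmic cost: an access is charged for the bits of the index and of the entry, and an
arithmetic operation for the product of the bit lengths of its operands. -/

/-- The contents of the arrays: `σ a i` is entry `i` of array `a`. -/
abbrev Store := ℕ → ℕ → ℕ

/-- Arithmetic operations on natural numbers (subtraction truncated, division rounded down). -/
inductive Op where
  | add | sub | mul | div

def Op.apply : Op → ℕ → ℕ → ℕ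
  | .add, x, y => x + y
  | .sub, x, y => x - y
  | .mul, x, y => x * y
  | .div, x, y => x / y

inductive Expr where
  | const (c : ℕ)
  | read (a : ℕ) (idx : Expr)
  | op (o : Op) (e₁ e₂ : Expr)

def Expr.eval (σ : Store) : Expr → ℕ
  | .const c => c
  | .read a idx => σ a (idx.eval σ)
  | .op o e₁ e₂ => o.apply (e₁.eval σ) (e₂.eval σ)

/-- Time for evaluating an expression. -/
def Expr.cost (σ : Store) : Expr → ℕ
  | .const c => 1 + Nat.size c
  | .read a idx => idx.cost σ + 1 + Nat.size (idx.eval σ) + Nat.size (σ a (idx.eval σ))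
  | .op _ e₁ e₂ => e₁.cost σ + e₂.cost σ
      + (1 + Nat.size (e₁.eval σ)) * (1 + Nat.size (e₂.eval σ))

inductive Program where
  /-- do nothing -/
  | skip
  /-- entry `idx` of array `a` becomes the value of `e` -/
  | assign (a : ℕ) (idx e : Expr)
  /-- entry `idx` of array `a` becomes a fresh random bit -/
  | flip (a : ℕ) (idx : Expr)
  | seq (P Q : Program)
  /-- run `P` if `e` is nonzero, and `Q` otherwise -/
  | ite (e : Expr) (P Q : Program)
  /-- run `P` as long as `e` is nonzero -/
  | loop (e : Expr) (P : Program)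

/-- Overwrite one array entry. -/
def Store.write (σ : Store) (a i v : ℕ) : Store :=
  Function.update σ a (Function.update (σ a) i v)

/-- `Exec P σ r σ' r' T`: started on the store `σ` with the random bits `r` still unread, the
program `P` halts after time `T` with the store `σ'` and the random bits `r'` still unread. -/
inductive Exec : Program → Store → List Bool → Store → List Bool → ℕ → Prop
  | skip (σ r) : Exec .skip σ r σ r 1
  | assign (a idx e σ r) :
      Exec (.assign a idx e) σ r (σ.write a (idx.eval σ) (e.eval σ)) r
        (idx.cost σ + e.cost σ + 1)
  | flip (a idx σ b r) :
      Exec (.flip a idx) σ (b :: r) (σ.write a (idx.eval σ) (Bool.toNat b)) r (idx.cost σ + 1)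
  | seq {P Q σ₀ r₀ σ₁ r₁ σ₂ r₂ T₁ T₂} :
      Exec P σ₀ r₀ σ₁ r₁ T₁ → Exec Q σ₁ r₁ σ₂ r₂ T₂ → Exec (.seq P Q) σ₀ r₀ σ₂ r₂ (T₁ + T₂)
  | ite_true {e P Q σ r σ' r' T} :
      e.eval σ ≠ 0 → Exec P σ r σ' r' T → Exec (.ite e P Q) σ r σ' r' (e.cost σ + 1 + T)
  | ite_false {e P Q σ r σ' r' T} :
      e.eval σ = 0 → Exec Q σ r σ' r' T → Exec (.ite e P Q) σ r σ' r' (e.cost σ + 1 + T)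
  | loop_stop {e P σ r} :
      e.eval σ = 0 → Exec (.loop e P) σ r σ r (e.cost σ + 1)
  | loop_step {e P σ₀ r₀ σ₁ r₁ σ₂ r₂ T₁ T₂} :
      e.eval σ₀ ≠ 0 → Exec P σ₀ r₀ σ₁ r₁ T₁ → Exec (.loop e P) σ₁ r₁ σ₂ r₂ T₂ →
      Exec (.loop e P) σ₀ r₀ σ₂ r₂ (e.cost σ₀ + 1 + T₁ + T₂)

/-! ### Computing colourings -/

/-- The input.  Array `0` holds `n`, `m`, `k` and the number of elements; entry `u` of array `1`
is the function to which the element `u` belongs; entry `u * n + j` of array `2` is `1` if item `j`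
covers the element `u`; all other entries are `0`. -/
def CoverageFamily.input {n m : ℕ} (F : CoverageFamily n m) (k : ℕ) : Store
  | 0, 0 => n
  | 0, 1 => m
  | 0, 2 => k
  | 0, 3 => F.numElems
  | 1, u => if h : u < F.numElems then (F.owner ⟨u, h⟩ : ℕ) else 0
  | 2, q =>
      if h : q / n < F.numElems ∧ q % n < n then
        if (⟨q % n, h.2⟩ : Fin n) ∈ F.dual ⟨q / n, h.1⟩ then 1 else 0
      else 0
  | _, _ => 0

/-- The size of an input: items, functions and elements count in unary, the number of colours
by its binary length. -/
def CoverageFamily.inputSize {n m : ℕ} (F : CoverageFamily n m) (k : ℕ) : ℕ :=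
  n + m + F.numElems + Nat.size k

/-- With the random bits `r`, the program halts on the input `(F, k)` within time `T`, and it
leaves the colour of item `j` in entry `j` of array `3`, for every item `j`. -/
def Program.Outputs {n m k : ℕ} (P : Program) (F : CoverageFamily n m) (r : List Bool) (T : ℕ)
    (χ : Fin n → Fin k) : Prop :=
  ∃ (σ : Store) (r' : List Bool) (T' : ℕ), Exec P (F.input k) r σ r' T' ∧ T' ≤ T ∧
    ∀ j : Fin n, σ 3 j = (χ j : ℕ)

/-- The probability of an event under `L` independent fair coin flips. -/
noncomputable def coinProb {L : ℕ} (E : (Fin L → Bool) → Prop) : ℝ :=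
  (Nat.card {r : Fin L → Bool // E r} : ℝ) / 2 ^ L

end SparseCoverage

/-! The algorithm flips no coins; its bound holds with probability one. If `k > n`, items get
distinct colours and every value lies between `0` and `t`. Let `k ≤ n` from here on.

Work with fractional colourings `x`, where item `j` has colour `l` with weight `x j l`, starting
from the uniform one. The expected number of elements of function `i` missed by colour `l` is
multilinear in `x`, and at the uniform point it does not depend on `l`. So it suffices to reach an
integral point while changing all these values little.

Let `e` be the number of nonempty dual sets, `L` the binary length of `ek`, `τ` one plus the largest
degree of an item. Dual sets are truncated to `k(2L+2)` items. A greedy division then needs at most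
`R = τk(2L+2)` classes so that no truncated set has two items in one class. Hence each expected
value is linear while a single class moves. The classes are rounded in turn, by the method of Beck
and Fiala: keep the sum of each live item, and keep the value of `(i, l)` as long as the live
gradient of this row exceeds `4τ`. Live items number at most half, and such rows at most a quarter,
of the fractional coordinates, so a direction exists (`exists_kernel`). A released row can change by
at most `4τ` per class (`good_shift`).

To keep the `R` changes `dev b` from adding up, the direction is oriented by a potential: the sum of
`∏ (1 + λ dev b)` and `∏ (1 - λ dev b)` over nonempty elements and colours. Earlier classes are
frozen and later ones have `dev = 0`, so it is affine along a direction, and one of the two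
orientations does not increase it (`potential_shift_le`). It starts at `2ek`. At the end, `log (1 +
z) ≥ z - 2z²` bounds `λ |∑ dev b|` by `log (2ek + 1) + 2R(4λτ)²` (`abs_sum_dev_le`). With `λ =
1/(8τr)` and `r = ⌈√(τk)⌉` the quadratic term is at most `L + 1`, so the total change is `O(τr
log(ek))`. The theorem follows, as `e ≤ nt` and `τ ≤ 2t` whenever there is something to prove.

Truncation is harmless: a second part of the potential charges `4ek` for each truncated set missed
by a colour. Under the uniform colouring this part is at most `1` (`potential_uniform_le`), so a
rounded colouring of potential at most `2ek + 1` misses none (`missing_rounded`).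

For the bit complexity, directions are exact kernel vectors of an integral Gram matrix, found by a
division-free Faddeev–LeVerrier recursion: if the matrix is singular, the last nonzero matrix of the
recursion has its columns in the kernel (`leverrier_card`, `mul_leverrier_eq_zero`). The Gram
entries have a size bound independent of the numerators of the colouring, so every round adds only
polynomially many bits (`round_safe`). The procedure is written in a small command language with
bounded loops, whose compilation has a polynomial time bound as long as all stores have short
entries. -/

namespace SparseCoverage

section

open Finset

/-! ### Polynomially bounded functions -/

/-- A function on the naturals that is dominated by a polynomial. -/
def PolyBounded (f : ℕ → ℕ) : Prop := ∃ p : Polynomial ℕ, ∀ x, f x ≤ p.eval x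

theorem eval_mono (p : Polynomial ℕ) {x y : ℕ} (h : x ≤ y) : p.eval x ≤ p.eval y := by
  rw [Polynomial.eval_eq_sum, Polynomial.eval_eq_sum]
  exact Finset.sum_le_sum fun i _ => Nat.mul_le_mul_left _ (Nat.pow_le_pow_left h i)

namespace PolyBounded

theorem const (c : ℕ) : PolyBounded fun _ => c := ⟨Polynomial.C c, by simp⟩

theorem id : PolyBounded fun x => x := ⟨Polynomial.X, by simp⟩

theorem add {f g : ℕ → ℕ} : PolyBounded f → PolyBounded g → PolyBounded fun x => f x + g x
  | ⟨p, hp⟩, ⟨q, hq⟩ => ⟨p + q, fun x => by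
    rw [Polynomial.eval_add]; exact Nat.add_le_add (hp x) (hq x)⟩

theorem mul {f g : ℕ → ℕ} : PolyBounded f → PolyBounded g → PolyBounded fun x => f x * g x
  | ⟨p, hp⟩, ⟨q, hq⟩ => ⟨p * q, fun x => by
    rw [Polynomial.eval_mul]; exact Nat.mul_le_mul (hp x) (hq x)⟩

theorem comp {f g : ℕ → ℕ} : PolyBounded f → PolyBounded g → PolyBounded fun x => f (g x)
  | ⟨p, hp⟩, ⟨q, hq⟩ => ⟨p.comp q, fun x => by
    rw [Polynomial.eval_comp]; exact (hp _).trans (eval_mono p (hq x))⟩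

end PolyBounded

/-! ### Binary lengths -/

theorem size_add_le (x y : ℕ) : (x + y).size ≤ x.size + y.size + 1 := by
  rw [Nat.size_le, pow_succ, pow_add]
  have h1 := Nat.lt_size_self x
  have h2 := Nat.lt_size_self y
  have h3 : 1 ≤ 2 ^ x.size := Nat.one_le_two_pow
  have h4 : 1 ≤ 2 ^ y.size := Nat.one_le_two_pow
  nlinarith

theorem size_mul_le (x y : ℕ) : (x * y).size ≤ x.size + y.size := by
  rw [Nat.size_le, pow_add]
  exact Nat.mul_lt_mul'' (Nat.lt_size_self x) (Nat.lt_size_self y)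

theorem size_le_self (x : ℕ) : x.size ≤ x := Nat.size_le.2 Nat.lt_two_pow_self

theorem size_le_of_le {x y : ℕ} (h : x ≤ y) : x.size ≤ y := (size_le_self x).trans h

/-- Additivity of lengths is what makes a fold of `Q` operations grow only linearly in `Q`,
whichever operation is folded. -/
theorem Op.size_apply_le (o : Op) (x y : ℕ) : (o.apply x y).size ≤ x.size + y.size + 1 := by
  cases o
  · exact size_add_le x y
  · exact (Nat.size_le_size (Nat.sub_le x y)).trans (by omega)
  · exact (size_mul_le x y).trans (by omega)
  · exact (Nat.size_le_size (Nat.div_le_self x y)).trans (by omega)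

/-! ### Machine stores and counted loops -/

/-- The machine store holding the user arrays `U`, a stack of intermediate results, the loop
variables of expressions, a scratch array and the loop counters of commands. -/
def machine (U : Store) (tmp env scr cnt : ℕ → ℕ) : Store
  | 0 => U 0 | 1 => U 1 | 2 => U 2 | 3 => U 3
  | 4 => tmp | 5 => env | 6 => scr | 7 => cnt
  | a + 8 => U (a + 4)

/-- The machine array that holds user array `a`. -/
def slot (a : ℕ) : ℕ := if a < 4 then a else a + 4

section machine
variable (U : Store) (tmp env scr cnt : ℕ → ℕ)

@[simp] theorem machine_four : machine U tmp env scr cnt 4 = tmp := rfl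
@[simp] theorem machine_five : machine U tmp env scr cnt 5 = env := rfl
@[simp] theorem machine_six : machine U tmp env scr cnt 6 = scr := rfl
@[simp] theorem machine_seven : machine U tmp env scr cnt 7 = cnt := rfl
@[simp] theorem machine_zero : machine U tmp env scr cnt 0 = U 0 := rfl

@[simp] theorem machine_slot (a : ℕ) : machine U tmp env scr cnt (slot a) = U a := by
  rcases a with _ | _ | _ | _ | a <;> rfl

@[simp] theorem machine_write_four (i v : ℕ) : (machine U tmp env scr cnt).write 4 i v =
    machine U (Function.update tmp i v) env scr cnt := by
  funext a
  rcases a with _ | _ | _ | _ | _ | _ | _ | _ | a <;> rfl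

@[simp] theorem machine_write_five (i v : ℕ) : (machine U tmp env scr cnt).write 5 i v =
    machine U tmp (Function.update env i v) scr cnt := by
  funext a
  rcases a with _ | _ | _ | _ | _ | _ | _ | _ | a <;> rfl

@[simp] theorem machine_write_six (i v : ℕ) : (machine U tmp env scr cnt).write 6 i v =
    machine U tmp env (Function.update scr i v) cnt := by
  funext a
  rcases a with _ | _ | _ | _ | _ | _ | _ | _ | a <;> rfl

@[simp] theorem machine_write_seven (i v : ℕ) : (machine U tmp env scr cnt).write 7 i v =
    machine U tmp env scr (Function.update cnt i v) := by
  funext a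
  rcases a with _ | _ | _ | _ | _ | _ | _ | _ | a <;> rfl

theorem slot_eq (a b : ℕ) : slot a = slot b ↔ a = b := by
  unfold slot; split_ifs <;> omega

@[simp] theorem machine_write_slot (a i v : ℕ) : (machine U tmp env scr cnt).write (slot a) i v =
    machine (U.write a i v) tmp env scr cnt := by
  funext b
  by_cases hb : ∃ c, b = slot c
  · obtain ⟨c, rfl⟩ := hb
    rw [machine_slot]
    unfold Store.write
    by_cases h : c = a
    · subst h; simp
    · rw [Function.update_of_ne (by rwa [Ne, slot_eq]), Function.update_of_ne h, machine_slot]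
  · have h1 : b ≠ slot a := fun h => hb ⟨a, h⟩
    unfold Store.write
    rw [Function.update_of_ne h1]
    have : b = 4 ∨ b = 5 ∨ b = 6 ∨ b = 7 := by
      by_contra h
      apply hb
      by_cases h4 : b < 4
      · exact ⟨b, by simp [slot, h4]⟩
      · exact ⟨b - 4, by unfold slot; split_ifs <;> omega⟩
    rcases this with rfl | rfl | rfl | rfl <;> rfl

end machine

/-- The rule for every compiled loop. The invariant carries the iteration number; the factor `N + 1`
includes the last, failing test. No random bit is consumed. -/
theorem exec_countdown {e : Expr} {P : Program} {N c t : ℕ} {r : List Bool}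
    (Inv : ℕ → Store → Prop)
    (hcost : ∀ q ≤ N, ∀ σ, Inv q σ → e.cost σ ≤ c)
    (hstep : ∀ q < N, ∀ σ, Inv q σ → e.eval σ ≠ 0 ∧
      ∃ σ' T, Exec P σ r σ' r T ∧ T ≤ t ∧ Inv (q + 1) σ')
    (hend : ∀ σ, Inv N σ → e.eval σ = 0) {σ : Store} (h0 : Inv 0 σ) :
    ∃ σ' T, Exec (.loop e P) σ r σ' r T ∧ T ≤ (N + 1) * (c + 1 + t) ∧ Inv N σ' := by
  suffices H : ∀ d q, q + d = N → ∀ σ, Inv q σ →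
      ∃ σ' T, Exec (.loop e P) σ r σ' r T ∧ T ≤ (d + 1) * (c + 1 + t) ∧ Inv N σ' from
    H N 0 (by omega) σ h0
  intro d
  induction d with
  | zero =>
    intro q hq σ hσ
    obtain rfl : q = N := by omega
    exact ⟨σ, _, Exec.loop_stop (hend σ hσ), by have := hcost q le_rfl σ hσ; omega, hσ⟩
  | succ d ih =>
    intro q hq σ hσ
    obtain ⟨hne, σ₁, T₁, h1, hT1, hI1⟩ := hstep q (by omega) σ hσ
    obtain ⟨σ₂, T₂, h2, hT2, hI2⟩ := ih (q + 1) (by omega) σ₁ hI1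
    refine ⟨σ₂, _, .loop_step hne h1 h2, ?_, hI2⟩
    have := hcost q (by omega) σ hσ
    calc e.cost σ + 1 + T₁ + T₂ ≤ c + 1 + t + (d + 1) * (c + 1 + t) := by omega
      _ = (d + 1 + 1) * (c + 1 + t) := by ring

/-! ### Expressions with bounded iteration -/

/-- The values `init`, `init ∘ f 0`, `(init ∘ f 0) ∘ f 1`, … for an operation `∘`. -/
def foldTo (o : Op) (init : ℕ) (f : ℕ → ℕ) : ℕ → ℕ
  | 0 => init
  | q + 1 => o.apply (foldTo o init f q) (f q)

/-- Expressions with loop variables; `fold o init v c e` combines the values of `e` for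
`v = 0, 1, …` below entry `c` of array `0`. -/
inductive NatExpr where
  | const (c : ℕ)
  | var (v : ℕ)
  | read (a : ℕ) (idx : NatExpr)
  | op (o : Op) (e₁ e₂ : NatExpr)
  | fold (o : Op) (init v c : ℕ) (e : NatExpr)

namespace NatExpr

def eval (U : Store) : (ℕ → ℕ) → NatExpr → ℕ
  | _, const c => c
  | env, var v => env v
  | env, read a idx => U a (idx.eval U env)
  | env, op o e₁ e₂ => o.apply (e₁.eval U env) (e₂.eval U env)
  | env, fold o init v c e => foldTo o init (fun q => e.eval U (Function.update env v q)) (U 0 c)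

/-- A program leaving the value of an expression in entry `d` of the stack. -/
def compile : NatExpr → ℕ → Program
  | const c, d => .assign 4 (.const d) (.const c)
  | var v, d => .assign 4 (.const d) (.read 5 (.const v))
  | read a idx, d => .seq (idx.compile d) (.assign 4 (.const d) (.read (slot a) (.read 4 (.const d))))
  | op o e₁ e₂, d => .seq (e₁.compile d) (.seq (e₂.compile (d + 1))
      (.assign 4 (.const d) (.op o (.read 4 (.const d)) (.read 4 (.const (d + 1))))))
  | fold o init v c e, d =>
    .seq (.assign 4 (.const d) (.const init))
    -- The outer value of the loop variable waits on the stack and is restored after the loop, so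
    -- the fold has no side effect on the variables.
    (.seq (.assign 4 (.const (d + 1)) (.read 5 (.const v)))
    (.seq (.assign 5 (.const v) (.const 0))
    (.seq (.loop (.op .sub (.read 0 (.const c)) (.read 5 (.const v)))
      (.seq (e.compile (d + 2))
      (.seq (.assign 4 (.const d) (.op o (.read 4 (.const d)) (.read 4 (.const (d + 2)))))
        (.assign 5 (.const v) (.op .add (.read 5 (.const v)) (.const 1))))))
    (.assign 5 (.const v) (.read 4 (.const (d + 1)))))))

/-- A bound for the binary length of the value. -/
def sizeBound : NatExpr → ℕ → ℕ
  | const c, _ => c.size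
  | var _, Q => Q
  | read _ _, Q => Q
  | op _ e₁ e₂, Q => e₁.sizeBound Q + e₂.sizeBound Q + 1
  | fold _ init _ _ e, Q => Q * (e.sizeBound Q + 1) + init.size

/-- A bound for the running time of the compiled program. -/
def timeBound : NatExpr → ℕ → ℕ → ℕ
  | const c, d, _ => d.size + c.size + 3
  | var v, d, Q => d.size + 2 * v.size + Q + 4
  | read _ idx, d, Q => idx.timeBound d Q + 3 * d.size + 2 * idx.sizeBound Q + Q + 10
  | op _ e₁ e₂, d, Q => e₁.timeBound d Q + e₂.timeBound (d + 1) Q + 3 * d.size + 2 * (d + 1).size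
      + e₁.sizeBound Q + e₂.sizeBound Q + (1 + e₁.sizeBound Q) * (1 + e₂.sizeBound Q) + 6
  | fold o init v c e, d, Q =>
      (d.size + init.size + 3) + ((d + 1).size + 2 * v.size + Q + 4) + (v.size + 3)
      + (Q + 1) * ((2 * c.size + 2 * v.size + 2 * Q + 4 + (1 + Q) * (1 + Q)) + 1 +
        (e.timeBound (d + 2) Q + (3 * d.size + 2 * (d + 2).size
          + sizeBound (fold o init v c e) Q + e.sizeBound Q
          + (1 + sizeBound (fold o init v c e) Q) * (1 + e.sizeBound Q) + 6)
          + (3 * v.size + Q + (1 + Q) * 2 + 7)))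
      + (v.size + 2 * (d + 1).size + Q + 4)

theorem polyBounded_sizeBound (e : NatExpr) : PolyBounded e.sizeBound := by
  induction e with
  | const c => exact .const _
  | var v => exact .id
  | read a idx ih => exact .id
  | op o e₁ e₂ h1 h2 => exact (h1.add h2).add (.const 1)
  | fold o init v c e ih => exact (PolyBounded.id.mul (ih.add (.const 1))).add (.const _)

theorem polyBounded_timeBound (e : NatExpr) (d : ℕ) : PolyBounded (e.timeBound d) := by
  induction e generalizing d with
  | const c => exact .const _
  | var v => exact (PolyBounded.add (.const _) .id).add (.const _)
  | read a idx ih =>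
    exact ((((ih d).add (.const _)).add ((PolyBounded.const 2).mul idx.polyBounded_sizeBound)).add
      .id).add (.const _)
  | op o e₁ e₂ h1 h2 =>
    have s1 := e₁.polyBounded_sizeBound
    have s2 := e₂.polyBounded_sizeBound
    exact (((((((h1 d).add (h2 (d + 1))).add (.const _)).add (.const _)).add s1).add s2).add
      (((PolyBounded.const 1).add s1).mul ((PolyBounded.const 1).add s2))).add (.const _)
  | fold o init v c e ih =>
    have s1 := (fold o init v c e).polyBounded_sizeBound
    have s2 := e.polyBounded_sizeBound
    have q := PolyBounded.id
    have one := PolyBounded.const 1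
    refine (((((PolyBounded.const _).add (((PolyBounded.const _).add q).add (.const _))).add
      (.const _)).add ((q.add one).mul ((((((PolyBounded.const _).add ((PolyBounded.const 2).mul q)).add
        (.const 4)).add ((one.add q).mul (one.add q))).add one).add ?_)))).add
        (((PolyBounded.const _).add q).add (.const _))
    exact ((ih (d + 2)).add (((((PolyBounded.const _).add s1).add s2).add
      ((one.add s1).mul (one.add s2))).add (.const _))).add
      ((((PolyBounded.const _).add q).add ((one.add q).mul (.const 2))).add (.const _))

end NatExpr

/-- All entries have at most `Q` bits, and those of array `0` are at most `Q`. -/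
def Store.Bounded (Q : ℕ) (U : Store) : Prop := (∀ a i, (U a i).size ≤ Q) ∧ ∀ i, U 0 i ≤ Q

theorem size_foldTo_le {o : Op} {init : ℕ} {f : ℕ → ℕ} {s N : ℕ} (h : ∀ q < N, (f q).size ≤ s) :
    (foldTo o init f N).size ≤ N * (s + 1) + init.size := by
  induction N with
  | zero => simp [foldTo]
  | succ N ih =>
    refine (o.size_apply_le _ _).trans ?_
    have h1 := ih fun q hq => h q (by omega)
    have h2 := h N (by omega)
    calc _ ≤ N * (s + 1) + init.size + s + 1 := by omega
      _ = _ := by ring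

theorem bounded_update {Q : ℕ} {env : ℕ → ℕ} (h : ∀ v, env v ≤ Q) {v q : ℕ} (hq : q ≤ Q) :
    ∀ w, Function.update env v q w ≤ Q := by
  intro w
  by_cases hw : w = v
  · subst hw; simpa using hq
  · simpa [Function.update_of_ne hw] using h w

namespace NatExpr

theorem size_eval_le (e : NatExpr) {Q : ℕ} {U : Store} (hU : U.Bounded Q) {env : ℕ → ℕ}
    (henv : ∀ v, env v ≤ Q) : (e.eval U env).size ≤ e.sizeBound Q := by
  induction e generalizing env with
  | const c => exact le_rfl
  | var v => exact size_le_of_le (henv v)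
  | read a idx ih => exact hU.1 _ _
  | op o e₁ e₂ h1 h2 =>
    exact (o.size_apply_le _ _).trans (by have := h1 henv; have := h2 henv; simp only [sizeBound]; omega)
  | fold o init v c e ih =>
    refine (size_foldTo_le (s := e.sizeBound Q) fun q hq =>
      ih (bounded_update henv (hq.le.trans (hU.2 c)))).trans ?_
    exact Nat.add_le_add_right (Nat.mul_le_mul_right _ (hU.2 c)) _

/-- Stack discipline: entries below `d` survive, so a first operand at `d` is still there after the
second has been evaluated at `d + 1`. User arrays and loop variables are unchanged. -/
theorem exec_compile (e : NatExpr) (d : ℕ) {Q : ℕ} {U : Store} (hU : U.Bounded Q) {env : ℕ → ℕ}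
    (henv : ∀ v, env v ≤ Q) (tmp scr cnt : ℕ → ℕ) (r : List Bool) :
    ∃ tmp' T, Exec (e.compile d) (machine U tmp env scr cnt) r (machine U tmp' env scr cnt) r T ∧
      T ≤ e.timeBound d Q ∧ tmp' d = e.eval U env ∧ ∀ i < d, tmp' i = tmp i := by
  induction e generalizing d env tmp with
  | const c =>
    have h := Exec.assign 4 (.const d) (.const c) (machine U tmp env scr cnt) r
    simp only [Expr.eval, machine_write_four] at h
    refine ⟨_, _, h, ?_, by simp [eval], ?_⟩
    · simp only [Expr.cost, timeBound]; omega
    · intro i hi; exact Function.update_of_ne hi.ne _ _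
  | var v =>
    have h := Exec.assign 4 (.const d) (.read 5 (.const v)) (machine U tmp env scr cnt) r
    simp only [Expr.eval, machine_write_four, machine_five] at h
    refine ⟨_, _, h, ?_, by simp [eval], ?_⟩
    · have := size_le_of_le (henv v)
      simp only [Expr.cost, Expr.eval, timeBound, machine_five]; omega
    · intro i hi; exact Function.update_of_ne hi.ne _ _
  | read a idx ih =>
    obtain ⟨tmp', T, hx, hT, hv, hk⟩ := ih d henv tmp
    have h2 := Exec.assign 4 (.const d) (.read (slot a) (.read 4 (.const d)))
      (machine U tmp' env scr cnt) r
    simp only [Expr.eval, machine_write_four, machine_slot, machine_four, hv] at h2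
    refine ⟨_, _, .seq hx h2, ?_, by simp [eval], ?_⟩
    · have h3 := idx.size_eval_le hU henv
      have h4 := hU.1 a (idx.eval U env)
      simp only [Expr.cost, Expr.eval, timeBound, machine_four, machine_slot, hv]
      omega
    · intro i hi; rw [Function.update_of_ne hi.ne, hk i hi]
  | op o e₁ e₂ h1 h2 =>
    obtain ⟨t1, T1, hx1, hT1, hv1, hk1⟩ := h1 d henv tmp
    obtain ⟨t2, T2, hx2, hT2, hv2, hk2⟩ := h2 (d + 1) henv t1
    have h3 := Exec.assign 4 (.const d) (.op o (.read 4 (.const d)) (.read 4 (.const (d + 1))))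
      (machine U t2 env scr cnt) r
    have hv1' : t2 d = e₁.eval U env := (hk2 d (by omega)).trans hv1
    simp only [Expr.eval, machine_write_four, machine_four, hv1', hv2] at h3
    refine ⟨_, _, .seq hx1 (.seq hx2 h3), ?_, by simp [eval], ?_⟩
    · have s1 := e₁.size_eval_le hU henv
      have s2 := e₂.size_eval_le hU henv
      have s3 := Nat.mul_le_mul (Nat.add_le_add_left s1 1) (Nat.add_le_add_left s2 1)
      simp only [Expr.cost, Expr.eval, timeBound, machine_four, hv1', hv2]
      omega
    · intro i hi; rw [Function.update_of_ne hi.ne, hk2 i (by omega), hk1 i hi]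
  | fold o init v c e ih =>
    have a1 := Exec.assign 4 (.const d) (.const init) (machine U tmp env scr cnt) r
    simp only [Expr.eval, machine_write_four] at a1
    set t1 := Function.update tmp d init with ht1
    have a2 := Exec.assign 4 (.const (d + 1)) (.read 5 (.const v)) (machine U t1 env scr cnt) r
    simp only [Expr.eval, machine_write_four, machine_five] at a2
    set t2 := Function.update t1 (d + 1) (env v) with ht2
    have a3 := Exec.assign 5 (.const v) (.const 0) (machine U t2 env scr cnt) r
    simp only [Expr.eval, machine_write_five] at a3
    set f : ℕ → ℕ := fun q => e.eval U (Function.update env v q) with hf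
    have hcQ := hU.2 c
    have hfs : ∀ q < U 0 c, (f q).size ≤ e.sizeBound Q := fun q hq =>
      e.size_eval_le hU (bounded_update henv (hq.le.trans hcQ))
    have hacc : ∀ q ≤ U 0 c,
        (foldTo o init f q).size ≤ sizeBound (fold o init v c e) Q := fun q hq =>
      (size_foldTo_le fun q' hq' => hfs q' (by omega)).trans
        (Nat.add_le_add_right (Nat.mul_le_mul_right _ (hq.trans hcQ)) _)
    obtain ⟨σ', T, hx, hT, t', rfl, ht'd, ht'1, ht'k⟩ := exec_countdown (r := r) (N := U 0 c)
      (e := .op .sub (.read 0 (.const c)) (.read 5 (.const v)))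
      (P := .seq (e.compile (d + 2))
        (.seq (.assign 4 (.const d) (.op o (.read 4 (.const d)) (.read 4 (.const (d + 2)))))
        (.assign 5 (.const v) (.op .add (.read 5 (.const v)) (.const 1)))))
      (c := 2 * c.size + 2 * v.size + 2 * Q + 4 + (1 + Q) * (1 + Q))
      (t := e.timeBound (d + 2) Q + (3 * d.size + 2 * (d + 2).size
          + sizeBound (fold o init v c e) Q + e.sizeBound Q
          + (1 + sizeBound (fold o init v c e) Q) * (1 + e.sizeBound Q) + 6)
          + (3 * v.size + Q + (1 + Q) * 2 + 7))
      (fun q σ => ∃ t', σ = machine U t' (Function.update env v q) scr cnt ∧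
        t' d = foldTo o init f q ∧ t' (d + 1) = env v ∧ ∀ i < d, t' i = tmp i)
      (by
        rintro q hq _ ⟨t', rfl, -⟩
        have b1 : (U 0 c).size ≤ Q := hU.1 0 c
        have b2 : q.size ≤ Q := size_le_of_le (hq.trans hcQ)
        have b3 := Nat.mul_le_mul (Nat.add_le_add_left b1 1) (Nat.add_le_add_left b2 1)
        simp only [Expr.cost, Expr.eval, machine_zero, machine_five, Function.update_self]
        omega)
      (by
        rintro q hq _ ⟨t', rfl, hd, h1, hk⟩
        refine ⟨by simp [Expr.eval, Op.apply]; omega, ?_⟩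
        have hqQ : q ≤ Q := hq.le.trans hcQ
        obtain ⟨t3, T3, hx3, hT3, hv3, hk3⟩ := ih (d + 2) (bounded_update henv hqQ) t'
        have b1 := Exec.assign 4 (.const d) (.op o (.read 4 (.const d)) (.read 4 (.const (d + 2))))
          (machine U t3 (Function.update env v q) scr cnt) r
        have hd3 : t3 d = foldTo o init f q := (hk3 d (by omega)).trans hd
        simp only [Expr.eval, machine_write_four, machine_four, hd3, hv3] at b1
        set t4 := Function.update t3 d (o.apply (foldTo o init f q)
          (eval U (Function.update env v q) e)) with ht4
        have b2 := Exec.assign 5 (.const v) (.op .add (.read 5 (.const v)) (.const 1))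
          (machine U t4 (Function.update env v q) scr cnt) r
        simp only [Expr.eval, machine_write_five, machine_five, Function.update_self,
          Function.update_idem, Op.apply] at b2
        refine ⟨_, _, .seq hx3 (.seq b1 b2), ?_, t4, rfl, ?_, ?_, ?_⟩
        · have s1 := hacc q hq.le
          have s2 : (e.eval U (Function.update env v q)).size ≤ _ := hfs q hq
          have s3 := Nat.mul_le_mul (Nat.add_le_add_left s1 1) (Nat.add_le_add_left s2 1)
          have s4 := size_le_of_le hqQ
          have s5 := Nat.mul_le_mul_right 2 (Nat.add_le_add_left s4 1)
          simp only [Expr.cost, Expr.eval, machine_four, machine_five, hd3, hv3,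
            Function.update_self, Nat.size_one]
          omega
        · rw [ht4, Function.update_self]; rfl
        · rw [ht4, Function.update_of_ne (by omega), hk3 _ (by omega), h1]
        · intro i hi
          rw [ht4, Function.update_of_ne hi.ne, hk3 _ (by omega), hk i hi])
      (by rintro _ ⟨t', rfl, -⟩; simp [Expr.eval, Op.apply])
      (σ := machine U t2 (Function.update env v 0) scr cnt)
      ⟨t2, rfl, by rw [ht2, Function.update_of_ne (by omega), ht1, Function.update_self]; rfl,
        by rw [ht2, Function.update_self],
        fun i hi => by
          rw [ht2, Function.update_of_ne (by omega), ht1, Function.update_of_ne (by omega)]⟩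
    have a4 := Exec.assign 5 (.const v) (.read 4 (.const (d + 1)))
      (machine U t' (Function.update env v (U 0 c)) scr cnt) r
    simp only [Expr.eval, machine_write_five, machine_four, ht'1, Function.update_idem,
      Function.update_eq_self] at a4
    refine ⟨t', _, .seq a1 (.seq a2 (.seq a3 (.seq hx a4))), ?_, ht'd, ht'k⟩
    have s1 := size_le_of_le (henv v)
    have s2 := hT.trans (Nat.mul_le_mul_right _ (Nat.add_le_add_right hcQ 1))
    simp only [Expr.cost, Expr.eval, machine_four, machine_five, ht'1, timeBound, Nat.size_zero]
    generalize (Q + 1) * _ = big at s2 ⊢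
    omega

end NatExpr

/-! ### Commands acting on whole arrays -/

/-- The entry of array `0` that holds the length of user array `a`. -/
def lengthCell : ℕ → ℕ
  | 1 => 3 | 2 => 6 | 3 => 0 | 4 => 6 | 10 => 0 | 12 => 4 | 15 => 4 | 16 => 11 | 17 => 9
  | 18 => 5 | 19 => 5 | 20 => 5 | 25 => 4 | 26 => 4 | 29 => 4 | 31 => 4 | 33 => 3 | 34 => 3
  | _ => 7

/-- The nonzero entries of each array lie within its length. -/
def Store.Supported (U : Store) : Prop := ∀ a, a ≠ 0 → ∀ i, U 0 (lengthCell a) ≤ i → U a i = 0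

/-- `fill a e` recomputes all entries of array `a` from the old store (with the index in variable
`0`), and `loop c b` repeats `b` as often as entry `c` of array `0` says. -/
inductive Cmd where
  | skip
  | fill (a : ℕ) (ha : a ≠ 0) (e : NatExpr)
  | seq (b₁ b₂ : Cmd)
  | loop (c : ℕ) (b : Cmd)

namespace Cmd

def run : Cmd → Store → Store
  | skip, U => U
  | fill a _ e, U => Function.update U a
      (fun q => if q < U 0 (lengthCell a) then e.eval U (Function.update 0 0 q) else 0)
  | seq b₁ b₂, U => b₂.run (b₁.run U)
  | loop c b, U => b.run^[U 0 c] U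

/-- The number of iterations left, for the counter in entry `v` of the machine array `a`. -/
def remaining (c a v : ℕ) : Expr := .op .sub (.read 0 (.const c)) (.read a (.const v))

def increment (a v : ℕ) : Program := .assign a (.const v) (.op .add (.read a (.const v)) (.const 1))

/-- A `fill` first writes all new entries to the scratch array and copies them only then, because
its expression may read the array being replaced. Loop counters are separated by the nesting depth.
-/
def compile : Cmd → ℕ → Program
  | skip, _ => .skip
  | fill a _ e, _ =>
    .seq (.loop (remaining (lengthCell a) 5 0) (.seq (e.compile 0)
      (.seq (.assign 6 (.read 5 (.const 0)) (.read 4 (.const 0))) (increment 5 0))))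
    (.seq (.assign 5 (.const 0) (.const 0))
    (.seq (.loop (remaining (lengthCell a) 5 0)
      (.seq (.assign (slot a) (.read 5 (.const 0)) (.read 6 (.read 5 (.const 0)))) (increment 5 0)))
    (.assign 5 (.const 0) (.const 0))))
  | seq b₁ b₂, d => .seq (b₁.compile d) (b₂.compile d)
  | loop c b, d => .seq (.assign 7 (.const d) (.const 0))
      (.loop (remaining c 7 d) (.seq (b.compile (d + 1)) (increment 7 d)))

/-- All stores that occur while a command runs are bounded. -/
def Safe (Q : ℕ) : Cmd → Store → Prop
  | skip, _ => True
  | fill _ _ _, U => U.Bounded Q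
  | seq b₁ b₂, U => b₁.Safe Q U ∧ b₂.Safe Q (b₁.run U)
  | loop c b, U => U.Bounded Q ∧ ∀ i < U 0 c, b.Safe Q (b.run^[i] U)

def guardBound (c v Q : ℕ) : ℕ := 2 * c.size + 2 * v.size + 2 * Q + 4 + (1 + Q) * (1 + Q)

def incrementBound (v Q : ℕ) : ℕ := 3 * v.size + Q + (1 + Q) * 2 + 7

def timeBound : Cmd → ℕ → ℕ → ℕ
  | skip, _, _ => 1
  | fill a _ e, _, Q =>
    (Q + 1) * (guardBound (lengthCell a) 0 Q + 1 +
      (e.timeBound 0 Q + (Q + e.sizeBound Q + 5 + incrementBound 0 Q))) + 3 +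
    (Q + 1) * (guardBound (lengthCell a) 0 Q + 1 +
      (3 * Q + e.sizeBound Q + 6 + incrementBound 0 Q)) + 3
  | seq b₁ b₂, d, Q => b₁.timeBound d Q + b₂.timeBound d Q
  | loop c b, d, Q => d.size + 3 +
      (Q + 1) * (guardBound c d Q + 1 + (b.timeBound (d + 1) Q + incrementBound d Q))

theorem polyBounded_guardBound (c v : ℕ) : PolyBounded (guardBound c v) :=
  ((((PolyBounded.const _).add (.const _)).add ((PolyBounded.const 2).mul .id)).add (.const 4)).add
    (((PolyBounded.const 1).add .id).mul ((PolyBounded.const 1).add .id))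

theorem polyBounded_incrementBound (v : ℕ) : PolyBounded (incrementBound v) :=
  (((PolyBounded.const _).add .id).add (((PolyBounded.const 1).add .id).mul (.const 2))).add
    (.const 7)

theorem polyBounded_timeBound (b : Cmd) (d : ℕ) : PolyBounded (b.timeBound d) := by
  induction b generalizing d with
  | skip => exact .const 1
  | fill a ha e =>
    have g := polyBounded_guardBound (lengthCell a) 0
    have i := polyBounded_incrementBound 0
    have q := PolyBounded.id
    have q1 := q.add (.const 1)
    have s := e.polyBounded_sizeBound
    exact (((q1.mul ((g.add (.const 1)).add ((e.polyBounded_timeBound 0).add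
      (((q.add s).add (.const 5)).add i)))).add (.const 3)).add
      (q1.mul ((g.add (.const 1)).add (((((PolyBounded.const 3).mul q).add s).add (.const 6)).add
        i)))).add (.const 3)
  | seq b₁ b₂ h1 h2 => exact (h1 d).add (h2 d)
  | loop c b ih =>
    exact (PolyBounded.const _).add ((PolyBounded.id.add (.const 1)).mul
      (((polyBounded_guardBound c d).add (.const 1)).add ((ih (d + 1)).add
        (polyBounded_incrementBound d))))

/-- A `fill` cannot target array `0`; hence array lengths and iteration counts are fixed once and
for all. -/
theorem run_zero (b : Cmd) (U : Store) : b.run U 0 = U 0 := by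
  induction b generalizing U with
  | skip => rfl
  | fill a ha e => exact Function.update_of_ne ha.symm _ _
  | seq b₁ b₂ h1 h2 => exact (h2 _).trans (h1 _)
  | loop c b ih =>
    have : ∀ N, (b.run^[N] U) 0 = U 0 := by
      intro N
      induction N with
      | zero => rfl
      | succ N h => rw [Function.iterate_succ_apply', ih, h]
    exact this _

theorem iterate_run_zero (b : Cmd) (U : Store) (N : ℕ) : (b.run^[N] U) 0 = U 0 := by
  induction N with
  | zero => rfl
  | succ N h => rw [Function.iterate_succ_apply', run_zero, h]

theorem supported_run (b : Cmd) {U : Store} (hU : U.Supported) : (b.run U).Supported := by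
  induction b generalizing U with
  | skip => exact hU
  | fill a ha e =>
    intro a' ha' i hi
    rw [run_zero] at hi
    by_cases h : a' = a
    · subst h; simp [run, Nat.not_lt.2 hi]
    · simp only [run]; rw [Function.update_of_ne h]; exact hU a' ha' i hi
  | seq b₁ b₂ h1 h2 => exact h2 (h1 hU)
  | loop c b ih =>
    have : ∀ N, (b.run^[N] U).Supported := by
      intro N
      induction N with
      | zero => exact hU
      | succ N h => rw [Function.iterate_succ_apply']; exact ih h
    exact this _

theorem iterate_supported (b : Cmd) {U : Store} (hU : U.Supported) (N : ℕ) :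
    (b.run^[N] U).Supported := by
  induction N with
  | zero => exact hU
  | succ N h => rw [Function.iterate_succ_apply']; exact b.supported_run h

theorem cost_guard {σ : Store} {c a v Q : ℕ} (h1 : (σ 0 c).size ≤ Q) (h2 : (σ a v).size ≤ Q) :
    (remaining c a v).cost σ ≤ guardBound c v Q := by
  have h3 := Nat.mul_le_mul (Nat.add_le_add_left h1 1) (Nat.add_le_add_left h2 1)
  simp only [remaining, Expr.cost, Expr.eval, guardBound]
  omega

theorem cost_increment {σ : Store} {a v Q : ℕ} (h : (σ a v).size ≤ Q) :
    (Expr.const v).cost σ + (Expr.op .add (.read a (.const v)) (.const 1)).cost σ + 1 ≤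
      incrementBound v Q := by
  have h5 := Nat.mul_le_mul_right 2 (Nat.add_le_add_left h 1)
  simp only [Expr.cost, Expr.eval, incrementBound, Nat.size_one]
  omega

theorem exec_compile_fill {a : ℕ} (ha : a ≠ 0) (e : NatExpr) (d : ℕ) {Q : ℕ} {U : Store}
    (hS : U.Supported) (hU : U.Bounded Q) (tmp scr cnt : ℕ → ℕ) (r : List Bool) :
    ∃ tmp' scr' T, Exec ((fill a ha e).compile d) (machine U tmp 0 scr cnt) r
      (machine ((fill a ha e).run U) tmp' 0 scr' cnt) r T ∧ T ≤ (fill a ha e).timeBound d Q := by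
  set c := lengthCell a with hc
  set f : ℕ → ℕ := fun q => e.eval U (Function.update 0 0 q) with hf
  have h0 : ∀ v, (0 : ℕ → ℕ) v ≤ Q := fun v => Nat.zero_le _
  have hupd : Function.update (0 : ℕ → ℕ) 0 0 = 0 := by simp
  have hcQ := hU.2 c
  have hcs : (U 0 c).size ≤ Q := hU.1 0 c
  have hfs : ∀ q < U 0 c, (f q).size ≤ e.sizeBound Q := fun q hq =>
    e.size_eval_le hU (bounded_update h0 (hq.le.trans hcQ))
  obtain ⟨_, T₁, hx1, hT1, t1, s1, rfl, hs1⟩ := exec_countdown (r := r) (N := U 0 c)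
    (e := remaining c 5 0) (P := .seq (e.compile 0)
      (.seq (.assign 6 (.read 5 (.const 0)) (.read 4 (.const 0))) (increment 5 0)))
    (c := guardBound c 0 Q)
    (t := e.timeBound 0 Q + (Q + e.sizeBound Q + 5 + incrementBound 0 Q))
    (fun q σ => ∃ t s, σ = machine U t (Function.update 0 0 q) s cnt ∧ ∀ i < q, s i = f i)
    (by
      rintro q hq _ ⟨t, s, rfl, -⟩
      exact cost_guard hcs (by simpa using size_le_of_le (hq.trans hcQ)))
    (by
      rintro q hq _ ⟨t, s, rfl, hs⟩
      refine ⟨by simp [remaining, Expr.eval, Op.apply]; omega, ?_⟩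
      have hqQ : q ≤ Q := hq.le.trans hcQ
      obtain ⟨t3, T3, hx3, hT3, hv3, hk3⟩ := e.exec_compile 0 hU (bounded_update h0 hqQ) t s cnt r
      have b1 := Exec.assign 6 (.read 5 (.const 0)) (.read 4 (.const 0))
        (machine U t3 (Function.update 0 0 q) s cnt) r
      simp only [Expr.eval, machine_write_six, machine_four, machine_five, hv3,
        Function.update_self] at b1
      have b2 := Exec.assign 5 (.const 0) (.op .add (.read 5 (.const 0)) (.const 1))
        (machine U t3 (Function.update 0 0 q) (Function.update s q (f q)) cnt) r
      have c2 := cost_increment (a := 5) (v := 0) (Q := Q)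
        (σ := machine U t3 (Function.update 0 0 q) (Function.update s q (f q)) cnt)
        (by simpa using size_le_of_le hqQ)
      simp only [Expr.eval, machine_write_five, machine_five, Function.update_self,
        Function.update_idem, Op.apply] at b2
      refine ⟨_, _, .seq hx3 (.seq b1 b2), ?_, t3, _, rfl, ?_⟩
      · have s2 : (e.eval U (Function.update 0 0 q)).size ≤ _ := hfs q hq
        have s4 := size_le_of_le hqQ
        have : (Expr.read 5 (.const 0)).cost (machine U t3 (Function.update 0 0 q) s cnt) +
          (Expr.read 4 (.const 0)).cost (machine U t3 (Function.update 0 0 q) s cnt) + 1 ≤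
            Q + e.sizeBound Q + 5 := by
          simp only [Expr.cost, Expr.eval, machine_four, machine_five, hv3, Function.update_self,
            Nat.size_zero]
          omega
        omega
      · intro i hi
        by_cases h : i = q
        · subst h; simp
        · rw [Function.update_of_ne h]; exact hs i (by omega))
    (by rintro _ ⟨t, s, rfl, -⟩; simp [remaining, Expr.eval, Op.apply])
    (σ := machine U tmp 0 scr cnt)
    ⟨tmp, scr, by rw [hupd], by simp⟩
  have a2 : ∀ V t s, Exec (.assign 5 (.const 0) (.const 0))
      (machine V t (Function.update 0 0 (U 0 c)) s cnt) r (machine V t 0 s cnt) r 3 := by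
    intro V t s
    have := Exec.assign 5 (.const 0) (.const 0)
      (machine V t (Function.update 0 0 (U 0 c)) s cnt) r
    simpa [Expr.eval, Expr.cost, hupd] using this
  -- The store after `q` entries have been copied back from the scratch array.
  let V : ℕ → Store := fun q => Function.update U a fun i => if i < q then f i else U a i
  have hV0 : ∀ q, V q 0 = U 0 := fun q => Function.update_of_ne ha.symm _ _
  obtain ⟨_, T₃, hx3, hT3, rfl⟩ := exec_countdown (r := r) (N := U 0 c)
    (e := remaining c 5 0)
    (P := .seq (.assign (slot a) (.read 5 (.const 0)) (.read 6 (.read 5 (.const 0))))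
      (increment 5 0))
    (c := guardBound c 0 Q) (t := 3 * Q + e.sizeBound Q + 6 + incrementBound 0 Q)
    (fun q σ => σ = machine (V q) t1 (Function.update 0 0 q) s1 cnt)
    (by
      rintro q hq _ rfl
      exact cost_guard (by simpa [hV0] using hcs) (by simpa using size_le_of_le (hq.trans hcQ)))
    (by
      rintro q hq _ rfl
      refine ⟨by simp [remaining, Expr.eval, Op.apply, hV0]; omega, ?_⟩
      have hqQ : q ≤ Q := hq.le.trans hcQ
      have b1 := Exec.assign (slot a) (.read 5 (.const 0)) (.read 6 (.read 5 (.const 0)))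
        (machine (V q) t1 (Function.update 0 0 q) s1 cnt) r
      simp only [Expr.eval, machine_write_slot, machine_six, machine_five, hs1 q hq,
        Function.update_self] at b1
      have hw : (V q).write a q (f q) = V (q + 1) := by
        simp only [V, Store.write, Function.update_self, Function.update_idem]
        congr 1
        funext i
        by_cases h : i = q
        · subst h; simp
        · rw [Function.update_of_ne h]
          have : i < q + 1 ↔ i < q := by omega
          simp [this]
      rw [hw] at b1
      have b2 := Exec.assign 5 (.const 0) (.op .add (.read 5 (.const 0)) (.const 1))
        (machine (V (q + 1)) t1 (Function.update 0 0 q) s1 cnt) r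
      have c2 := cost_increment (a := 5) (v := 0) (Q := Q)
        (σ := machine (V (q + 1)) t1 (Function.update 0 0 q) s1 cnt)
        (by simpa using size_le_of_le hqQ)
      simp only [Expr.eval, machine_write_five, machine_five, Function.update_self,
        Function.update_idem, Op.apply] at b2
      refine ⟨_, _, .seq b1 b2, ?_, rfl⟩
      have s2 := hfs q hq
      have s4 := size_le_of_le hqQ
      have : (Expr.read 5 (.const 0)).cost (machine (V q) t1 (Function.update 0 0 q) s1 cnt) +
        (Expr.read 6 (.read 5 (.const 0))).cost (machine (V q) t1 (Function.update 0 0 q) s1 cnt) + 1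
          ≤ 3 * Q + e.sizeBound Q + 6 := by
        simp only [Expr.cost, Expr.eval, machine_five, machine_six, hs1 q hq, Function.update_self,
          Nat.size_zero]
        omega
      omega)
    (by rintro _ rfl; simp [remaining, Expr.eval, Op.apply, hV0])
    (σ := machine U t1 0 s1 cnt)
    (by
      have : V 0 = U := by simp [V]
      rw [this, hupd])
  have hrun : V (U 0 c) = (fill a ha e).run U := by
    simp only [V, run]
    congr 1
    funext i
    by_cases h : i < U 0 c
    · simp [h, ← hc, hf]
    -- Entries beyond the length are not touched by the program, whereas `run` sets them to `0`;
    -- they agree because the old store is supported.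
    · simp [h, ← hc, hS a ha i (Nat.not_lt.1 h)]
  rw [hrun] at hx3
  have hx4 := a2 ((fill a ha e).run U) t1 s1
  refine ⟨_, _, _, .seq hx1 (.seq (a2 U t1 s1) (.seq hx3 hx4)), ?_⟩
  have u1 := hT1.trans (Nat.mul_le_mul_right _ (Nat.add_le_add_right hcQ 1))
  have u3 := hT3.trans (Nat.mul_le_mul_right _ (Nat.add_le_add_right hcQ 1))
  simp only [timeBound, ← hc]
  generalize (Q + 1) * _ = x at u1 ⊢
  generalize (Q + 1) * _ = y at u3 ⊢
  omega

theorem exec_compile (b : Cmd) (d : ℕ) {Q : ℕ} {U : Store} (hS : U.Supported) (hU : b.Safe Q U)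
    (tmp scr cnt : ℕ → ℕ) (r : List Bool) :
    ∃ tmp' scr' cnt' T, Exec (b.compile d) (machine U tmp 0 scr cnt) r
      (machine (b.run U) tmp' 0 scr' cnt') r T ∧ T ≤ b.timeBound d Q ∧ ∀ i < d, cnt' i = cnt i := by
  induction b generalizing d U tmp scr cnt with
  | skip => exact ⟨tmp, scr, cnt, 1, .skip _ _, le_rfl, fun _ _ => rfl⟩
  | fill a ha e =>
    obtain ⟨t, s, T, h, hT⟩ := exec_compile_fill ha e d hS hU tmp scr cnt r
    exact ⟨t, s, cnt, T, h, hT, fun _ _ => rfl⟩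
  | seq b₁ b₂ h1 h2 =>
    obtain ⟨t1, s1, c1, T1, x1, hT1, k1⟩ := h1 d hS hU.1 tmp scr cnt
    obtain ⟨t2, s2, c2, T2, x2, hT2, k2⟩ := h2 d (b₁.supported_run hS) hU.2 t1 s1 c1
    exact ⟨t2, s2, c2, _, .seq x1 x2, Nat.add_le_add hT1 hT2,
      fun i hi => (k2 i hi).trans (k1 i hi)⟩
  | loop c b ih =>
    have hcQ := hU.1.2 c
    have a1 := Exec.assign 7 (.const d) (.const 0) (machine U tmp 0 scr cnt) r
    simp only [Expr.eval, machine_write_seven] at a1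
    obtain ⟨_, T, hx, hT, t, s, c', rfl, -, hk⟩ := exec_countdown (r := r) (N := U 0 c)
      (e := remaining c 7 d) (P := .seq (b.compile (d + 1)) (increment 7 d))
      (c := guardBound c d Q) (t := b.timeBound (d + 1) Q + incrementBound d Q)
      (fun q σ => ∃ t s c', σ = machine (b.run^[q] U) t 0 s c' ∧ c' d = q ∧ ∀ i < d, c' i = cnt i)
      (by
        rintro q hq _ ⟨t, s, c', rfl, hd, -⟩
        exact cost_guard (by simpa [iterate_run_zero] using hU.1.1 0 c)
          (by simpa [hd] using size_le_of_le (hq.trans hcQ)))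
      (by
        rintro q hq _ ⟨t, s, c', rfl, hd, hk⟩
        refine ⟨by simp [remaining, Expr.eval, Op.apply, iterate_run_zero, hd]; omega, ?_⟩
        have hqQ : q ≤ Q := hq.le.trans hcQ
        obtain ⟨t3, s3, c3, T3, hx3, hT3, hk3⟩ :=
          ih (d + 1) (b.iterate_supported hS q) (hU.2 q hq) t s c'
        rw [← Function.iterate_succ_apply' b.run] at hx3
        have hd3 : c3 d = q := (hk3 d (by omega)).trans hd
        have b2 := Exec.assign 7 (.const d) (.op .add (.read 7 (.const d)) (.const 1))
          (machine (b.run^[q + 1] U) t3 0 s3 c3) r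
        have c2 := cost_increment (a := 7) (v := d) (Q := Q)
          (σ := machine (b.run^[q + 1] U) t3 0 s3 c3) (by simpa [hd3] using size_le_of_le hqQ)
        simp only [Expr.eval, machine_write_seven, machine_seven, hd3, Op.apply] at b2
        refine ⟨_, _, .seq hx3 b2, by omega, t3, s3, _, rfl, by simp, fun i hi => ?_⟩
        rw [Function.update_of_ne hi.ne, hk3 i (by omega), hk i hi])
      (by rintro _ ⟨t, s, c', rfl, hd, -⟩
          simp [remaining, Expr.eval, Op.apply, iterate_run_zero, hd])
      (σ := machine U tmp 0 scr (Function.update cnt d 0))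
      ⟨tmp, scr, _, rfl, by simp, fun i hi => Function.update_of_ne hi.ne _ _⟩
    refine ⟨t, s, c', _, .seq a1 hx, ?_, hk⟩
    have u1 := hT.trans (Nat.mul_le_mul_right _ (Nat.add_le_add_right hcQ 1))
    simp only [timeBound, Expr.cost, Nat.size_zero]
    omega

end Cmd

namespace NatExpr

instance : Add NatExpr := ⟨op .add⟩
instance : Sub NatExpr := ⟨op .sub⟩
instance : Mul NatExpr := ⟨op .mul⟩
instance : Div NatExpr := ⟨op .div⟩
instance (n : ℕ) : OfNat NatExpr n := ⟨const n⟩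

/-- Entry `c` of array `0`. -/
def cell (c : ℕ) : NatExpr := read 0 (const c)
-- Truncated subtraction yields indicators: `1 - (1 - z)` is `1` for `z > 0` and `0` for `z = 0`.
-- Conjunctions become products.
def lt (a b : NatExpr) : NatExpr := 1 - (1 - (b - a))
def le (a b : NatExpr) : NatExpr := 1 - (a - b)
def eq (a b : NatExpr) : NatExpr := le a b * le b a
def ite (c a b : NatExpr) : NatExpr := (1 - (1 - c)) * a + (1 - c) * b
def sum (v c : ℕ) (e : NatExpr) : NatExpr := fold .add 0 v c e
def prod (v c : ℕ) (e : NatExpr) : NatExpr := fold .mul 1 v c e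
/-- The least value of variable `w` with `e ≠ 0`, below entry `c` of array `0`;
`v` is an auxiliary variable. -/
def first (v w c : ℕ) (e : NatExpr) : NatExpr := sum v c (prod w c (1 - le (var w) (var v) * e))

variable (U : Store) (env : ℕ → ℕ)

@[simp] theorem eval_add (a b : NatExpr) : (a + b).eval U env = a.eval U env + b.eval U env := rfl
@[simp] theorem eval_sub (a b : NatExpr) : (a - b).eval U env = a.eval U env - b.eval U env := rfl
@[simp] theorem eval_mul (a b : NatExpr) : (a * b).eval U env = a.eval U env * b.eval U env := rfl
@[simp] theorem eval_div (a b : NatExpr) : (a / b).eval U env = a.eval U env / b.eval U env := rfl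
@[simp] theorem eval_ofNat (n : ℕ) [n.AtLeastTwo] :
    (ofNat(n) : NatExpr).eval U env = OfNat.ofNat n := rfl
@[simp] theorem eval_zero : (0 : NatExpr).eval U env = 0 := rfl
@[simp] theorem eval_one : (1 : NatExpr).eval U env = 1 := rfl
@[simp] theorem eval_var (v : ℕ) : (var v).eval U env = env v := rfl
@[simp] theorem eval_read (a : ℕ) (i : NatExpr) : (read a i).eval U env = U a (i.eval U env) := rfl
@[simp] theorem eval_cell (c : ℕ) : (cell c).eval U env = U 0 c := rfl

@[simp] theorem eval_lt (a b : NatExpr) :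
    (lt a b).eval U env = if a.eval U env < b.eval U env then 1 else 0 := by
  simp only [lt, eval_sub, eval_one]; split_ifs <;> omega

@[simp] theorem eval_le (a b : NatExpr) :
    (le a b).eval U env = if a.eval U env ≤ b.eval U env then 1 else 0 := by
  simp only [le, eval_sub, eval_one]; split_ifs <;> omega

@[simp] theorem eval_eq (a b : NatExpr) :
    (eq a b).eval U env = if a.eval U env = b.eval U env then 1 else 0 := by
  simp only [eq, eval_mul, eval_le]; split_ifs <;> omega

@[simp] theorem eval_ite (c a b : NatExpr) :
    (ite c a b).eval U env = if c.eval U env ≠ 0 then a.eval U env else b.eval U env := by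
  simp only [ite, eval_add, eval_mul, eval_sub, eval_one]
  by_cases h : c.eval U env = 0
  · simp [h]
  · have : 1 - c.eval U env = 0 := by omega
    simp [h, this]

@[simp] theorem eval_sum (v c : ℕ) (e : NatExpr) :
    (sum v c e).eval U env = ∑ q ∈ range (U 0 c), e.eval U (Function.update env v q) := by
  simp only [sum, eval]
  induction U 0 c with
  | zero => rfl
  | succ N ih => rw [sum_range_succ, ← ih]; rfl

@[simp] theorem eval_prod (v c : ℕ) (e : NatExpr) :
    (prod v c e).eval U env = ∏ q ∈ range (U 0 c), e.eval U (Function.update env v q) := by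
  simp only [prod, eval]
  induction U 0 c with
  | zero => rfl
  | succ N ih => rw [prod_range_succ, ← ih]; rfl

end NatExpr

/-- The least `q < N` with `f q ≠ 0`, or `N` if there is none. -/
def firstIndex (f : ℕ → ℕ) (N : ℕ) : ℕ := ((range N).filter fun q => ∀ r ≤ q, f r = 0).card

theorem firstIndex_le (f : ℕ → ℕ) (N : ℕ) : firstIndex f N ≤ N :=
  (card_filter_le _ _).trans (card_range N).le

theorem firstIndex_eq {f : ℕ → ℕ} {N m : ℕ} (hm : m ≤ N) (h0 : ∀ r < m, f r = 0)
    (h1 : m < N → f m ≠ 0) : firstIndex f N = m := by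
  have : ((range N).filter fun q => ∀ r ≤ q, f r = 0) = range m := by
    ext q
    simp only [mem_filter, mem_range]
    refine ⟨fun ⟨h, h'⟩ => ?_, fun h => ⟨by omega, fun r hr => h0 r (by omega)⟩⟩
    by_contra hq
    exact h1 (by omega) (h' m (by omega))
  rw [firstIndex, this, card_range]

theorem exists_firstIndex (f : ℕ → ℕ) (N : ℕ) :
    (∀ r < firstIndex f N, f r = 0) ∧ (firstIndex f N < N → f (firstIndex f N) ≠ 0) := by
  by_cases h : ∃ q, q < N ∧ f q ≠ 0
  · classical
    have h2 := Nat.find_spec h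
    have h3 : ∀ r < Nat.find h, f r = 0 := fun r hr => by
      by_contra hne
      exact Nat.find_min h hr ⟨by omega, hne⟩
    rw [firstIndex_eq h2.1.le h3 fun _ => h2.2]
    exact ⟨h3, fun _ => h2.2⟩
  · push Not at h
    rw [firstIndex_eq le_rfl h fun h => absurd h (lt_irrefl _)]
    exact ⟨h, fun h => absurd h (lt_irrefl _)⟩

theorem firstIndex_lt {f : ℕ → ℕ} {N q : ℕ} (hq : q < N) (h : f q ≠ 0) : firstIndex f N < N := by
  by_contra hn
  exact h ((exists_firstIndex f N).1 q (by omega))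

/-- The least index with a nonzero value equals the number of indices `q` such that all values up to
`q` vanish. This turns a search into a sum of products of indicators. -/
theorem NatExpr.eval_first {U : Store} {env : ℕ → ℕ} {v w c : ℕ} {e : NatExpr} (f : ℕ → ℕ)
    (hvw : v ≠ w)
    (h : ∀ q r, e.eval U (Function.update (Function.update env v q) w r) = f r) :
    (first v w c e).eval U env = firstIndex f (U 0 c) := by
  have h1 : ∀ q, q < U 0 c →
      (∏ r ∈ range (U 0 c), (1 - (if r ≤ q then 1 else 0) * f r)) =
        if ∀ r ≤ q, f r = 0 then 1 else 0 := by
    intro q hq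
    split_ifs with hz
    · refine prod_eq_one fun r hr => ?_
      by_cases hrq : r ≤ q
      · simp [hz r hrq]
      · simp [hrq]
    · push Not at hz
      obtain ⟨r, hr, hne⟩ := hz
      exact prod_eq_zero (mem_range.2 (hr.trans_lt hq)) (by simp [hr]; omega)
  simp only [first, eval_sum, eval_prod, eval_sub, eval_one, eval_mul, eval_le, eval_var, h,
    Function.update_self, Function.update_of_ne hvw, firstIndex]
  rw [card_filter]
  exact sum_congr rfl fun q hq => h1 q (mem_range.1 hq)

/-! ### Rational expressions -/

/-- Rational expressions; `ratio a b` is `a / b` and `prod` takes positive parts of its factors. -/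
inductive RatExpr where
  | ratio (a b : NatExpr)
  | add (e₁ e₂ : RatExpr)
  | sub (e₁ e₂ : RatExpr)
  | mul (e₁ e₂ : RatExpr)
  | sum (v c : ℕ) (e : RatExpr)
  | prod (v c : ℕ) (e : RatExpr)

namespace RatExpr

instance : Add RatExpr := ⟨add⟩
instance : Sub RatExpr := ⟨sub⟩
instance : Mul RatExpr := ⟨mul⟩

noncomputable def eval (U : Store) : (ℕ → ℕ) → RatExpr → ℝ
  | env, ratio a b => (a.eval U env : ℝ) / (b.eval U env : ℝ)
  | env, add a b => a.eval U env + b.eval U env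
  | env, sub a b => a.eval U env - b.eval U env
  | env, mul a b => a.eval U env * b.eval U env
  | env, sum v c e => ∑ q ∈ range (U 0 c), e.eval U (Function.update env v q)
  | env, prod v c e => ∏ q ∈ range (U 0 c), max (e.eval U (Function.update env v q)) 0

/-- A positive denominator of the value. -/
def den : RatExpr → NatExpr
  | ratio _ b => .ite b b 1
  | add a b => a.den * b.den
  | sub a b => a.den * b.den
  | mul a b => a.den * b.den
  | sum v c e => .prod v c e.den
  | prod v c e => .prod v c e.den

/-- The numerator of the value, as a difference of two natural numbers. -/
def num : RatExpr → NatExpr × NatExpr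
  | ratio a b => (.ite b a 0, 0)
  | add a b => (a.num.1 * b.den + b.num.1 * a.den, a.num.2 * b.den + b.num.2 * a.den)
  | sub a b => (a.num.1 * b.den + b.num.2 * a.den, a.num.2 * b.den + b.num.1 * a.den)
  | mul a b => (a.num.1 * b.num.1 + a.num.2 * b.num.2, a.num.1 * b.num.2 + a.num.2 * b.num.1)
  -- The common denominator is the product of all denominators, so this division is exact.
  | sum v c e => (.sum v c (e.num.1 * (.prod v c e.den / e.den)),
      .sum v c (e.num.2 * (.prod v c e.den / e.den)))
  -- Truncated subtraction is the positive part. Without it, expanding the product of differences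
  -- would not give a bounded product of natural numbers.
  | prod v c e => (.prod v c (e.num.1 - e.num.2), 0)

variable (U : Store) (env : ℕ → ℕ)

theorem den_pos (e : RatExpr) : 0 < e.den.eval U env := by
  induction e generalizing env with
  | ratio a b => simp only [den, NatExpr.eval_ite, NatExpr.eval_one]; split_ifs <;> omega
  | add a b h1 h2 => exact Nat.mul_pos (h1 env) (h2 env)
  | sub a b h1 h2 => exact Nat.mul_pos (h1 env) (h2 env)
  | mul a b h1 h2 => exact Nat.mul_pos (h1 env) (h2 env)
  | sum v c e ih => simp only [den, NatExpr.eval_prod]; exact prod_pos fun q _ => ih _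
  | prod v c e ih => simp only [den, NatExpr.eval_prod]; exact prod_pos fun q _ => ih _

theorem eval_mul_den (e : RatExpr) :
    e.eval U env * e.den.eval U env = e.num.1.eval U env - e.num.2.eval U env := by
  induction e generalizing env with
  | ratio a b =>
    simp only [den, num, eval, NatExpr.eval_ite, NatExpr.eval_one, NatExpr.eval_zero]
    by_cases h : b.eval U env = 0
    · simp [h]
    · have : (b.eval U env : ℝ) ≠ 0 := by exact_mod_cast h
      simp [h]
  | add a b h1 h2 =>
    simp only [den, num, eval, NatExpr.eval_add, NatExpr.eval_mul, Nat.cast_add, Nat.cast_mul]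
    linear_combination (b.den.eval U env : ℝ) * h1 env + (a.den.eval U env : ℝ) * h2 env
  | sub a b h1 h2 =>
    simp only [den, num, eval, NatExpr.eval_add, NatExpr.eval_mul, Nat.cast_add, Nat.cast_mul]
    linear_combination (b.den.eval U env : ℝ) * h1 env - (a.den.eval U env : ℝ) * h2 env
  | mul a b h1 h2 =>
    simp only [den, num, eval, NatExpr.eval_add, NatExpr.eval_mul, Nat.cast_add, Nat.cast_mul]
    linear_combination (b.eval U env * b.den.eval U env : ℝ) * h1 env +
      (a.num.1.eval U env - a.num.2.eval U env : ℝ) * h2 env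
  | sum v c e ih =>
    simp only [den, num, eval, NatExpr.eval_sum, NatExpr.eval_mul, NatExpr.eval_div,
      NatExpr.eval_prod, Function.update_idem, Nat.cast_sum, Nat.cast_mul, sum_mul]
    rw [← sum_sub_distrib]
    refine sum_congr rfl fun q hq => ?_
    set D := ∏ q ∈ range (U 0 c), e.den.eval U (Function.update env v q) with hD
    set d := e.den.eval U (Function.update env v q) with hd
    have hdD : d ∣ D := dvd_prod_of_mem (fun q => e.den.eval U (Function.update env v q)) hq
    have h1 : ((D / d : ℕ) : ℝ) * d = D := by
      rw [← Nat.cast_mul, Nat.div_mul_cancel hdD]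
    have h2 := ih (Function.update env v q)
    rw [← h1]
    linear_combination ((D / d : ℕ) : ℝ) * h2
  | prod v c e ih =>
    simp only [den, num, eval, NatExpr.eval_prod, NatExpr.eval_sub, NatExpr.eval_zero,
      Nat.cast_prod, Nat.cast_zero, sub_zero]
    rw [← prod_mul_distrib]
    refine prod_congr rfl fun q _ => ?_
    have h2 := ih (Function.update env v q)
    have h3 : (0 : ℝ) < e.den.eval U (Function.update env v q) := by
      exact_mod_cast den_pos U (Function.update env v q) e
    rw [max_mul_of_nonneg _ _ h3.le, h2, zero_mul]
    rcases le_total (e.num.2.eval U (Function.update env v q))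
      (e.num.1.eval U (Function.update env v q)) with h | h
    · rw [Nat.cast_sub h, max_eq_left]
      have : (e.num.2.eval U (Function.update env v q) : ℝ) ≤ _ := Nat.cast_le.2 h
      linarith
    · rw [Nat.sub_eq_zero_of_le h, max_eq_right]
      · simp
      · have : (e.num.1.eval U (Function.update env v q) : ℝ) ≤ _ := Nat.cast_le.2 h
        linarith

/-- Cross-multiplication by the positive denominators, with the negative parts moved to the other
side, so the comparison is exact in natural numbers. -/
def le (a b : RatExpr) : NatExpr :=
  .le (a.num.1 * b.den + b.num.2 * a.den) (b.num.1 * a.den + a.num.2 * b.den)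

@[simp] theorem eval_le (a b : RatExpr) :
    (le a b).eval U env = if a.eval U env ≤ b.eval U env then 1 else 0 := by
  simp only [le, NatExpr.eval_le, NatExpr.eval_add, NatExpr.eval_mul]
  refine if_congr ?_ rfl rfl
  have ha : (0 : ℝ) < a.den.eval U env := by exact_mod_cast den_pos U env a
  have hb : (0 : ℝ) < b.den.eval U env := by exact_mod_cast den_pos U env b
  have h1 := eval_mul_den U env a
  have h2 := eval_mul_den U env b
  refine Iff.trans ?_ (mul_le_mul_iff_left₀ (mul_pos ha hb))
  rw [← Nat.cast_le (α := ℝ)]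
  push_cast
  have e1 : a.eval U env * (a.den.eval U env * b.den.eval U env) =
      (a.num.1.eval U env - a.num.2.eval U env) * b.den.eval U env := by rw [← h1]; ring
  have e2 : b.eval U env * (a.den.eval U env * b.den.eval U env) =
      (b.num.1.eval U env - b.num.2.eval U env) * a.den.eval U env := by rw [← h2]; ring
  rw [e1, e2]
  constructor <;> intro h <;> linarith

@[simp] theorem eval_ratio (a b : NatExpr) :
    (ratio a b).eval U env = (a.eval U env : ℝ) / (b.eval U env : ℝ) := rfl
@[simp] theorem eval_add (a b : RatExpr) : (a + b).eval U env = a.eval U env + b.eval U env := rfl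
@[simp] theorem eval_sub (a b : RatExpr) : (a - b).eval U env = a.eval U env - b.eval U env := rfl
@[simp] theorem eval_mul (a b : RatExpr) : (a * b).eval U env = a.eval U env * b.eval U env := rfl
@[simp] theorem eval_sum (v c : ℕ) (e : RatExpr) :
    (sum v c e).eval U env = ∑ q ∈ range (U 0 c), e.eval U (Function.update env v q) := rfl
@[simp] theorem eval_prod (v c : ℕ) (e : RatExpr) :
    (prod v c e).eval U env = ∏ q ∈ range (U 0 c), max (e.eval U (Function.update env v q)) 0 := rfl

end RatExpr

/-! ### Kernel vectors by the Faddeev–LeVerrier recursion -/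

section FaddeevLeVerrier
variable {ι : Type*} [Fintype ι] [DecidableEq ι]

/-- The division-free Faddeev–LeVerrier recursion. -/
noncomputable def leverrier (M : Matrix ι ι ℝ) : ℕ → Matrix ι ι ℝ
  | 0 => 1
  | i + 1 => ((i + 1 : ℕ) : ℝ) • (M * leverrier M i) - (M * leverrier M i).trace • 1

/-- Elementary symmetric polynomials of the `l q` with `q ∈ s`. -/
noncomputable def elemSymm (l : ι → ℝ) (i : ℕ) (s : Finset ι) : ℝ :=
  ∑ T ∈ s.powersetCard i, ∏ q ∈ T, l q

/-- Split the subsets according to whether they contain `q`. -/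
theorem elemSymm_succ (l : ι → ℝ) (i : ℕ) (q : ι) :
    elemSymm l (i + 1) univ =
      elemSymm l (i + 1) (univ.erase q) + l q * elemSymm l i (univ.erase q) := by
  have hq : q ∉ (univ : Finset ι).erase q := notMem_erase q univ
  have h := powersetCard_succ_insert hq i
  rw [insert_erase (mem_univ q)] at h
  have hmem : ∀ T ∈ powersetCard i ((univ : Finset ι).erase q), q ∉ T := fun T hT hqT =>
    hq ((mem_powersetCard.1 hT).1 hqT)
  rw [elemSymm, h, sum_union, sum_image, elemSymm, elemSymm, mul_sum]
  · congr 1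
    exact sum_congr rfl fun T hT => prod_insert (hmem T hT)
  · intro T hT T' hT' he
    rw [← erase_insert (hmem T hT), ← erase_insert (hmem T' hT'), he]
  · rw [disjoint_left]
    intro T hT hT'
    obtain ⟨T', -, rfl⟩ := mem_image.1 hT'
    exact hq ((mem_powersetCard.1 hT).1 (mem_insert_self _ _))

/-- Double counting: a subset with `i + 1` elements arises once from each of its elements `q`. -/
theorem sum_mul_elemSymm (l : ι → ℝ) (i : ℕ) :
    ∑ q, l q * elemSymm l i (univ.erase q) = (i + 1 : ℕ) * elemSymm l (i + 1) univ := by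
  have h1 : ∀ q, l q * elemSymm l i (univ.erase q) =
      ∑ T ∈ powersetCard (i + 1) (univ : Finset ι), if q ∈ T then ∏ p ∈ T, l p else 0 := by
    intro q
    have h2 : elemSymm l (i + 1) (univ.erase q) =
        ∑ T ∈ powersetCard (i + 1) (univ : Finset ι), if q ∈ T then 0 else ∏ p ∈ T, l p := by
      simp only [← ite_not (q ∈ _)]
      rw [elemSymm, ← sum_filter]
      refine sum_congr ?_ fun _ _ => rfl
      ext T
      simp only [mem_powersetCard, mem_filter, subset_univ, true_and]
      constructor
      · rintro ⟨h, hc⟩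
        exact ⟨hc, fun hq => notMem_erase q univ (h hq)⟩
      · rintro ⟨hc, hq⟩
        exact ⟨fun p hp => mem_erase.2 ⟨fun h => hq (h ▸ hp), mem_univ p⟩, hc⟩
    have h3 := elemSymm_succ l i q
    have h4 : l q * elemSymm l i (univ.erase q) =
        elemSymm l (i + 1) univ - elemSymm l (i + 1) (univ.erase q) := by linarith
    rw [h4, h2, elemSymm, ← sum_sub_distrib]
    exact sum_congr rfl fun T _ => by split_ifs <;> simp
  simp_rw [h1]
  rw [sum_comm, elemSymm, mul_sum]
  refine sum_congr rfl fun T hT => ?_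
  rw [sum_ite_mem, univ_inter, sum_const, (mem_powersetCard.1 hT).2, nsmul_eq_mul]

/-- By `sum_mul_elemSymm` the trace is a multiple of the full symmetric polynomial, and by
`elemSymm_succ` subtracting it leaves the polynomial without `q`. -/
theorem leverrier_diagonal (l : ι → ℝ) (i : ℕ) : leverrier (Matrix.diagonal l) i =
    Matrix.diagonal fun q => (i.factorial : ℝ) * (-1) ^ i * elemSymm l i (univ.erase q) := by
  induction i with
  | zero =>
    rw [leverrier, ← Matrix.diagonal_one]
    congr 1
    funext q
    simp [elemSymm]
  | succ i ih =>
    have hs : ∑ q, l q * ((i.factorial : ℝ) * (-1) ^ i * elemSymm l i (univ.erase q)) =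
        (i.factorial : ℝ) * (-1) ^ i * ((i + 1 : ℕ) * elemSymm l (i + 1) univ) := by
      rw [← sum_mul_elemSymm, mul_sum]
      exact sum_congr rfl fun q _ => by ring
    rw [leverrier, ih, Matrix.diagonal_mul_diagonal, Matrix.trace_diagonal, hs,
      ← Matrix.diagonal_one, ← Matrix.diagonal_smul, ← Matrix.diagonal_smul, Matrix.diagonal_sub]
    congr 1
    funext q
    simp only [Pi.smul_apply, smul_eq_mul, mul_one]
    rw [elemSymm_succ l i q, Nat.factorial_succ]
    push_cast
    ring

/-- The recursion commutes with orthogonal conjugation, so the spectral theorem reduces to diagonal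
matrices. There the entries are symmetric polynomials of degree `N` in only `N - 1` eigenvalues. -/
theorem leverrier_card {M : Matrix ι ι ℝ} (hM : M.IsSymm) : leverrier M (Fintype.card ι) = 0 := by
  have hH : M.IsHermitian := by
    rw [Matrix.IsHermitian, Matrix.conjTranspose_eq_transpose_of_trivial]; exact hM
  set φ := Unitary.conjStarAlgAut ℝ (Matrix ι ι ℝ) hH.eigenvectorUnitary with hφ
  set D : Matrix ι ι ℝ := Matrix.diagonal hH.eigenvalues with hD
  have hMD : M = φ D := hH.spectral_theorem
  have htr : ∀ X, (φ X).trace = X.trace := by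
    intro X
    rw [hφ, Unitary.conjStarAlgAut_apply, Matrix.trace_mul_comm, ← mul_assoc]
    simp
  have h : ∀ i, leverrier M i = φ (leverrier D i) := by
    intro i
    induction i with
    | zero => simp [leverrier]
    | succ i ih =>
      rw [leverrier, leverrier, ih, map_sub, map_smul, map_smul, map_one, map_mul, ← hMD]
      congr 2
      rw [← htr (D * _), map_mul, ← hMD]
  rw [h, hD, leverrier_diagonal]
  have : ∀ q : ι, elemSymm hH.eigenvalues (Fintype.card ι) (univ.erase q) = 0 := by
    intro q
    have hc : ((univ : Finset ι).erase q).card < Fintype.card ι := by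
      rw [card_erase_of_mem (mem_univ q), card_univ]
      have := Fintype.card_pos_iff.2 ⟨q⟩
      omega
    rw [elemSymm, powersetCard_eq_empty.2 hc, sum_empty]
  simp [this]

/-- If the next matrix vanishes, `M * leverrier M i` is a scalar matrix. A kernel vector `z`
annihilates it from the left, because `M` is symmetric, so the scalar is zero. -/
theorem mul_leverrier_eq_zero {M : Matrix ι ι ℝ} (hM : M.IsSymm) {z : ι → ℝ} (hz : z ≠ 0)
    (hMz : M.mulVec z = 0) {i : ℕ} (h : leverrier M (i + 1) = 0) : M * leverrier M i = 0 := by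
  rw [leverrier, sub_eq_zero] at h
  have hzM : Matrix.vecMul z M = 0 := by
    rw [← Matrix.mulVec_transpose, hM.eq, hMz]
  have h1 := congrArg (Matrix.vecMul z) h
  rw [Matrix.vecMul_smul, ← Matrix.vecMul_vecMul, hzM, Matrix.zero_vecMul, smul_zero,
    Matrix.vecMul_smul, Matrix.vecMul_one] at h1
  have ht : (M * leverrier M i).trace = 0 := by
    by_contra hne
    exact hz ((smul_eq_zero.1 h1.symm).resolve_left hne)
  rw [ht, zero_smul] at h
  exact (smul_eq_zero.1 h).resolve_left (by positivity)

end FaddeevLeVerrier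

/-! ### Fractional colourings, deviations and the potential -/

/-- Elements `u < E` of functions `own u` and dual sets `{j | mem u j = 1}`, where the items are
divided into classes; `deg` bounds the number of sets of an item.  The other entries are the
parameters of the potential. -/
structure Layout where
  (n k m E deg : ℕ)
  own : ℕ → ℕ
  mem : ℕ → ℕ → ℕ
  cls : ℕ → ℕ
  lam : ℝ
  (nonempty big : ℕ → ℕ)
  weight : ℕ

namespace Layout

/-- `proper` makes expected values linear in each class; `lam_le` keeps all factors `1 ± lam * dev`
at least `1 / 2`. -/
structure Valid (S : Layout) : Prop where
  k_pos : 1 ≤ S.k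
  own_lt : ∀ u < S.E, S.own u < S.m
  mem_le : ∀ u j, S.mem u j ≤ 1
  deg_pos : 1 ≤ S.deg
  sum_mem_le : ∀ j < S.n, ∑ u ∈ range S.E, S.mem u j ≤ S.deg
  cls_lt : ∀ j < S.n, S.cls j < S.n
  proper : ∀ u < S.E, ∀ j < S.n, ∀ j' < S.n, S.mem u j ≠ 0 → S.mem u j' ≠ 0 →
    S.cls j = S.cls j' → j = j'
  lam_pos : 0 < S.lam
  lam_le : S.lam * (4 * S.deg) ≤ 1 / 2

variable (S : Layout)

/-- The colouring whose classes from `b` on are reset to the uniform distribution. -/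
noncomputable def cut (b : ℕ) (x : ℕ → ℕ → ℝ) (j l : ℕ) : ℝ :=
  if S.cls j < b then x j l else 1 / S.k

/-- The probability that the element `u` is missed by the colour `l`. -/
noncomputable def missing (x : ℕ → ℕ → ℝ) (u l : ℕ) : ℝ :=
  ∏ j ∈ range S.n, (1 - S.mem u j * x j l)

/-- The probability that no item other than `j` gives colour `l` to `u`, with classes from `b` on
uniform. For `j` in `u` it is the derivative of the coverage probability in `x j l`; `grad` collects
these derivatives over the elements of function `i`. -/
noncomputable def coef (b : ℕ) (x : ℕ → ℕ → ℝ) (u j l : ℕ) : ℝ :=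
  ∏ j' ∈ range S.n, (1 - S.mem u j' * if j' = j then 0 else S.cut b x j' l)

noncomputable def grad (b : ℕ) (x : ℕ → ℕ → ℝ) (i j l : ℕ) : ℝ :=
  ∑ u ∈ range S.E, if S.own u = i then S.mem u j * S.coef b x u j l else 0

/-- The change of the value of function `i` at colour `l` that is due to class `b`. -/
noncomputable def dev (b : ℕ) (x : ℕ → ℕ → ℝ) (i l : ℕ) : ℝ :=
  ∑ j ∈ range S.n, if S.cls j = b then S.grad b x i j l * (x j l - 1 / S.k) else 0

/-- A pessimistic estimator. The first sum controls both tails of `∑ dev b`; it runs over nonempty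
elements rather than functions, so that its size depends on `n * t` and not on `m`. The second sum
penalises truncated sets missed by a colour. The positive parts are inactive for good colourings and
only match `RatExpr.prod`. -/
noncomputable def potential (x : ℕ → ℕ → ℝ) : ℝ :=
  ∑ u ∈ range S.E, S.nonempty u * ∑ l ∈ range S.k,
    (∏ b ∈ range S.n, max (1 + S.lam * S.dev b x (S.own u) l) 0 +
      ∏ b ∈ range S.n, max (1 - S.lam * S.dev b x (S.own u) l) 0) +
  ∑ u ∈ range S.E, S.big u * ∑ l ∈ range S.k,
    S.weight * ∏ j ∈ range S.n, max (1 - S.mem u j * x j l) 0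

/-- A coordinate that is not yet rounded. -/
def Frac (x : ℕ → ℕ → ℝ) (j l : ℕ) : Prop := 0 < x j l ∧ x j l < 1

-- The invariant of the rounding. By `order`, classes after an unfinished one are still uniform. In
-- `bound`, the sums are the decrease and the increase of `dev` if all fractional coordinates of the
-- class fell to `0` or rose to `1`: a row that has moved stays within `4 * deg` whatever happens to
-- these coordinates.
open Classical in
structure Good (x : ℕ → ℕ → ℝ) : Prop where
  nonneg : ∀ j < S.n, ∀ l < S.k, 0 ≤ x j l
  sum_one : ∀ j < S.n, ∑ l ∈ range S.k, x j l = 1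
  order : ∀ j < S.n, ∀ j' < S.n, ∀ l < S.k, ∀ l' < S.k, Frac x j l → S.cls j < S.cls j' →
    x j' l' = 1 / S.k
  bound : ∀ b i, ∀ l < S.k, S.dev b x i l = 0 ∨
    (-(4 * S.deg) ≤ S.dev b x i l -
      ∑ j ∈ range S.n, (if S.cls j = b ∧ Frac x j l then S.grad b x i j l * x j l else 0) ∧
    S.dev b x i l +
      ∑ j ∈ range S.n, (if S.cls j = b ∧ Frac x j l then S.grad b x i j l * (1 - x j l) else 0) ≤
        4 * S.deg)

/-- The class `b` is the first one that is not yet rounded. -/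
def Current (x : ℕ → ℕ → ℝ) (b : ℕ) : Prop :=
  (∃ j < S.n, ∃ l < S.k, S.cls j = b ∧ Frac x j l) ∧
    ∀ j < S.n, ∀ l < S.k, Frac x j l → b ≤ S.cls j

open Classical in
/-- A direction in which the class `b` may be moved. -/
structure Direction (b : ℕ) (x y : ℕ → ℕ → ℝ) : Prop where
  support : ∀ j < S.n, ∀ l < S.k, y j l ≠ 0 → S.cls j = b ∧ Frac x j l
  sum_zero : ∀ j < S.n, ∑ l ∈ range S.k, y j l = 0
  -- Beck–Fiala: a row may be released once its remaining gradient is so small that further moves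
  -- cannot change it by more than `4 * deg`.
  keep : ∀ i, ∀ l < S.k, ∑ j ∈ range S.n, (if S.cls j = b then S.grad b x i j l * y j l else 0) = 0 ∨
    ∑ j ∈ range S.n, (if S.cls j = b ∧ Frac x j l then S.grad b x i j l else 0) ≤ 4 * S.deg

variable {S}

/-- An element is covered by at most one item of class `b`, so at most one factor of its product
changes, and the difference is linear in that factor. -/
theorem prod_sub_prod (hS : S.Valid) {u : ℕ} (hu : u < S.E) {b : ℕ} {v w : ℕ → ℝ}
    (h : ∀ j < S.n, S.cls j ≠ b → v j = w j) :
    ∏ j ∈ range S.n, (1 - S.mem u j * w j) - ∏ j ∈ range S.n, (1 - S.mem u j * v j) =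
      -∑ j ∈ range S.n, if S.cls j = b then S.mem u j * (w j - v j) *
        ∏ j' ∈ range S.n, (1 - S.mem u j' * if j' = j then 0 else v j') else 0 := by
  by_cases hex : ∃ j < S.n, S.cls j = b ∧ S.mem u j ≠ 0
  · obtain ⟨j₀, hj₀, hb, hm⟩ := hex
    have hother : ∀ j < S.n, j ≠ j₀ → (S.mem u j : ℝ) * w j = S.mem u j * v j := by
      intro j hj hne
      by_cases hmj : S.mem u j = 0
      · simp [hmj]
      · rw [h j hj fun hc => hne (hS.proper u hu j hj j₀ hj₀ hmj hm (hc.trans hb.symm))]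
    have hj₀' : j₀ ∈ range S.n := mem_range.2 hj₀
    rw [sum_eq_single_of_mem j₀ hj₀', if_pos hb, ← mul_prod_erase _ _ hj₀', ← mul_prod_erase _ _ hj₀',
      ← mul_prod_erase _ _ hj₀', if_pos rfl]
    · have e1 : ∏ j ∈ (range S.n).erase j₀, (1 - S.mem u j * w j) =
          ∏ j ∈ (range S.n).erase j₀, (1 - S.mem u j * v j) :=
        prod_congr rfl fun j hj => by
          rw [hother j (mem_range.1 (mem_erase.1 hj).2) (mem_erase.1 hj).1]
      have e2 : ∏ j ∈ (range S.n).erase j₀, (1 - S.mem u j * if j = j₀ then 0 else v j) =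
          ∏ j ∈ (range S.n).erase j₀, (1 - S.mem u j * v j) :=
        prod_congr rfl fun j hj => by rw [if_neg (mem_erase.1 hj).1]
      rw [e1, e2]
      ring
    · intro j hj hne
      split_ifs with hc
      · have hmj : S.mem u j = 0 := by
          by_contra hmj
          exact hne (hS.proper u hu j (mem_range.1 hj) j₀ hj₀ hmj hm (hc.trans hb.symm))
        simp [hmj]
      · rfl
  · push Not at hex
    rw [sum_eq_zero, neg_zero, sub_eq_zero]
    · refine prod_congr rfl fun j hj => ?_
      by_cases hc : S.cls j = b
      · simp [hex j (mem_range.1 hj) hc]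
      · rw [h j (mem_range.1 hj) hc]
    · intro j hj
      split_ifs with hc
      · simp [hex j (mem_range.1 hj) hc]
      · rfl

theorem missing_cut_succ_sub (hS : S.Valid) {u : ℕ} (hu : u < S.E) (b : ℕ) (x : ℕ → ℕ → ℝ) (l : ℕ) :
    S.missing (S.cut (b + 1) x) u l - S.missing (S.cut b x) u l =
      -∑ j ∈ range S.n, if S.cls j = b then S.mem u j * (x j l - 1 / S.k) * S.coef b x u j l
        else 0 := by
  refine (prod_sub_prod hS hu (b := b) fun j _ hc => ?_).trans ?_
  · have : S.cls j < b + 1 ↔ S.cls j < b := by omega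
    simp [cut, this]
  · refine congrArg _ (sum_congr rfl fun j _ => ?_)
    split_ifs with hc
    · simp [cut, hc, coef]
    · rfl

theorem dev_eq (b : ℕ) (x : ℕ → ℕ → ℝ) (i l : ℕ) : S.dev b x i l =
    ∑ u ∈ range S.E, if S.own u = i then ∑ j ∈ range S.n,
      if S.cls j = b then S.mem u j * (x j l - 1 / S.k) * S.coef b x u j l else 0 else 0 := by
  have h : ∀ j, (if S.cls j = b then S.grad b x i j l * (x j l - 1 / S.k) else 0) =
      ∑ u ∈ range S.E, if S.own u = i then
        if S.cls j = b then S.mem u j * (x j l - 1 / S.k) * S.coef b x u j l else 0 else 0 := by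
    intro j
    split_ifs with hc
    · rw [grad, sum_mul]
      exact sum_congr rfl fun u _ => by split_ifs <;> ring
    · simp
  rw [dev, sum_congr rfl fun j _ => h j, sum_comm]
  refine sum_congr rfl fun u _ => ?_
  split_ifs <;> simp

/-- Telescoping over `cut 0, cut 1, …`, from the uniform colouring to `x`. The uniform term is the
same for all colours, so differences between colours are governed by the sums of `dev`. -/
theorem sum_dev (hS : S.Valid) (x : ℕ → ℕ → ℝ) (i l : ℕ) :
    ∑ u ∈ range S.E, (if S.own u = i then S.missing x u l else 0) =
      ∑ u ∈ range S.E, (if S.own u = i then S.missing (fun _ _ => 1 / S.k) u l else 0) -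
        ∑ b ∈ range S.n, S.dev b x i l := by
  have h : ∀ N, ∑ u ∈ range S.E, (if S.own u = i then S.missing (S.cut N x) u l else 0) =
      ∑ u ∈ range S.E, (if S.own u = i then S.missing (fun _ _ => 1 / S.k) u l else 0) -
        ∑ b ∈ range N, S.dev b x i l := by
    intro N
    induction N with
    | zero => simp [cut, missing]
    | succ N ih =>
      rw [sum_range_succ, ← sub_sub, ← ih, dev_eq, ← sum_sub_distrib]
      refine sum_congr rfl fun u hu => ?_
      have := missing_cut_succ_sub hS (mem_range.1 hu) N x l
      split_ifs
      · linarith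
      · simp
  rw [← h S.n]
  refine sum_congr rfl fun u _ => ?_
  have : S.missing (S.cut S.n x) u l = S.missing x u l :=
    prod_congr rfl fun j hj => by rw [cut, if_pos (hS.cls_lt j (mem_range.1 hj))]
  rw [this]

theorem inv_k_mem (hS : S.Valid) : (0 : ℝ) < 1 / S.k ∧ (1 : ℝ) / S.k ≤ 1 := by
  have : (1 : ℝ) ≤ S.k := by exact_mod_cast hS.k_pos
  exact ⟨by positivity, by rw [div_le_one (by linarith)]; exact this⟩

theorem Good.le_one {x : ℕ → ℕ → ℝ} (hx : S.Good x) {j l : ℕ} (hj : j < S.n) (hl : l < S.k) :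
    x j l ≤ 1 := by
  rw [← hx.sum_one j hj]
  exact single_le_sum (f := fun l => x j l) (fun l hl => hx.nonneg j hj l (mem_range.1 hl))
    (mem_range.2 hl)

theorem cut_mem (hS : S.Valid) {x : ℕ → ℕ → ℝ} (hx : S.Good x) (b : ℕ) {j l : ℕ}
    (hj : j < S.n) (hl : l < S.k) : 0 ≤ S.cut b x j l ∧ S.cut b x j l ≤ 1 := by
  unfold cut
  split_ifs
  · exact ⟨hx.nonneg j hj l hl, hx.le_one hj hl⟩
  · exact ⟨(inv_k_mem hS).1.le, (inv_k_mem hS).2⟩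

theorem factor_mem (hS : S.Valid) (u j : ℕ) {a : ℝ} (h0 : 0 ≤ a) (h1 : a ≤ 1) :
    0 ≤ 1 - S.mem u j * a ∧ 1 - S.mem u j * a ≤ 1 := by
  have h2 : (S.mem u j : ℝ) ≤ 1 := by exact_mod_cast hS.mem_le u j
  have h3 : (0 : ℝ) ≤ S.mem u j := Nat.cast_nonneg _
  constructor <;> nlinarith

theorem coef_mem (hS : S.Valid) {x : ℕ → ℕ → ℝ} (hx : S.Good x) (b u j : ℕ) {l : ℕ} (hl : l < S.k) :
    0 ≤ S.coef b x u j l ∧ S.coef b x u j l ≤ 1 := by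
  have h : ∀ j' ∈ range S.n, 0 ≤ 1 - S.mem u j' * (if j' = j then 0 else S.cut b x j' l) ∧
      1 - S.mem u j' * (if j' = j then 0 else S.cut b x j' l) ≤ 1 := by
    intro j' hj'
    have := cut_mem hS hx b (mem_range.1 hj') hl
    exact factor_mem hS u j' (by split_ifs <;> linarith) (by split_ifs <;> linarith)
  exact ⟨prod_nonneg fun j' hj' => (h j' hj').1,
    prod_le_one (fun j' hj' => (h j' hj').1) fun j' hj' => (h j' hj').2⟩

theorem grad_nonneg (hS : S.Valid) {x : ℕ → ℕ → ℝ} (hx : S.Good x) (b i j : ℕ) {l : ℕ}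
    (hl : l < S.k) : 0 ≤ S.grad b x i j l :=
  sum_nonneg fun u _ => by
    split_ifs
    · exact mul_nonneg (Nat.cast_nonneg _) (coef_mem hS hx b u j hl).1
    · exact le_rfl

/-- Each element has one owner and contributes at most `1`. This column bound limits the number of
rows with a large gradient. -/
theorem sum_grad_le (hS : S.Valid) {x : ℕ → ℕ → ℝ} (hx : S.Good x) (b : ℕ) {j l : ℕ}
    (hj : j < S.n) (hl : l < S.k) : ∑ i ∈ range S.m, S.grad b x i j l ≤ S.deg := by
  have h : ∑ i ∈ range S.m, S.grad b x i j l ≤ ∑ u ∈ range S.E, (S.mem u j : ℝ) := by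
    simp only [grad]
    rw [sum_comm]
    refine sum_le_sum fun u hu => ?_
    rw [sum_ite_eq, if_pos (mem_range.2 (hS.own_lt u (mem_range.1 hu)))]
    exact mul_le_of_le_one_right (Nat.cast_nonneg _) (coef_mem hS hx b u j hl).2
  refine h.trans ?_
  exact_mod_cast hS.sum_mem_le j hj

theorem abs_dev_le (hS : S.Valid) {x : ℕ → ℕ → ℝ} (hx : S.Good x) (b i : ℕ) {l : ℕ}
    (hl : l < S.k) : |S.dev b x i l| ≤ 4 * S.deg := by
  classical
  rcases hx.bound b i l hl with h | ⟨h1, h2⟩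
  · rw [h, abs_zero]; positivity
  · rw [abs_le]
    have g1 : 0 ≤ ∑ j ∈ range S.n,
        (if S.cls j = b ∧ Frac x j l then S.grad b x i j l * x j l else 0) :=
      sum_nonneg fun j hj => by
        split_ifs
        · exact mul_nonneg (grad_nonneg hS hx b i j hl) (hx.nonneg j (mem_range.1 hj) l hl)
        · exact le_rfl
    have g2 : 0 ≤ ∑ j ∈ range S.n,
        (if S.cls j = b ∧ Frac x j l then S.grad b x i j l * (1 - x j l) else 0) :=
      sum_nonneg fun j hj => by
        split_ifs
        · exact mul_nonneg (grad_nonneg hS hx b i j hl)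
            (sub_nonneg.2 (hx.le_one (mem_range.1 hj) hl))
        · exact le_rfl
    constructor <;> linarith

theorem abs_lam_mul_dev_le (hS : S.Valid) {x : ℕ → ℕ → ℝ} (hx : S.Good x) (b i : ℕ) {l : ℕ}
    (hl : l < S.k) : |S.lam * S.dev b x i l| ≤ 1 / 2 := by
  rw [abs_mul, abs_of_pos hS.lam_pos]
  exact (mul_le_mul_of_nonneg_left (abs_dev_le hS hx b i hl) hS.lam_pos.le).trans hS.lam_le

/-! ### Moving along a direction -/

/-- The colouring moved from `x` along `y` by `c`. -/
def shift (x y : ℕ → ℕ → ℝ) (c : ℝ) (j l : ℕ) : ℝ := x j l + c * y j l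

theorem grad_congr {b : ℕ} {x x' : ℕ → ℕ → ℝ} {l : ℕ}
    (h : ∀ j < S.n, S.cls j < b → x' j l = x j l) (i j : ℕ) :
    S.grad b x' i j l = S.grad b x i j l := by
  refine sum_congr rfl fun u _ => ?_
  have : S.coef b x' u j l = S.coef b x u j l := prod_congr rfl fun j' hj' => by
    have : S.cut b x' j' l = S.cut b x j' l := by
      unfold cut
      split_ifs with hc
      · exact h j' (mem_range.1 hj') hc
      · rfl
    rw [this]
  rw [this]

section step
variable {b : ℕ} {x y : ℕ → ℕ → ℝ}

theorem shift_eq (hy : S.Direction b x y) (c : ℝ) {j l : ℕ} (hj : j < S.n) (hl : l < S.k)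
    (h : ¬ (S.cls j = b ∧ Frac x j l)) : shift x y c j l = x j l := by
  have : y j l = 0 := by
    by_contra hne
    exact h (hy.support j hj l hl hne)
  rw [shift, this, mul_zero, add_zero]

theorem dev_shift_of_lt (hy : S.Direction b x y) (c : ℝ) {b' i l : ℕ} (hb : b' < b) (hl : l < S.k) :
    S.dev b' (shift x y c) i l = S.dev b' x i l := by
  have h : ∀ j < S.n, S.cls j ≤ b' → shift x y c j l = x j l := fun j hj hc =>
    shift_eq hy c hj hl fun h => by omega
  refine sum_congr rfl fun j hj => ?_
  split_ifs with hc
  · rw [grad_congr fun j hj hc => h j hj hc.le, h j (mem_range.1 hj) hc.le]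
  · rfl

theorem dev_shift_of_gt (hx : S.Good x) (hb : S.Current x b) (hy : S.Direction b x y) (c : ℝ)
    {b' i l : ℕ} (hbb : b < b') (hl : l < S.k) : S.dev b' (shift x y c) i l = 0 := by
  obtain ⟨⟨j₀, hj₀, l₀, hl₀, hc₀, hf₀⟩, -⟩ := hb
  refine sum_eq_zero fun j hj => ?_
  split_ifs with hc
  · rw [shift_eq hy c (mem_range.1 hj) hl fun h => by omega,
      hx.order j₀ hj₀ j (mem_range.1 hj) l₀ hl₀ l hl hf₀ (by omega), sub_self, mul_zero]
  · rfl

theorem grad_shift (hy : S.Direction b x y) (c : ℝ) {i j l : ℕ} (hl : l < S.k) :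
    S.grad b (shift x y c) i j l = S.grad b x i j l :=
  grad_congr (fun _ hj hc => shift_eq hy c hj hl fun h => by omega) i j

theorem dev_shift (hy : S.Direction b x y) (c : ℝ) {i l : ℕ} (hl : l < S.k) :
    S.dev b (shift x y c) i l = S.dev b x i l +
      c * ∑ j ∈ range S.n, if S.cls j = b then S.grad b x i j l * y j l else 0 := by
  rw [dev, dev, mul_sum, ← sum_add_distrib]
  refine sum_congr rfl fun j _ => ?_
  rw [grad_shift hy c hl]
  split_ifs
  · rw [shift]; ring
  · simp

theorem sum_shift (hx : S.Good x) (hy : S.Direction b x y) (c : ℝ) {j : ℕ} (hj : j < S.n) :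
    ∑ l ∈ range S.k, shift x y c j l = 1 := by
  simp only [shift]
  rw [sum_add_distrib, ← mul_sum, hx.sum_one j hj, hy.sum_zero j hj, mul_zero, add_zero]

theorem frac_of_frac_shift (hy : S.Direction b x y) (c : ℝ) {j l : ℕ} (hj : j < S.n) (hl : l < S.k)
    (h : Frac (shift x y c) j l) : Frac x j l := by
  by_contra hn
  have := shift_eq hy c hj hl fun h => hn h.2
  rw [Frac, this] at h
  exact hn h

/-- Only `bound` in the current class needs an argument. For a coordinate that stays fractional, the
change of `dev` and the change of its reserve cancel. One that becomes integral leaves the surplus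
`grad * x'` (or `grad * (1 - x')` on the upper side), which is nonnegative, where `x'` is its new
value. -/
theorem good_shift (hS : S.Valid) (hx : S.Good x) (hb : S.Current x b) (hy : S.Direction b x y)
    {c : ℝ} (hc : ∀ j < S.n, ∀ l < S.k, 0 ≤ shift x y c j l) : S.Good (shift x y c) := by
  classical
  have hone : ∀ j < S.n, ∀ l < S.k, shift x y c j l ≤ 1 := fun j hj l hl => by
    rw [← sum_shift hx hy c hj]
    exact single_le_sum (f := fun l => shift x y c j l) (fun l hl => hc j hj l (mem_range.1 hl))
      (mem_range.2 hl)
  refine ⟨hc, fun j hj => sum_shift hx hy c hj, ?_, ?_⟩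
  · intro j hj j' hj' l hl l' hl' hf hlt
    have hf' := frac_of_frac_shift hy c hj hl hf
    have := hb.2 j hj l hl hf'
    rw [shift_eq hy c hj' hl' fun h => by omega]
    exact hx.order j hj j' hj' l hl l' hl' hf' hlt
  · intro b' i l hl
    rcases lt_trichotomy b' b with hlt | rfl | hgt
    · have h : ∀ j < S.n, S.cls j ≤ b' → shift x y c j l = x j l := fun j hj hc =>
        shift_eq hy c hj hl fun h => by omega
      have hg := fun j => grad_congr (S := S) (b := b') (x := x) (x' := shift x y c) (l := l)
        (fun j hj hc => h j hj hc.le) i j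
      have e1 : ∀ f : ℝ → ℝ, ∑ j ∈ range S.n, (if S.cls j = b' ∧ Frac (shift x y c) j l then
          S.grad b' (shift x y c) i j l * f (shift x y c j l) else 0) =
          ∑ j ∈ range S.n, (if S.cls j = b' ∧ Frac x j l then
            S.grad b' x i j l * f (x j l) else 0) := by
        intro f
        refine sum_congr rfl fun j hj => ?_
        by_cases hcb : S.cls j = b'
        · have := h j (mem_range.1 hj) hcb.le
          rw [hg, Frac, Frac, this]
        · simp [hcb]
      have := hx.bound b' i l hl
      rw [← dev_shift_of_lt hy c hlt hl, ← e1 fun a => a, ← e1 fun a => 1 - a] at this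
      exact this
    · have hgn := fun j => grad_nonneg hS hx b' i j hl
      -- An untouched row either stays at zero, or is being released, and then its total live
      -- gradient, at most `4 * deg`, supplies both inequalities.
      have key : (-(4 * S.deg : ℝ) ≤ S.dev b' x i l -
          ∑ j ∈ range S.n, (if S.cls j = b' ∧ Frac x j l then S.grad b' x i j l * x j l else 0) ∧
          S.dev b' x i l + ∑ j ∈ range S.n,
            (if S.cls j = b' ∧ Frac x j l then S.grad b' x i j l * (1 - x j l) else 0) ≤
              4 * S.deg) ∨ S.dev b' (shift x y c) i l = 0 := by
        rcases hx.bound b' i l hl with h0 | h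
        · rcases hy.keep i l hl with hk | hk
          · right
            rw [dev_shift hy c hl, h0, hk, mul_zero, add_zero]
          · left
            rw [h0]
            have m1 : ∑ j ∈ range S.n,
                (if S.cls j = b' ∧ Frac x j l then S.grad b' x i j l * x j l else 0) ≤
                ∑ j ∈ range S.n, (if S.cls j = b' ∧ Frac x j l then S.grad b' x i j l else 0) :=
              sum_le_sum fun j hj => by
                split_ifs
                · exact mul_le_of_le_one_right (hgn j) (hx.le_one (mem_range.1 hj) hl)
                · exact le_rfl
            have m2 : ∑ j ∈ range S.n,
                (if S.cls j = b' ∧ Frac x j l then S.grad b' x i j l * (1 - x j l) else 0) ≤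
                ∑ j ∈ range S.n, (if S.cls j = b' ∧ Frac x j l then S.grad b' x i j l else 0) :=
              sum_le_sum fun j hj => by
                split_ifs
                · exact mul_le_of_le_one_right (hgn j)
                    (by linarith [hx.nonneg j (mem_range.1 hj) l hl])
                · exact le_rfl
            constructor <;> linarith
        · exact Or.inl h
      rcases key with ⟨h1, h2⟩ | h
      · right
        have hd : S.dev b' (shift x y c) i l = S.dev b' x i l + ∑ j ∈ range S.n,
            if S.cls j = b' then S.grad b' x i j l * (shift x y c j l - x j l) else 0 := by
          rw [dev_shift hy c hl, mul_sum]
          refine congrArg _ (sum_congr rfl fun j _ => ?_)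
          split_ifs
          · rw [shift]; ring
          · simp
        simp only [grad_shift hy c hl]
        constructor
        · refine h1.trans ?_
          rw [hd]
          rw [sub_le_iff_le_add, add_sub_assoc, add_assoc, le_add_iff_nonneg_right,
            ← sum_sub_distrib, ← sum_add_distrib]
          refine sum_nonneg fun j hj => ?_
          have hj := mem_range.1 hj
          by_cases hcb : S.cls j = b'
          · by_cases hf' : Frac (shift x y c) j l
            · have hf := frac_of_frac_shift hy c hj hl hf'
              simp only [hcb, hf, hf', and_self, if_true]
              linarith
            · by_cases hf : Frac x j l
              · simp only [hcb, hf, hf', and_self, and_false, if_true, if_false]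
                nlinarith [mul_nonneg (hgn j) (hc j hj l hl)]
              · simp [hcb, hf, hf', shift_eq hy c hj hl fun h => hf h.2]
          · simp [hcb]
        · refine le_trans ?_ h2
          rw [hd, add_assoc, add_le_add_iff_left, ← sub_nonneg, ← sum_add_distrib,
            ← sum_sub_distrib]
          refine sum_nonneg fun j hj => ?_
          have hj := mem_range.1 hj
          by_cases hcb : S.cls j = b'
          · by_cases hf' : Frac (shift x y c) j l
            · have hf := frac_of_frac_shift hy c hj hl hf'
              simp only [hcb, hf, hf', and_self, if_true]
              linarith
            · by_cases hf : Frac x j l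
              · simp only [hcb, hf, hf', and_self, and_false, if_true, if_false]
                nlinarith [mul_nonneg (hgn j) (sub_nonneg.2 (hone j hj l hl))]
              · simp [hcb, hf, hf', shift_eq hy c hj hl fun h => hf h.2]
          · simp [hcb]
      · exact Or.inl h
    · exact Or.inl (dev_shift_of_gt hx hb hy c hgt hl)

/-! ### The potential is affine along a direction -/

/-- The potential without the positive parts. -/
noncomputable def smooth (S : Layout) (x : ℕ → ℕ → ℝ) : ℝ :=
  ∑ u ∈ range S.E, S.nonempty u * ∑ l ∈ range S.k,
    (∏ b ∈ range S.n, (1 + S.lam * S.dev b x (S.own u) l) +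
      ∏ b ∈ range S.n, (1 - S.lam * S.dev b x (S.own u) l)) +
  ∑ u ∈ range S.E, S.big u * ∑ l ∈ range S.k, S.weight * S.missing x u l

theorem potential_eq_smooth (hS : S.Valid) (hx : S.Good x) : S.potential x = S.smooth x := by
  unfold potential smooth missing
  congr 1
  · refine sum_congr rfl fun u _ => congrArg _ (sum_congr rfl fun l hl => ?_)
    have h := fun b => abs_le.1 (abs_lam_mul_dev_le hS hx b (S.own u) (mem_range.1 hl))
    congr 1
    · exact prod_congr rfl fun b _ => max_eq_left (by linarith [(h b).1])
    · exact prod_congr rfl fun b _ => max_eq_left (by linarith [(h b).2])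
  · refine sum_congr rfl fun u _ => congrArg _ (sum_congr rfl fun l hl => congrArg _ ?_)
    exact prod_congr rfl fun j hj => max_eq_left (factor_mem hS u j
      (hx.nonneg j (mem_range.1 hj) l (mem_range.1 hl)) (hx.le_one (mem_range.1 hj)
        (mem_range.1 hl))).1

/-- Affine functions of one real variable. -/
def IsAffine (f : ℝ → ℝ) : Prop := ∃ a, ∀ c, f c = f 0 + c * a

theorem IsAffine.sum {ι : Type*} {s : Finset ι} {f : ι → ℝ → ℝ} (h : ∀ i ∈ s, IsAffine (f i)) :
    IsAffine fun c => ∑ i ∈ s, f i c := by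
  choose! a ha using h
  exact ⟨∑ i ∈ s, a i, fun c => by
    rw [mul_sum, ← sum_add_distrib]; exact sum_congr rfl fun i hi => ha i hi c⟩

theorem IsAffine.add {f g : ℝ → ℝ} : IsAffine f → IsAffine g → IsAffine fun c => f c + g c
  | ⟨a, ha⟩, ⟨b, hb⟩ => ⟨a + b, fun c => by
    have h1 := ha c; have h2 := hb c; simp only; linarith⟩

theorem IsAffine.const_mul {f : ℝ → ℝ} (r : ℝ) : IsAffine f → IsAffine fun c => r * f c
  | ⟨a, ha⟩ => ⟨r * a, fun c => by
    have h1 := ha c; simp only; rw [h1]; ring⟩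

/-- Only the factor of the current class depends on `c`, and it is affine: earlier deviations do not
change and later ones are zero. -/
theorem isAffine_prod_dev (hS : S.Valid) (hx : S.Good x) (hb : S.Current x b)
    (hy : S.Direction b x y) (r : ℝ) (i : ℕ) {l : ℕ} (hl : l < S.k) :
    IsAffine fun c => ∏ b' ∈ range S.n, (1 + r * S.dev b' (shift x y c) i l) := by
  have hbn : b ∈ range S.n := by
    obtain ⟨⟨j₀, hj₀, l₀, hl₀, hc₀, hf₀⟩, -⟩ := hb
    rw [← hc₀]; exact mem_range.2 (hS.cls_lt j₀ hj₀)
  have h : ∀ c, ∏ b' ∈ range S.n, (1 + r * S.dev b' (shift x y c) i l) =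
      (1 + r * S.dev b (shift x y c) i l) *
        ∏ b' ∈ (range S.n).erase b, (1 + r * S.dev b' (shift x y 0) i l) := by
    intro c
    rw [← mul_prod_erase _ _ hbn]
    refine congrArg _ (prod_congr rfl fun b' hb' => ?_)
    rcases lt_or_gt_of_ne (mem_erase.1 hb').1 with hlt | hgt
    · rw [dev_shift_of_lt hy c hlt hl, dev_shift_of_lt hy 0 hlt hl]
    · rw [dev_shift_of_gt hx hb hy c hgt hl, dev_shift_of_gt hx hb hy 0 hgt hl]
  refine ⟨r * (∑ j ∈ range S.n, if S.cls j = b then S.grad b x i j l * y j l else 0) *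
    ∏ b' ∈ (range S.n).erase b, (1 + r * S.dev b' (shift x y 0) i l), fun c => ?_⟩
  simp only [h]
  rw [dev_shift hy c hl, dev_shift hy 0 hl]
  ring

theorem isAffine_missing (hS : S.Valid) (hy : S.Direction b x y) {u : ℕ} (hu : u < S.E) {l : ℕ}
    (hl : l < S.k) : IsAffine fun c => S.missing (shift x y c) u l := by
  refine ⟨-∑ j ∈ range S.n, if S.cls j = b then S.mem u j * y j l *
        ∏ j' ∈ range S.n, (1 - S.mem u j' * if j' = j then 0 else x j' l) else 0, fun c => ?_⟩
  have h := prod_sub_prod hS hu (b := b) (v := fun j => x j l) (w := fun j => shift x y c j l)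
    fun j hj hc => (shift_eq hy c hj hl fun h => hc h.1).symm
  have h0 : shift x y 0 = x := by funext j l; simp [shift]
  simp only [h0]
  have e : ∑ j ∈ range S.n, (if S.cls j = b then (S.mem u j : ℝ) * (shift x y c j l - x j l) *
        ∏ j' ∈ range S.n, (1 - S.mem u j' * if j' = j then 0 else x j' l) else 0) =
      c * ∑ j ∈ range S.n, if S.cls j = b then S.mem u j * y j l *
        ∏ j' ∈ range S.n, (1 - S.mem u j' * if j' = j then 0 else x j' l) else 0 := by
    rw [mul_sum]
    refine sum_congr rfl fun j _ => ?_
    split_ifs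
    · rw [shift]; ring
    · simp
  rw [e] at h
  unfold missing
  linarith

theorem isAffine_smooth (hS : S.Valid) (hx : S.Good x) (hb : S.Current x b)
    (hy : S.Direction b x y) : IsAffine fun c => S.smooth (shift x y c) := by
  refine IsAffine.add ?_ ?_
  · refine IsAffine.sum fun u _ => .const_mul _ (.sum fun l hl => .add ?_ ?_)
    · exact isAffine_prod_dev hS hx hb hy S.lam _ (mem_range.1 hl)
    · have := isAffine_prod_dev hS hx hb hy (-S.lam) (S.own u) (mem_range.1 hl)
      simpa only [neg_mul, ← sub_eq_add_neg] using this
  · exact IsAffine.sum fun u hu => .const_mul _ (.sum fun l hl => .const_mul _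
      (isAffine_missing hS hy (mem_range.1 hu) (mem_range.1 hl)))

/-- An affine function cannot increase on both sides of `0`. Goodness of both end points serves to
remove the positive parts there. -/
theorem potential_shift_le (hS : S.Valid) (hx : S.Good x) (hb : S.Current x b)
    (hy : S.Direction b x y) {c₁ c₂ : ℝ} (h1 : 0 ≤ c₁) (h2 : c₂ ≤ 0)
    (hx1 : S.Good (shift x y c₁)) (hx2 : S.Good (shift x y c₂)) :
    min (S.potential (shift x y c₁)) (S.potential (shift x y c₂)) ≤ S.potential x := by
  obtain ⟨a, ha⟩ := isAffine_smooth hS hx hb hy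
  have h0 : shift x y 0 = x := by funext j l; simp [shift]
  rw [potential_eq_smooth hS hx1, potential_eq_smooth hS hx2, potential_eq_smooth hS hx, min_le_iff]
  have e1 := ha c₁
  have e2 := ha c₂
  simp only [h0] at e1 e2
  rcases le_total a 0 with h | h
  · left; nlinarith
  · right; nlinarith

end step

end Layout

/-! ### Constraint rows and their Gram matrix -/

theorem sum_range_mul {M : Type*} [AddCommMonoid M] (n k : ℕ) (f : ℕ → M) :
    ∑ q ∈ range (n * k), f q = ∑ j ∈ range n, ∑ l ∈ range k, f (j * k + l) := by
  induction n with
  | zero => simp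
  | succ n ih => rw [Nat.succ_mul, sum_range_add, ih, sum_range_succ]

theorem index_lt {n k j l : ℕ} (hj : j < n) (hl : l < k) : j * k + l < n * k := by nlinarith

theorem index_div {k j l : ℕ} (hl : l < k) : (j * k + l) / k = j := by
  rw [mul_comm, Nat.mul_add_div (by omega), Nat.div_eq_of_lt hl, add_zero]

theorem index_mod {k j l : ℕ} (hl : l < k) : (j * k + l) % k = l := by
  rw [mul_comm, Nat.mul_add_mod, Nat.mod_eq_of_lt hl]

theorem pos_of_fin_mul {n k : ℕ} (q : Fin (n * k)) : 0 < k :=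
  Nat.pos_of_ne_zero (by rintro rfl; exact absurd q.2 (by simp))

/-- The Gram matrix of the rows that a direction has to be orthogonal to. -/
def gram (k m : ℕ) (alive : ℕ → ℕ) (act : ℕ → ℕ → ℕ) (G : ℕ → ℕ → ℕ → ℕ) (q q' : ℕ) : ℕ :=
  alive q * alive q' * ((if q / k = q' / k then 1 else 0) + (if q % k = q' % k then 1 else 0) *
    ∑ i ∈ range m, act i (q % k) * G i (q / k) (q % k) * G i (q' / k) (q % k)) +
  (1 - alive q) * (if q = q' then 1 else 0)

/-- The rows that a direction has to be orthogonal to: items, functions with a colour, and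
coordinates that are not alive. -/
def rows (n k m : ℕ) (alive : ℕ → ℕ) (act : ℕ → ℕ → ℕ) (G : ℕ → ℕ → ℕ → ℕ) :
    Matrix (Fin n ⊕ (Fin m × Fin k) ⊕ Fin (n * k)) (Fin (n * k)) ℝ
  | .inl j, q => if (q : ℕ) / k = j then alive q else 0
  | .inr (.inl p), q => if (q : ℕ) % k = p.2 then alive q * act p.1 p.2 * G p.1 (q / k) p.2 else 0
  | .inr (.inr q₀), q => if q = q₀ then 1 - alive q₀ else 0

/-- The three kinds of rows give the three summands of `gram`; squares of the indicators `alive` and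
`act` disappear since these are `0` or `1`. -/
theorem gram_eq {n k m : ℕ} {alive : ℕ → ℕ} {act : ℕ → ℕ → ℕ} (G : ℕ → ℕ → ℕ → ℕ)
    (halive : ∀ q < n * k, alive q ≤ 1) (hact : ∀ i < m, ∀ l < k, act i l ≤ 1) :
    (Matrix.of fun q q' : Fin (n * k) => (gram k m alive act G q q' : ℝ)) =
      (rows n k m alive act G).transpose * rows n k m alive act G := by
  ext q q'
  have hk := pos_of_fin_mul q
  have ha := halive q q.2
  rw [Matrix.mul_apply, Fintype.sum_sum_type, Fintype.sum_sum_type, Matrix.of_apply, gram]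
  simp only [Matrix.transpose_apply, rows]
  have e1 : ∑ j : Fin n, (if (q : ℕ) / k = j then (alive q : ℝ) else 0) *
      (if (q' : ℕ) / k = j then (alive q' : ℝ) else 0) =
      alive q * alive q' * if (q : ℕ) / k = q' / k then 1 else 0 := by
    rw [Fintype.sum_eq_single ⟨(q : ℕ) / k, Nat.div_lt_of_lt_mul (q.2.trans_eq (mul_comm _ _))⟩]
    · by_cases h : (q : ℕ) / k = q' / k
      · simp [h]
      · simp [h, Ne.symm h]
    · intro j hj
      rw [if_neg, zero_mul]
      intro h; exact hj (Fin.ext h.symm)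
  have e2 : ∑ p : Fin m × Fin k,
      (if (q : ℕ) % k = p.2 then (alive q * act p.1 p.2 * G p.1 (q / k) p.2 : ℝ) else 0) *
      (if (q' : ℕ) % k = p.2 then (alive q' * act p.1 p.2 * G p.1 (q' / k) p.2 : ℝ) else 0) =
      alive q * alive q' * ((if (q : ℕ) % k = q' % k then 1 else 0) *
        ∑ i ∈ range m, (act i (q % k) * G i (q / k) (q % k) * G i (q' / k) (q % k) : ℝ)) := by
    rw [Fintype.sum_prod_type, ← Fin.sum_univ_eq_sum_range
      (fun i => (act i (q % k) * G i (q / k) (q % k) * G i (q' / k) (q % k) : ℝ)) m, mul_sum, mul_sum]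
    refine sum_congr rfl fun i _ => ?_
    rw [Fintype.sum_eq_single ⟨(q : ℕ) % k, Nat.mod_lt _ hk⟩]
    · have hb := hact i i.2 (q % k) (Nat.mod_lt _ hk)
      have hb' : (act i (q % k) : ℝ) * act i (q % k) = act i (q % k) := by
        interval_cases act i (q % k) <;> simp
      by_cases h : (q : ℕ) % k = q' % k
      · simp only [← h, if_true, one_mul]
        linear_combination (alive q * alive q' * G i (q / k) (q % k) * G i (q' / k) (q % k) : ℝ) * hb'
      · simp [h, Ne.symm h]
    · intro l hl
      rw [if_neg, zero_mul]
      intro h; exact hl (Fin.ext h.symm)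
  have e3 : ∑ q₀ : Fin (n * k), (if q = q₀ then (1 - alive q₀ : ℝ) else 0) *
      (if q' = q₀ then (1 - alive q₀ : ℝ) else 0) =
      ((1 - alive q : ℕ) : ℝ) * if (q : ℕ) = q' then 1 else 0 := by
    rw [Fintype.sum_eq_single q]
    · rw [Nat.cast_sub ha]
      by_cases h : q = q'
      · subst h
        interval_cases alive q <;> simp
      · simp [Ne.symm h, Fin.val_inj, h]
    · intro l hl
      rw [if_neg hl.symm, zero_mul]
  rw [e1, e2, e3]
  push_cast
  ring

section kernel
variable {n k m : ℕ} {alive : ℕ → ℕ} {act : ℕ → ℕ → ℕ} {G : ℕ → ℕ → ℕ → ℕ}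

theorem isSymm_gram (halive : ∀ q < n * k, alive q ≤ 1) (hact : ∀ i < m, ∀ l < k, act i l ≤ 1) :
    (Matrix.of fun q q' : Fin (n * k) => (gram k m alive act G q q' : ℝ)).IsSymm := by
  rw [gram_eq G halive hact, Matrix.IsSymm, Matrix.transpose_mul, Matrix.transpose_transpose]

/-- Over the reals `AᵀA y = 0` forces `A y = 0`. Passing to `AᵀA` makes the system square and
symmetric, as the recursion requires. -/
theorem gram_mulVec_eq_zero (halive : ∀ q < n * k, alive q ≤ 1)
    (hact : ∀ i < m, ∀ l < k, act i l ≤ 1) (y : Fin (n * k) → ℝ) :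
    (Matrix.of fun q q' : Fin (n * k) => (gram k m alive act G q q' : ℝ)).mulVec y = 0 ↔
      (rows n k m alive act G).mulVec y = 0 := by
  rw [gram_eq G halive hact]
  have := Matrix.conjTranspose_mul_self_mulVec_eq_zero (rows n k m alive act G) y
  rwa [Matrix.conjTranspose_eq_transpose_of_trivial] at this

/-- There are fewer nonzero rows than coordinates, so that the kernel is nontrivial. -/
theorem exists_rows_mulVec_eq_zero {items actives alives : ℕ}
    (halive : ∀ q < n * k, alive q ≤ 1)
    (hitems : ((range n).filter fun j => ∃ l < k, alive (j * k + l) ≠ 0).card ≤ items)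
    (hactives : (((range m) ×ˢ (range k)).filter fun p => act p.1 p.2 ≠ 0).card ≤ actives)
    (halives : alives ≤ ((range (n * k)).filter fun q => alive q ≠ 0).card)
    (h : items + actives < alives) :
    ∃ z : Fin (n * k) → ℝ, z ≠ 0 ∧ (rows n k m alive act G).mulVec z = 0 := by
  classical
  let R := Fin n ⊕ (Fin m × Fin k) ⊕ Fin (n * k)
  let nz : R → Prop := fun r => ∃ q, rows n k m alive act G r q ≠ 0
  -- Nonzero rows come from live items, active pairs and dead coordinates. The dead ones number at
  -- most `n * k - alives`, so the total is below `n * k`.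
  have hcard : Fintype.card {r // nz r} < n * k := by
    have h1 : Fintype.card {r // nz r} ≤
        ((univ : Finset (Fin n)).filter fun j : Fin n => ∃ l < k, alive (j * k + l) ≠ 0).card +
        (((univ : Finset (Fin m × Fin k)).filter fun p => act p.1 p.2 ≠ 0).card +
        ((univ : Finset (Fin (n * k))).filter fun q : Fin (n * k) => alive q = 0).card) := by
      rw [Fintype.card_subtype, card_filter, Fintype.sum_sum_type, Fintype.sum_sum_type,
        card_filter, card_filter, card_filter]
      have hif : ∀ {P Q : Prop} [Decidable P] [Decidable Q], (P → Q) →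
          (if P then 1 else 0 : ℕ) ≤ if Q then 1 else 0 := by
        intro P Q _ _ hPQ
        split_ifs with hp hq
        · exact le_rfl
        · exact absurd (hPQ hp) hq
        · exact Nat.zero_le _
        · exact le_rfl
      refine add_le_add (sum_le_sum fun j _ => hif ?_) (add_le_add (sum_le_sum fun p _ => hif ?_)
        (sum_le_sum fun q₀ _ => hif ?_))
      · rintro ⟨q, hq⟩
        simp only [rows, ne_eq, ite_eq_right_iff, Nat.cast_eq_zero, Classical.not_imp] at hq
        have hk := pos_of_fin_mul q
        refine ⟨q % k, Nat.mod_lt _ hk, ?_⟩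
        rw [← hq.1, mul_comm, Nat.div_add_mod]
        exact hq.2
      · rintro ⟨q, hq⟩ h0
        exact hq (by simp [rows, h0])
      · rintro ⟨q, hq⟩
        by_contra h0
        have : alive q₀ = 1 := by have := halive q₀ q₀.2; omega
        exact hq (by simp [rows, this])
    have fin_card : ∀ (N : ℕ) (P : ℕ → Prop) [DecidablePred P],
        ((univ : Finset (Fin N)).filter fun j : Fin N => P j).card = ((range N).filter P).card := by
      intro N P _
      rw [card_filter, card_filter, Fin.sum_univ_eq_sum_range (fun j => if P j then 1 else 0)]
    have c2 : ((univ : Finset (Fin m × Fin k)).filter fun p => act p.1 p.2 ≠ 0).card =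
        (((range m) ×ˢ (range k)).filter fun p => act p.1 p.2 ≠ 0).card := by
      rw [card_filter, card_filter, Fintype.sum_prod_type, sum_product,
        ← Fin.sum_univ_eq_sum_range (fun i => ∑ l ∈ range k, if act i l ≠ 0 then 1 else 0)]
      exact sum_congr rfl fun i _ =>
        Fin.sum_univ_eq_sum_range (fun l => if act i l ≠ 0 then 1 else 0) k
    have c3 := card_filter_add_card_filter_not (s := range (n * k)) (fun q => alive q ≠ 0)
    simp only [not_not, card_range] at c3
    rw [fin_card n (fun j => ∃ l < k, alive (j * k + l) ≠ 0), c2,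
      fin_card (n * k) (fun q => alive q = 0)] at h1
    omega
  let A : Matrix {r // nz r} (Fin (n * k)) ℝ := fun r q => rows n k m alive act G r q
  obtain ⟨z, hz, hne⟩ := (Submodule.ne_bot_iff _).1 (LinearMap.ker_ne_bot_of_finrank_lt
    (f := A.mulVecLin) (by simpa using hcard))
  refine ⟨z, hne, ?_⟩
  funext r
  by_cases hr : nz r
  · exact congrFun (LinearMap.mem_ker.1 hz) ⟨r, hr⟩
  · simp only [nz, not_exists, not_not] at hr
    simp [Matrix.mulVec, dotProduct, hr]

end kernel

/-! ### Existence of a direction for the current class -/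

namespace Layout

open Classical in
/-- Natural numbers describing the rows that belong to the class `b` of the colouring `x`. -/
structure Coords (S : Layout) (b : ℕ) (x : ℕ → ℕ → ℝ) (w : ℕ) (alive : ℕ → ℕ) (act : ℕ → ℕ → ℕ)
    (G : ℕ → ℕ → ℕ → ℕ) : Prop where
  w_pos : 0 < w
  alive_eq : ∀ j < S.n, ∀ l < S.k, alive (j * S.k + l) = if S.cls j = b ∧ Frac x j l then 1 else 0
  G_eq : ∀ i < S.m, ∀ j < S.n, ∀ l < S.k, S.cls j = b → (G i j l : ℝ) = w * S.grad b x i j l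
  act_eq : ∀ i < S.m, ∀ l < S.k, act i l =
    if 4 * S.deg * w < ∑ j ∈ range S.n, alive (j * S.k + l) * G i j l then 1 else 0

section
variable {S : Layout} {b : ℕ} {x : ℕ → ℕ → ℝ} {w : ℕ} {alive : ℕ → ℕ} {act : ℕ → ℕ → ℕ}
  {G : ℕ → ℕ → ℕ → ℕ}

theorem Coords.alive_le (hS : S.Valid) (h : S.Coords b x w alive act G) :
    ∀ q < S.n * S.k, alive q ≤ 1 := by
  classical
  intro q hq
  have hk := hS.k_pos
  have := h.alive_eq (q / S.k) (Nat.div_lt_of_lt_mul (hq.trans_eq (mul_comm _ _))) (q % S.k)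
    (Nat.mod_lt _ hk)
  rw [mul_comm, Nat.div_add_mod] at this
  rw [this]
  split_ifs <;> simp

theorem Coords.act_le (h : S.Coords b x w alive act G) : ∀ i < S.m, ∀ l < S.k, act i l ≤ 1 := by
  intro i hi l hl
  rw [h.act_eq i hi l hl]
  split_ifs <;> simp

theorem Coords.alive_mul_G (h : S.Coords b x w alive act G) {i j l : ℕ} (hi : i < S.m) (hj : j < S.n)
    (hl : l < S.k) : (alive (j * S.k + l) : ℝ) * G i j l = w * (alive (j * S.k + l) * S.grad b x i j l) := by
  classical
  rw [h.alive_eq j hj l hl]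
  split_ifs with hc
  · rw [h.G_eq i hi j hj l hl hc.1]; simp
  · simp

/-- With `A` live coordinates there are at most `A / 2` live items and `A / 4` active rows, and `3A
/ 4 < A` because the current class has a fractional coordinate. -/
theorem exists_kernel (hS : S.Valid) (hx : S.Good x) (hb : S.Current x b)
    (h : S.Coords b x w alive act G) :
    ∃ z : Fin (S.n * S.k) → ℝ, z ≠ 0 ∧ (rows S.n S.k S.m alive act G).mulVec z = 0 := by
  classical
  set A := ∑ q ∈ range (S.n * S.k), alive q with hA
  have hale := h.alive_le hS
  have hcard : ((range (S.n * S.k)).filter fun q => alive q ≠ 0).card = A := by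
    rw [card_filter]
    refine sum_congr rfl fun q hq => ?_
    have := hale q (mem_range.1 hq)
    split_ifs <;> omega
  set I := ((range S.n).filter fun j => ∃ l < S.k, alive (j * S.k + l) ≠ 0).card with hI
  set C := (((range S.m) ×ˢ (range S.k)).filter fun p => act p.1 p.2 ≠ 0).card with hC
  have hpos : 0 < A := by
    obtain ⟨⟨j, hj, l, hl, hc, hf⟩, -⟩ := hb
    refine sum_pos' (fun _ _ => Nat.zero_le _) ⟨j * S.k + l, mem_range.2 (index_lt hj hl), ?_⟩
    rw [h.alive_eq j hj l hl, if_pos ⟨hc, hf⟩]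
    exact one_pos
  -- The weights of an item sum to `1`, so one fractional coordinate forces another.
  have h2I : 2 * I ≤ A := by
    rw [hA, sum_range_mul, hI, card_filter, mul_sum]
    refine sum_le_sum fun j hj => ?_
    have hj := mem_range.1 hj
    split_ifs with hex
    · obtain ⟨l, hl, hne⟩ := hex
      rw [h.alive_eq j hj l hl] at hne
      have hcf : S.cls j = b ∧ Frac x j l := by
        by_contra hn; exact hne (if_neg hn)
      obtain ⟨l', hl', hll, hpos'⟩ : ∃ l' < S.k, l' ≠ l ∧ 0 < x j l' := by
        by_contra hno
        push Not at hno
        have h1 := hx.sum_one j hj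
        rw [← add_sum_erase _ _ (mem_range.2 hl)] at h1
        have h3 : ∑ l' ∈ (range S.k).erase l, x j l' ≤ 0 := sum_nonpos fun l' hl' =>
          hno l' (mem_range.1 (mem_erase.1 hl').2) (mem_erase.1 hl').1
        linarith [hcf.2.2]
      have hf' : Frac x j l' := by
        refine ⟨hpos', ?_⟩
        have h1 := hx.sum_one j hj
        rw [← add_sum_erase _ _ (mem_range.2 hl')] at h1
        have h3 : x j l ≤ ∑ l'' ∈ (range S.k).erase l', x j l'' :=
          single_le_sum (f := fun l => x j l) (fun l'' hl'' => hx.nonneg j hj l''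
            (mem_range.1 (mem_erase.1 hl'').2)) (mem_erase.2 ⟨hll.symm, mem_range.2 hl⟩)
        linarith [hcf.2.1]
      calc 2 * 1 = ∑ l'' ∈ {l, l'}, alive (j * S.k + l'') := by
            rw [sum_pair hll.symm, h.alive_eq j hj l hl, h.alive_eq j hj l' hl', if_pos hcf,
              if_pos ⟨hcf.1, hf'⟩]
        _ ≤ _ := sum_le_sum_of_subset (by
            intro a ha
            rcases mem_insert.1 ha with rfl | ha
            · exact mem_range.2 hl
            · rw [mem_singleton.1 ha]; exact mem_range.2 hl')
    · simp
  -- Every active row carries a live gradient above `4 * deg` (scaled by `w`), while every live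
  -- coordinate contributes at most `deg` to all rows together.
  have h4C : 4 * C ≤ A := by
    have hw : (0 : ℝ) < w := by exact_mod_cast h.w_pos
    have hd : (0 : ℝ) < S.deg := by exact_mod_cast hS.deg_pos
    have e : (4 * S.deg * w : ℝ) * C ≤ S.deg * w * A := by
      calc (4 * S.deg * w : ℝ) * C =
          ∑ i ∈ range S.m, ∑ l ∈ range S.k, (4 * S.deg * w : ℝ) * (if act i l ≠ 0 then 1 else 0) := by
            rw [hC, card_filter, sum_product]
            push_cast
            rw [mul_sum]
            exact sum_congr rfl fun i _ => mul_sum _ _ _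
        _ ≤ ∑ i ∈ range S.m, ∑ l ∈ range S.k, ∑ j ∈ range S.n,
            (alive (j * S.k + l) : ℝ) * G i j l := by
            refine sum_le_sum fun i hi => sum_le_sum fun l hl => ?_
            rw [h.act_eq i (mem_range.1 hi) l (mem_range.1 hl)]
            by_cases hlt : 4 * S.deg * w < ∑ j ∈ range S.n, alive (j * S.k + l) * G i j l
            · rw [if_pos hlt, if_pos one_ne_zero, mul_one]
              exact_mod_cast hlt.le
            · rw [if_neg hlt, if_neg (by simp), mul_zero]
              positivity
        _ = ∑ j ∈ range S.n, ∑ l ∈ range S.k, ∑ i ∈ range S.m,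
            w * (alive (j * S.k + l) * S.grad b x i j l) := by
            rw [sum_comm, sum_congr rfl fun l _ => sum_comm, sum_comm]
            exact sum_congr rfl fun j hj => sum_congr rfl fun l hl => sum_congr rfl fun i hi =>
              h.alive_mul_G (mem_range.1 hi) (mem_range.1 hj) (mem_range.1 hl)
        _ ≤ ∑ j ∈ range S.n, ∑ l ∈ range S.k, S.deg * w * (alive (j * S.k + l) : ℝ) := by
            refine sum_le_sum fun j hj => sum_le_sum fun l hl => ?_
            have := sum_grad_le hS hx b (mem_range.1 hj) (mem_range.1 hl)
            rw [← mul_sum, ← mul_sum]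
            have ha : (0 : ℝ) ≤ alive (j * S.k + l) := Nat.cast_nonneg _
            nlinarith [mul_le_mul_of_nonneg_left this (mul_nonneg hw.le ha)]
        _ = S.deg * w * A := by
            rw [hA, sum_range_mul]
            push_cast
            simp only [mul_sum]
    have : (4 * C : ℝ) ≤ A := by
      have hdw := mul_pos hd hw
      nlinarith
    exact_mod_cast this
  exact exists_rows_mulVec_eq_zero hale le_rfl le_rfl hcard.ge (by omega)

/-- Rows of dead coordinates give `support`, item rows give `sum_zero`, active rows give the first
alternative of `keep`; inactivity is the second one. -/
theorem direction_of_kernel (hS : S.Valid) (h : S.Coords b x w alive act G) {y : ℕ → ℝ}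
    (hy : (rows S.n S.k S.m alive act G).mulVec (fun q => y q) = 0) :
    S.Direction b x fun j l => y (j * S.k + l) := by
  classical
  have hsum : ∀ f : ℕ → ℝ, ∑ q : Fin (S.n * S.k), f q =
      ∑ j ∈ range S.n, ∑ l ∈ range S.k, f (j * S.k + l) := fun f => by
    rw [Fin.sum_univ_eq_sum_range f, sum_range_mul]
  have hdead : ∀ q < S.n * S.k, alive q = 0 → y q = 0 := by
    intro q hq h0
    have := congrFun hy (.inr (.inr ⟨q, hq⟩))
    simp only [Matrix.mulVec, dotProduct, rows, Pi.zero_apply] at this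
    rw [Fintype.sum_eq_single ⟨q, hq⟩ fun q' hq' => by rw [if_neg hq', zero_mul]] at this
    simpa [h0] using this
  have hay : ∀ j < S.n, ∀ l < S.k, (alive (j * S.k + l) : ℝ) * y (j * S.k + l) = y (j * S.k + l) := by
    intro j hj l hl
    have h1 := h.alive_le hS _ (index_lt hj hl)
    rcases Nat.le_one_iff_eq_zero_or_eq_one.1 h1 with h0 | h0
    · rw [hdead _ (index_lt hj hl) h0, mul_zero]
    · rw [h0, Nat.cast_one, one_mul]
  have hsupp : ∀ j < S.n, ∀ l < S.k, y (j * S.k + l) ≠ 0 → S.cls j = b ∧ Frac x j l := by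
    intro j hj l hl hne
    by_contra hn
    exact hne (hdead _ (index_lt hj hl) (by rw [h.alive_eq j hj l hl, if_neg hn]))
  refine ⟨hsupp, fun j hj => ?_, fun i l hl => ?_⟩
  · have := congrFun hy (.inl ⟨j, hj⟩)
    simp only [Matrix.mulVec, dotProduct, rows, Pi.zero_apply] at this
    rw [hsum fun q => (if q / S.k = j then (alive q : ℝ) else 0) * y q,
      sum_eq_single_of_mem j (mem_range.2 hj)] at this
    · rw [← this]
      refine sum_congr rfl fun l hl => ?_
      have hl := mem_range.1 hl
      rw [index_div hl, if_pos rfl, hay j hj l hl]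
    · intro j' _ hne
      refine sum_eq_zero fun l hl => ?_
      rw [index_div (mem_range.1 hl), if_neg hne, zero_mul]
  · by_cases hi : i < S.m
    · have e1 : ∑ j ∈ range S.n, (if S.cls j = b ∧ Frac x j l then S.grad b x i j l else 0) * w =
          ((∑ j ∈ range S.n, alive (j * S.k + l) * G i j l : ℕ) : ℝ) := by
        push_cast
        refine sum_congr rfl fun j hj => ?_
        rw [h.alive_mul_G hi (mem_range.1 hj) hl, h.alive_eq j (mem_range.1 hj) l hl]
        split_ifs <;> simp [mul_comm]
      have hw : (0 : ℝ) < w := by exact_mod_cast h.w_pos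
      by_cases hact : 4 * S.deg * w < ∑ j ∈ range S.n, alive (j * S.k + l) * G i j l
      · left
        have := congrFun hy (.inr (.inl (⟨i, hi⟩, ⟨l, hl⟩)))
        simp only [Matrix.mulVec, dotProduct, rows, Pi.zero_apply] at this
        rw [h.act_eq i hi l hl, if_pos hact, hsum fun q =>
          (if q % S.k = l then (alive q * (1 : ℕ) * G i (q / S.k) l : ℝ) else 0) * y q] at this
        have e2 : ∑ j ∈ range S.n, ∑ l' ∈ range S.k, (if (j * S.k + l') % S.k = l then
            (alive (j * S.k + l') * (1 : ℕ) * G i ((j * S.k + l') / S.k) l : ℝ) else 0) *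
              y (j * S.k + l') =
            w * ∑ j ∈ range S.n, if S.cls j = b then S.grad b x i j l * y (j * S.k + l) else 0 := by
          rw [mul_sum]
          refine sum_congr rfl fun j hj => ?_
          have hj := mem_range.1 hj
          rw [sum_eq_single_of_mem l (mem_range.2 hl)]
          · rw [index_mod hl, if_pos rfl, index_div hl, Nat.cast_one, mul_one,
              h.alive_mul_G hi hj hl]
            by_cases hc : S.cls j = b
            · rw [if_pos hc]
              linear_combination (w * S.grad b x i j l : ℝ) * hay j hj l hl
            · rw [if_neg hc, h.alive_eq j hj l hl, if_neg fun h => hc h.1]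
              simp
          · intro l' hl' hne
            rw [index_mod (mem_range.1 hl'), if_neg hne, zero_mul]
        rw [e2] at this
        exact (mul_eq_zero.1 this).resolve_left hw.ne'
      · right
        have e3 : ((∑ j ∈ range S.n, alive (j * S.k + l) * G i j l : ℕ) : ℝ) ≤ 4 * S.deg * w := by
          exact_mod_cast Nat.not_lt.1 hact
        rw [← e1, ← sum_mul] at e3
        exact le_of_mul_le_mul_right e3 hw
    · left
      refine sum_eq_zero fun j _ => ?_
      have : S.grad b x i j l = 0 := sum_eq_zero fun u hu => if_neg fun (hu' : S.own u = i) => hi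
        (hu' ▸ hS.own_lt u (mem_range.1 hu))
      simp [this]

end

end Layout

namespace Layout

variable {S : Layout}

/-! ### The uniform colouring -/

theorem dev_uniform (b i l : ℕ) : S.dev b (fun _ _ => 1 / S.k) i l = 0 :=
  sum_eq_zero fun j _ => by simp

theorem good_uniform (hS : S.Valid) : S.Good fun _ _ => 1 / S.k where
  nonneg _ _ _ _ := (inv_k_mem hS).1.le
  sum_one _ _ := by
    have : (S.k : ℝ) ≠ 0 := by have := hS.k_pos; positivity
    simp [this]
  order _ _ _ _ _ _ _ _ _ _ := rfl
  bound b i l _ := .inl (dev_uniform b i l)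

theorem missing_uniform_le (hS : S.Valid) {u s : ℕ} (hs : s ≤ ∑ j ∈ range S.n, S.mem u j) (l : ℕ) :
    S.missing (fun _ _ => 1 / S.k) u l ≤ (1 - 1 / S.k) ^ s := by
  have hk := inv_k_mem hS
  have h : S.missing (fun _ _ => 1 / S.k) u l = (1 - 1 / S.k) ^ ∑ j ∈ range S.n, S.mem u j := by
    rw [← prod_pow_eq_pow_sum]
    refine prod_congr rfl fun j _ => ?_
    rcases Nat.le_one_iff_eq_zero_or_eq_one.1 (hS.mem_le u j) with h | h <;> simp [h]
  rw [h]
  exact pow_le_pow_of_le_one (by linarith) (by linarith) hs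

/-- Bernoulli's inequality for the reciprocal: `(1 + 1 / (k - 1)) ^ k ≥ 1 + k / (k - 1) ≥ 2`. -/
theorem one_sub_inv_pow_le {k : ℕ} (hk : 1 ≤ k) : (1 - 1 / (k : ℝ)) ^ k ≤ 1 / 2 := by
  rcases hk.eq_or_lt with rfl | hk
  · norm_num
  have hk1 : (1 : ℝ) < k := by exact_mod_cast hk
  have h0 : (0 : ℝ) < 1 - 1 / k := by rw [sub_pos, div_lt_one (by linarith)]; exact hk1
  have h := one_add_mul_le_pow (a := 1 / ((k : ℝ) - 1)) (by
    have : 0 < 1 / ((k : ℝ) - 1) := one_div_pos.2 (by linarith)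
    linarith) k
  have h1 : (1 : ℝ) + 1 / ((k : ℝ) - 1) = (1 - 1 / (k : ℝ))⁻¹ := by
    have h3 : (k : ℝ) - 1 ≠ 0 := (sub_pos.2 hk1).ne'
    have h4 : (k : ℝ) ≠ 0 := by linarith
    refine eq_inv_of_mul_eq_one_left ?_
    field_simp
    ring
  have h2 : (1 : ℝ) ≤ (k : ℝ) * (1 / ((k : ℝ) - 1)) := by
    rw [mul_one_div, le_div_iff₀ (by linarith)]; linarith
  rw [h1, inv_pow] at h
  have h3 : (2 : ℝ) ≤ ((1 - 1 / (k : ℝ)) ^ k)⁻¹ := by linarith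
  have := inv_anti₀ (by norm_num) h3
  rwa [inv_inv, inv_eq_one_div] at this

/-- All deviations vanish, so the first part is exactly `2ek`. A big set is missed with probability
at most `2 ^ -(2L + 2)`, so the second part is at most `ek * 4ek / (4 * 4 ^ L) ≤ 1`. -/
theorem potential_uniform_le (hS : S.Valid) {L : ℕ}
    (hL : (∑ u ∈ range S.E, S.nonempty u) * S.k ≤ 2 ^ L)
    (hweight : S.weight = 4 * ((∑ u ∈ range S.E, S.nonempty u) * S.k))
    (hbig : ∀ u < S.E, S.big u ≤ S.nonempty u)
    (hmem : ∀ u < S.E, S.big u ≠ 0 → S.k * (2 * L + 2) ≤ ∑ j ∈ range S.n, S.mem u j) :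
    S.potential (fun _ _ => 1 / S.k) ≤ 2 * ((∑ u ∈ range S.E, S.nonempty u) * S.k : ℕ) + 1 := by
  set e := ∑ u ∈ range S.E, S.nonempty u with he
  rw [potential_eq_smooth hS (good_uniform hS), smooth]
  have h1 : ∑ u ∈ range S.E, (S.nonempty u : ℝ) * ∑ l ∈ range S.k,
      (∏ b ∈ range S.n, (1 + S.lam * S.dev b (fun _ _ => 1 / S.k) (S.own u) l) +
        ∏ b ∈ range S.n, (1 - S.lam * S.dev b (fun _ _ => 1 / S.k) (S.own u) l)) =
      2 * (e * S.k : ℕ) := by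
    simp only [dev_uniform]
    rw [← sum_mul]
    simp [he]
    ring
  have h2 : ∑ u ∈ range S.E, (S.big u : ℝ) * ∑ l ∈ range S.k,
      S.weight * S.missing (fun _ _ => 1 / S.k) u l ≤ 1 := by
    have h3 : ∀ u ∈ range S.E, (S.big u : ℝ) * ∑ l ∈ range S.k,
        S.weight * S.missing (fun _ _ => 1 / S.k) u l ≤
        S.nonempty u * (S.k * (S.weight * (1 / 2) ^ (2 * L + 2))) := by
      intro u hu
      have hu := mem_range.1 hu
      by_cases hb : S.big u = 0
      · rw [hb, Nat.cast_zero, zero_mul]; positivity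
      · have hm : ∀ l ∈ range S.k, S.weight * S.missing (fun _ _ => 1 / S.k) u l ≤
            S.weight * (1 / 2) ^ (2 * L + 2) := by
          intro l _
          refine mul_le_mul_of_nonneg_left ?_ (Nat.cast_nonneg _)
          refine (missing_uniform_le hS (hmem u hu hb) l).trans ?_
          rw [pow_mul]
          exact pow_le_pow_left₀ (pow_nonneg (by linarith [(inv_k_mem hS).2]) _)
            (one_sub_inv_pow_le hS.k_pos) _
        have hs := sum_le_sum hm
        rw [sum_const, card_range, nsmul_eq_mul] at hs
        have hbn : (S.big u : ℝ) ≤ S.nonempty u := by exact_mod_cast hbig u hu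
        exact mul_le_mul hbn hs (sum_nonneg fun l hl => mul_nonneg (Nat.cast_nonneg _)
          (prod_nonneg fun j _ => (factor_mem hS u j (inv_k_mem hS).1.le (inv_k_mem hS).2).1))
          (Nat.cast_nonneg _)
    refine (sum_le_sum h3).trans ?_
    rw [← sum_mul, ← Nat.cast_sum, ← he, hweight]
    have hL' : ((e * S.k : ℕ) : ℝ) ≤ 2 ^ L := by exact_mod_cast hL
    have hL2 : (((e * S.k : ℕ) : ℝ)) ^ 2 ≤ 4 ^ L := by
      calc _ ≤ ((2 : ℝ) ^ L) ^ 2 := pow_le_pow_left₀ (Nat.cast_nonneg _) hL' 2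
        _ = _ := by rw [← pow_mul, mul_comm, pow_mul]; norm_num
    have e2 : (1 / 2 : ℝ) ^ (2 * L + 2) = 1 / (4 * 4 ^ L) := by
      rw [pow_add, pow_mul]; norm_num [div_pow]
    rw [e2]
    have h4 : (0 : ℝ) < 4 ^ L := by positivity
    have e3 : (e : ℝ) * (S.k * (((4 * (e * S.k) : ℕ) : ℝ) * (1 / (4 * 4 ^ L)))) =
        ((e * S.k : ℕ) : ℝ) ^ 2 / 4 ^ L := by push_cast; field_simp
    rw [e3, div_le_one h4]
    exact hL2
  linarith

/-! ### Rounded colourings -/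

theorem log_one_add_ge {z : ℝ} (hz : |z| ≤ 1 / 2) : z - 2 * z ^ 2 ≤ Real.log (1 + z) := by
  have h := abs_le.1 hz
  have hp : 0 < 1 + z := by linarith
  have h1 := Real.log_le_sub_one_of_pos (inv_pos.2 hp)
  rw [Real.log_inv] at h1
  have h2 : (1 + z)⁻¹ ≤ 1 - z + 2 * z ^ 2 := by
    rw [inv_le_iff_one_le_mul₀ hp]
    nlinarith [sq_nonneg z]
  linarith

/-- Take logarithms and use `log (1 + z) ≥ z - 2 z ^ 2`. The quadratic loss is paid only for the at
most `R` classes in use. -/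
theorem sum_le_of_prod_le {z : ℕ → ℝ} {n R : ℕ} {d B : ℝ} (hd : d ≤ 1 / 2)
    (hz : ∀ b < n, |z b| ≤ d) (h0 : ∀ b < n, R ≤ b → z b = 0)
    (hB : ∏ b ∈ range n, (1 + z b) ≤ B) : ∑ b ∈ range n, z b ≤ Real.log B + 2 * R * d ^ 2 := by
  have hpos : ∀ b ∈ range n, 0 < 1 + z b := fun b hb => by
    have := abs_le.1 (hz b (mem_range.1 hb)); linarith
  have h1 : ∑ b ∈ range n, Real.log (1 + z b) ≤ Real.log B := by
    rw [← Real.log_prod fun b hb => (hpos b hb).ne']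
    exact Real.log_le_log (prod_pos hpos) hB
  have h2 : ∀ b ∈ range n, z b ≤ Real.log (1 + z b) + if b < R then 2 * d ^ 2 else 0 := by
    intro b hb
    have hb := mem_range.1 hb
    split_ifs with hR
    · have h3 := log_one_add_ge ((hz b hb).trans hd)
      have h4 : z b ^ 2 ≤ d ^ 2 := by
        rw [← sq_abs]; exact pow_le_pow_left₀ (abs_nonneg _) (hz b hb) 2
      linarith
    · rw [h0 b hb (Nat.not_lt.1 hR)]; simp
  have h3 := sum_le_sum h2
  rw [sum_add_distrib] at h3
  have h4 : ∑ b ∈ range n, (if b < R then 2 * d ^ 2 else 0) ≤ 2 * R * d ^ 2 := by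
    rw [← sum_filter, sum_const, nsmul_eq_mul]
    have : ((range n).filter (· < R)).card ≤ R := by
      calc _ ≤ (range R).card := card_le_card fun b hb => mem_range.2 (mem_filter.1 hb).2
        _ = R := card_range R
    have : (((range n).filter (· < R)).card : ℝ) ≤ R := by exact_mod_cast this
    nlinarith [sq_nonneg d]
  linarith

theorem term_nonneg (x : ℕ → ℕ → ℝ) (u : ℕ) : 0 ≤ (S.nonempty u : ℝ) * ∑ l ∈ range S.k,
    (∏ b ∈ range S.n, max (1 + S.lam * S.dev b x (S.own u) l) 0 +
      ∏ b ∈ range S.n, max (1 - S.lam * S.dev b x (S.own u) l) 0) :=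
  mul_nonneg (Nat.cast_nonneg _) (sum_nonneg fun _ _ => add_nonneg
    (prod_nonneg fun _ _ => le_max_right _ _) (prod_nonneg fun _ _ => le_max_right _ _))

theorem term_nonneg' (x : ℕ → ℕ → ℝ) (u : ℕ) : 0 ≤ (S.big u : ℝ) * ∑ l ∈ range S.k,
    S.weight * ∏ j ∈ range S.n, max (1 - S.mem u j * x j l) 0 :=
  mul_nonneg (Nat.cast_nonneg _) (sum_nonneg fun _ _ => mul_nonneg (Nat.cast_nonneg _)
    (prod_nonneg fun _ _ => le_max_right _ _))

/-- All terms of the potential are nonnegative, so each of the two products for `(u, l)` is at most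
`B`. The one with plus signs bounds the sum from above, the other one from below. -/
theorem abs_sum_dev_le (hS : S.Valid) {x : ℕ → ℕ → ℝ} (hx : S.Good x) {B : ℝ}
    (hB : S.potential x ≤ B) {R : ℕ} (hR : ∀ j < S.n, S.cls j < R) {u l : ℕ} (hu : u < S.E)
    (hl : l < S.k) (hne : S.nonempty u ≠ 0) :
    S.lam * |∑ b ∈ range S.n, S.dev b x (S.own u) l| ≤
      Real.log B + 2 * R * (S.lam * (4 * S.deg)) ^ 2 := by
  have hW : ∏ b ∈ range S.n, max (1 + S.lam * S.dev b x (S.own u) l) 0 +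
      ∏ b ∈ range S.n, max (1 - S.lam * S.dev b x (S.own u) l) 0 ≤ B := by
    refine le_trans ?_ hB
    unfold potential
    refine le_add_of_le_of_nonneg ?_ (sum_nonneg fun u _ => term_nonneg' x u)
    refine le_trans ?_ (single_le_sum (fun u _ => term_nonneg x u) (mem_range.2 hu))
    have h1 : (1 : ℝ) ≤ S.nonempty u := by exact_mod_cast Nat.one_le_iff_ne_zero.2 hne
    refine le_trans ?_ (le_mul_of_one_le_left (sum_nonneg fun _ _ => add_nonneg
      (prod_nonneg fun _ _ => le_max_right _ _) (prod_nonneg fun _ _ => le_max_right _ _)) h1)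
    exact single_le_sum (f := fun l => ∏ b ∈ range S.n, max (1 + S.lam * S.dev b x (S.own u) l) 0 +
      ∏ b ∈ range S.n, max (1 - S.lam * S.dev b x (S.own u) l) 0) (fun _ _ => add_nonneg
      (prod_nonneg fun _ _ => le_max_right _ _) (prod_nonneg fun _ _ => le_max_right _ _))
      (mem_range.2 hl)
  have p1 : 0 ≤ ∏ b ∈ range S.n, max (1 + S.lam * S.dev b x (S.own u) l) 0 :=
    prod_nonneg fun _ _ => le_max_right _ _
  have p2 : 0 ≤ ∏ b ∈ range S.n, max (1 - S.lam * S.dev b x (S.own u) l) 0 :=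
    prod_nonneg fun _ _ => le_max_right _ _
  have hdev : ∀ b, |S.lam * S.dev b x (S.own u) l| ≤ S.lam * (4 * S.deg) := fun b => by
    rw [abs_mul, abs_of_pos hS.lam_pos]
    exact mul_le_mul_of_nonneg_left (abs_dev_le hS hx b _ hl) hS.lam_pos.le
  have hzero : ∀ b, R ≤ b → S.dev b x (S.own u) l = 0 := fun b hb => sum_eq_zero fun j hj => by
    rw [if_neg]; have := hR j (mem_range.1 hj); omega
  have habs := fun b => abs_le.1 (abs_lam_mul_dev_le hS hx b (S.own u) hl)
  have e1 : ∏ b ∈ range S.n, max (1 + S.lam * S.dev b x (S.own u) l) 0 =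
      ∏ b ∈ range S.n, (1 + S.lam * S.dev b x (S.own u) l) :=
    prod_congr rfl fun b _ => max_eq_left (by linarith [(habs b).1])
  have e2 : ∏ b ∈ range S.n, max (1 - S.lam * S.dev b x (S.own u) l) 0 =
      ∏ b ∈ range S.n, (1 + -(S.lam * S.dev b x (S.own u) l)) :=
    prod_congr rfl fun b _ => (max_eq_left (by linarith [(habs b).2])).trans (sub_eq_add_neg _ _)
  have s1 := sum_le_of_prod_le hS.lam_le (fun b _ => hdev b)
    (fun b _ hb => by rw [hzero b hb, mul_zero])
    (e1 ▸ (by linarith : ∏ b ∈ range S.n, max (1 + S.lam * S.dev b x (S.own u) l) 0 ≤ B))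
  have s2 := sum_le_of_prod_le hS.lam_le (fun b _ => (abs_neg _).trans_le (hdev b))
    (fun b _ hb => by rw [hzero b hb, mul_zero, neg_zero])
    (e2 ▸ (by linarith : ∏ b ∈ range S.n, max (1 - S.lam * S.dev b x (S.own u) l) 0 ≤ B))
  rw [sum_neg_distrib, ← mul_sum] at s2
  rw [← mul_sum] at s1
  rw [← abs_of_pos hS.lam_pos, ← abs_mul, abs_of_pos hS.lam_pos, abs_le]
  constructor <;> linarith

/-- A rounded colouring of small potential misses no big element. -/
theorem exists_of_big {x : ℕ → ℕ → ℝ} (hx : S.Good x)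
    (hint : ∀ j < S.n, ∀ l < S.k, ¬ Frac x j l) (hB : S.potential x < S.weight) {u l : ℕ}
    (hu : u < S.E) (hl : l < S.k) (hbig : S.big u ≠ 0) :
    ∃ j < S.n, S.mem u j ≠ 0 ∧ x j l = 1 := by
  by_contra hno
  push Not at hno
  have hx0 : ∀ j < S.n, (S.mem u j : ℝ) * x j l = 0 := by
    intro j hj
    by_cases hm : S.mem u j = 0
    · simp [hm]
    · have h1 := hno j hj hm
      have h2 := hx.nonneg j hj l hl
      have h3 := hx.le_one hj hl
      have : x j l = 0 := by
        by_contra h0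
        exact hint j hj l hl ⟨lt_of_le_of_ne h2 (Ne.symm h0), lt_of_le_of_ne h3 h1⟩
      rw [this, mul_zero]
  refine absurd hB (not_lt.2 ?_)
  unfold potential
  refine le_add_of_nonneg_of_le (sum_nonneg fun u _ => term_nonneg x u) ?_
  refine le_trans ?_ (single_le_sum (fun u _ => term_nonneg' x u) (mem_range.2 hu))
  have h1 : (1 : ℝ) ≤ S.big u := by exact_mod_cast Nat.one_le_iff_ne_zero.2 hbig
  refine le_trans ?_ (le_mul_of_one_le_left (sum_nonneg fun _ _ => mul_nonneg (Nat.cast_nonneg _)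
    (prod_nonneg fun _ _ => le_max_right _ _)) h1)
  refine le_trans (le_of_eq ?_) (single_le_sum (f := fun l => (S.weight : ℝ) *
    ∏ j ∈ range S.n, max (1 - S.mem u j * x j l) 0) (fun _ _ => mul_nonneg (Nat.cast_nonneg _)
    (prod_nonneg fun _ _ => le_max_right _ _)) (mem_range.2 hl))
  rw [prod_eq_one, mul_one]
  intro j hj
  rw [hx0 j (mem_range.1 hj)]
  simp

end Layout

/-! ### Blocks of independent assignments -/

/-- The arrays that an expression mentions. -/
def NatExpr.reads : NatExpr → List ℕ
  | .const _ => []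
  | .var _ => []
  | .read a idx => a :: idx.reads
  | .op _ e₁ e₂ => e₁.reads ++ e₂.reads
  | .fold _ _ _ _ e => e.reads

theorem NatExpr.eval_congr {U U' : Store} (h0 : U 0 = U' 0) {e : NatExpr}
    (h : ∀ a ∈ e.reads, U a = U' a) (env : ℕ → ℕ) : e.eval U env = e.eval U' env := by
  induction e generalizing env with
  | const c => rfl
  | var v => rfl
  | read a idx ih =>
    simp only [reads, List.mem_cons, forall_eq_or_imp] at h
    rw [eval, eval, ih h.2, h.1]
  | op o e₁ e₂ h1 h2 =>
    simp only [reads, List.mem_append] at h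
    rw [eval, eval, h1 fun a ha => h a (.inl ha), h2 fun a ha => h a (.inr ha)]
  | fold o init v c e ih =>
    rw [eval, eval, h0]
    congr 1
    funext q
    exact ih h _

/-- The assignment of all entries of an array. -/
structure Assign where
  target : ℕ
  ne : target ≠ 0
  expr : NatExpr

def fills : List Assign → Cmd
  | [] => .skip
  | p :: l => .seq (.fill p.target p.ne p.expr) (fills l)

/-- No assignment reads its own target or a later one, and the targets are distinct. -/
def ordered : List Assign → Bool
  | [] => true
  | p :: l => (l.all fun p' => !(p.expr.reads.contains p'.target) && p'.target != p.target) &&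
      !(p.expr.reads.contains p.target) && ordered l

/-- Since no assignment reads what it or a later one writes, its expression has the same value in
the final store. The effect of a block is thus a system of equations between final arrays. -/
theorem run_fills {l : List Assign} (h : ordered l = true) (U : Store) :
    (∀ a, (∀ p ∈ l, p.target ≠ a) → (fills l).run U a = U a) ∧
    ∀ p ∈ l, (fills l).run U p.target = fun q => if q < U 0 (lengthCell p.target) then
      p.expr.eval ((fills l).run U) (Function.update 0 0 q) else 0 := by
  induction l generalizing U with
  | nil => exact ⟨fun _ _ => rfl, fun p hp => absurd hp (List.not_mem_nil)⟩
  | cons p l ih =>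
    simp only [ordered, Bool.and_eq_true, List.all_eq_true, Bool.not_eq_true', bne_iff_ne,
      List.contains_eq_mem, decide_eq_false_iff_not] at h
    obtain ⟨⟨h1, h2⟩, h3⟩ := h
    set V := (Cmd.fill p.target p.ne p.expr).run U with hV
    obtain ⟨i1, i2⟩ := ih h3 V
    have hrun : (fills (p :: l)).run U = (fills l).run V := rfl
    have hV0 : V 0 = U 0 := Cmd.run_zero _ _
    have hVne : ∀ a, a ≠ p.target → V a = U a := fun a ha => Function.update_of_ne ha _ _
    rw [hrun]
    refine ⟨fun a ha => ?_, fun p' hp' => ?_⟩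
    · rw [i1 a fun p' hp' => ha p' (List.mem_cons_of_mem _ hp'),
        hVne a (ha p List.mem_cons_self).symm]
    · rcases List.mem_cons.1 hp' with rfl | hp'
      · rw [i1 _ fun q hq => (h1 q hq).2, hV, Cmd.run, Function.update_self]
        funext q
        split_ifs with hlt
        · refine NatExpr.eval_congr (((Cmd.run_zero _ _).trans hV0).symm) (fun a ha => ?_) _
          rw [i1 a fun q hq hqa => (h1 q hq).1 (hqa ▸ ha), hVne a fun hap => h2 (hap ▸ ha)]
        · rfl
      · rw [i2 p' hp', hV0]

/-! ### The algorithm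

The algorithm is deterministic, so that the discrepancy bound holds with probability one.  The items
are divided greedily into classes such that every (truncated) dual set has at most one item of each
class.  Starting from the uniform distribution, the classes are rounded one after the other: a step
moves the fractional items of the current class along a kernel vector of the rows that belong to
items and to functions with a large gradient, in the direction that does not increase a potential,
until a coordinate vanishes. -/

namespace Algorithm

open NatExpr

/-- The remainder of a division. -/
def mod (a b : NatExpr) : NatExpr := a - b * (a / b)

@[simp] theorem eval_mod (U : Store) (env : ℕ → ℕ) (a b : NatExpr) :
    (mod a b).eval U env = a.eval U env % b.eval U env := by
  simp only [mod, eval_sub, eval_mul, eval_div, Nat.mod_def]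

/-- Entry `0` of an array. -/
def scalar (a : ℕ) : NatExpr := read a (const 0)

@[simp] theorem eval_scalar (U : Store) (env : ℕ → ℕ) (a : ℕ) : (scalar a).eval U env = U a 0 := rfl

/-- Entry `(i, j)` of an array with rows of the length in entry `c` of array `0`. -/
def entry (a : ℕ) (i : NatExpr) (c : ℕ) (j : NatExpr) : NatExpr := read a (i * cell c + j)

@[simp] theorem eval_entry (U : Store) (env : ℕ → ℕ) (a c : ℕ) (i j : NatExpr) :
    (entry a i c j).eval U env = U a (i.eval U env * U 0 c + j.eval U env) := rfl

/-- Assign values to entries of array `0`, one after the other. -/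
def assigns : List (ℕ × Expr) → Program
  | [] => .skip
  | p :: l => .seq (.assign 0 (.const p.1) p.2) (assigns l)

/-- Entry `c` of array `0`. -/
def size (c : ℕ) : Expr := .read 0 (.const c)

/-- The minimum of `k` and `n + 1`, and the lengths of the arrays. -/
def sizes : List (ℕ × Expr) :=
  -- Entry `10` becomes `1` exactly if `k > n`. It must precede the truncation of `k`, which in turn
  -- keeps all lengths polynomial although `k` is given in binary.
  [(10, .op .sub (.const 1) (.op .sub (.op .add (size 0) (.const 1)) (size 2))),
   (2, .op .sub (size 2) (.op .sub (size 2) (.op .add (size 0) (.const 1)))),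
   (4, .op .mul (size 0) (size 2)),
   (5, .op .mul (size 4) (size 4)),
   (6, .op .mul (size 3) (size 0)),
   (7, .const 1),
   (8, .op .mul (.op .add (size 3) (.const 1)) (size 2)),
   (9, .op .mul (size 1) (size 2)),
   (11, .op .mul (size 1) (size 4))]

/-- Whether an element is covered at all. -/
def nonempty : Assign := ⟨33, by decide, 1 - (1 - sum 1 0 (entry 2 (var 0) 0 (var 1)))⟩
def numNonempty : Assign := ⟨5, by decide, sum 4 3 (read 33 (var 4))⟩
/-- One more than the largest number of elements that an item covers. -/
def degree : Assign := ⟨6, by decide,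
  -- The maximum degree is the number of thresholds that some degree exceeds; adding `1` makes the
  -- result positive.
  1 + sum 5 3 (1 - (1 - sum 1 0 (lt (var 5) (sum 4 3 (entry 2 (var 4) 0 (var 1))))))⟩
/-- The binary length of `numNonempty * k`. -/
def logSize : Assign := ⟨7, by decide,
  -- The inner product is `2 ^ x` for `x` the value of variable `5`, and the binary length of `N` is
  -- the number of `x` with `2 ^ x ≤ N`.
  sum 5 8 (le (prod 6 8 (1 + lt (var 6) (var 5))) (scalar 5 * cell 2))⟩
/-- The square root of `degree * k`, rounded up. -/
def root : Assign := ⟨8, by decide, sum 5 8 (lt (var 5 * var 5) (scalar 6 * cell 2))⟩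
/-- Larger dual sets are truncated to this size. -/
def cutoff : Assign := ⟨9, by decide, cell 2 * (2 * scalar 7 + 2)⟩
/-- Membership in the truncated dual sets. -/
def member : Assign := ⟨4, by decide, read 2 (var 0) *
  lt (sum 1 0 (lt (var 1) (mod (var 0) (cell 0)) * entry 2 (var 0 / cell 0) 0 (var 1))) (scalar 9)⟩
def bigElem : Assign := ⟨34, by decide, lt (scalar 9) (sum 1 0 (entry 2 (var 0) 0 (var 1)))⟩

def setup : List Assign :=
  [nonempty, numNonempty, degree, logSize, root, cutoff, member, bigElem]

/-- Whether the class `var 6` has no item before the item `scalar 11` that is in conflict with it. -/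
def freeClass : NatExpr := 1 - sum 1 0 (lt (var 1) (scalar 11) * eq (read 10 (var 1)) (var 6) *
  sum 4 3 (entry 4 (var 4) 0 (var 1) * entry 4 (var 4) 0 (scalar 11)))

/-- Greedy division of the items into classes. -/
def classify : Cmd :=
  .seq (.fill 10 (by decide) (ite (eq (var 0) (scalar 11)) (first 5 6 0 freeClass) (read 10 (var 0))))
    (.fill 11 (by decide) (scalar 11 + 1))

/-- The uniform colouring. -/
def start : List Assign := [⟨12, by decide, 1⟩, ⟨13, by decide, cell 2⟩]

def fractional (q : NatExpr) : NatExpr := lt 0 (read 12 q) * lt (read 12 q) (scalar 13)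

def current : Assign := ⟨14, by decide, first 5 6 0 (sum 1 0 (eq (read 10 (var 1)) (var 6) *
  sum 2 2 (fractional (var 1 * cell 2 + var 2))))⟩
def alive : Assign := ⟨15, by decide,
  eq (read 10 (var 0 / cell 2)) (scalar 14) * fractional (var 0)⟩
def anyAlive : Assign := ⟨36, by decide, sum 1 4 (read 15 (var 1))⟩

/-- The gradient, scaled by `k ^ n`, at function `i`, item `j` and colour `l`. -/
def scaledGrad (i j l : NatExpr) : NatExpr :=
  sum 4 3 (eq (read 1 (var 4)) i * entry 4 (var 4) 0 j *
    prod 6 0 (ite (eq (var 6) j) (cell 2) (ite (entry 4 (var 4) 0 (var 6))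
      (ite (lt (read 10 (var 6)) (scalar 14)) (cell 2 * (1 - entry 12 (var 6) 2 l)) (cell 2 - 1))
      (cell 2))))
def gradient : Assign := ⟨16, by decide,
  scaledGrad (var 0 / cell 2 / cell 0) (mod (var 0 / cell 2) (cell 0)) (mod (var 0) (cell 2))⟩
def gradEntry (i j l : NatExpr) : NatExpr := read 16 ((i * cell 0 + j) * cell 2 + l)
def active : Assign := ⟨17, by decide, lt (4 * scalar 6 * prod 6 0 (cell 2))
  (sum 1 0 (entry 15 (var 1) 2 (mod (var 0) (cell 2)) *
    gradEntry (var 0 / cell 2) (var 1) (mod (var 0) (cell 2))))⟩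
def gramExpr (q q' : NatExpr) : NatExpr :=
  read 15 q * read 15 q' * (eq (q / cell 2) (q' / cell 2) +
    eq (mod q (cell 2)) (mod q' (cell 2)) * sum 3 1 (entry 17 (var 3) 2 (mod q (cell 2)) *
      gradEntry (var 3) (q / cell 2) (mod q (cell 2)) *
      gradEntry (var 3) (q' / cell 2) (mod q (cell 2)))) +
  (1 - read 15 q) * eq q q'
def gramMatrix : Assign := ⟨18, by decide, gramExpr (var 0 / cell 4) (mod (var 0) (cell 4))⟩
def identity : Assign := ⟨19, by decide, eq (var 0 / cell 4) (mod (var 0) (cell 4))⟩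

def prepare : List Assign :=
  [current, alive, anyAlive, gradient, active, gramMatrix, identity,
    ⟨20, by decide, 0⟩, ⟨23, by decide, 0⟩, ⟨25, by decide, 0⟩, ⟨26, by decide, 0⟩]

/-- The first nonzero column of the difference of the arrays `19` and `20`. -/
def column : Assign := ⟨24, by decide, first 5 6 4 (sum 7 4
  ((entry 19 (var 7) 4 (var 6) - entry 20 (var 7) 4 (var 6)) +
    (entry 20 (var 7) 4 (var 6) - entry 19 (var 7) 4 (var 6))))⟩
def traceExpr (a : ℕ) : NatExpr :=
  sum 6 4 (sum 7 4 (entry 18 (var 6) 4 (var 7) * entry a (var 7) 4 (var 6)))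
def copyColumn (y a : ℕ) : NatExpr :=
  ite (lt (scalar 24) (cell 4)) (entry a (var 0) 4 (scalar 24)) (read y (var 0))
/-- One part of the Faddeev–LeVerrier recursion; `c` holds the trace of the other part. -/
def recursion (a c : ℕ) : NatExpr :=
  scalar 23 * sum 7 4 (entry 18 (var 0 / cell 4) 4 (var 7) * entry a (var 7) 4 (mod (var 0) (cell 4))) +
    eq (var 0 / cell 4) (mod (var 0) (cell 4)) * scalar c

def leverrierStep : Cmd :=
  .seq (fills [column, ⟨21, by decide, traceExpr 19⟩, ⟨22, by decide, traceExpr 20⟩])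
  (.seq (.fill 25 (by decide) (copyColumn 25 19))
  (.seq (.fill 26 (by decide) (copyColumn 26 20))
  (.seq (.fill 23 (by decide) (scalar 23 + 1))
  (.seq (.fill 19 (by decide) (recursion 19 22))
    (.fill 20 (by decide) (recursion 20 21))))))

/-- The first coordinate that vanishes when moving along the difference of the arrays `p` and `r`. -/
def blocking (p r : ℕ) : NatExpr :=
  first 5 6 4 (lt (read p (var 6)) (read r (var 6)) * prod 7 4 (1 -
    lt (read p (var 7)) (read r (var 7)) *
    lt (read 12 (var 7) * (read r (var 6) - read p (var 6)))
      (read 12 (var 6) * (read r (var 7) - read p (var 7)))))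
/-- The length of the direction in the coordinate `scalar c`. -/
def slope (c p r : ℕ) : NatExpr := read r (scalar c) - read p (scalar c)
def moved (c p r : ℕ) : NatExpr :=
  (read 12 (var 0) * slope c p r + read 12 (scalar c) * read p (var 0)) -
    read 12 (scalar c) * read r (var 0)

def candidates : List Assign :=
  [⟨27, by decide, blocking 25 26⟩, ⟨28, by decide, blocking 26 25⟩,
   ⟨29, by decide, moved 27 25 26⟩, ⟨30, by decide, scalar 13 * slope 27 25 26⟩,
   ⟨31, by decide, moved 28 26 25⟩, ⟨32, by decide, scalar 13 * slope 28 26 25⟩]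

open RatExpr in
/-- `lam * dev` for element `var 4`, colour `var 2` and class `var 5`, at the colouring given by
the arrays `a` and `d`. -/
def devExpr (a d : ℕ) : RatExpr :=
  RatExpr.sum 1 0 (ratio (eq (read 10 (var 1)) (var 5)) 1 *
    RatExpr.sum 7 3 (ratio (eq (read 1 (var 7)) (read 1 (var 4)) * entry 4 (var 7) 0 (var 1)) 1 *
      RatExpr.prod 6 0 (ratio 1 1 - ratio (entry 4 (var 7) 0 (var 6) * (1 - eq (var 6) (var 1))) 1 *
        ratio (ite (lt (read 10 (var 6)) (var 5)) (entry a (var 6) 2 (var 2)) 1)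
          (ite (lt (read 10 (var 6)) (var 5)) (scalar d) (cell 2)))) *
    (ratio (entry a (var 1) 2 (var 2)) (scalar d) - ratio 1 (cell 2)))

open RatExpr in
def potentialExpr (a d : ℕ) : RatExpr :=
  RatExpr.sum 4 3 (ratio (read 33 (var 4)) 1 * RatExpr.sum 2 2
    (RatExpr.prod 5 0 (ratio 1 1 + ratio 1 (8 * scalar 6 * scalar 8) * devExpr a d) +
      RatExpr.prod 5 0 (ratio 1 1 - ratio 1 (8 * scalar 6 * scalar 8) * devExpr a d))) +
  RatExpr.sum 4 3 (ratio (read 34 (var 4)) 1 * RatExpr.sum 2 2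
    (ratio (4 * (scalar 5 * cell 2)) 1 * RatExpr.prod 1 0 (ratio 1 1 -
      ratio (entry 4 (var 4) 0 (var 1)) 1 * ratio (entry a (var 1) 2 (var 2)) (scalar d))))

/-- Take the candidate of smaller potential. -/
def choose (a b c : ℕ) : NatExpr :=
  ite (scalar 36) (ite (scalar 35) (read a (var 0)) (read b (var 0))) (read c (var 0))

def update : Cmd :=
  .seq (.fill 35 (by decide) (RatExpr.le (potentialExpr 29 30) (potentialExpr 31 32)))
  (.seq (.fill 12 (by decide) (choose 29 31 12)) (.fill 13 (by decide) (choose 30 32 13)))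

/-- Reset the arrays of intermediate results. -/
def clear : List Assign :=
  [⟨14, by decide, 0⟩, ⟨15, by decide, 0⟩, ⟨16, by decide, 0⟩, ⟨17, by decide, 0⟩,
   ⟨18, by decide, 0⟩, ⟨19, by decide, 0⟩, ⟨20, by decide, 0⟩, ⟨21, by decide, 0⟩,
   ⟨22, by decide, 0⟩, ⟨23, by decide, 0⟩, ⟨24, by decide, 0⟩, ⟨25, by decide, 0⟩,
   ⟨26, by decide, 0⟩, ⟨27, by decide, 0⟩, ⟨28, by decide, 0⟩, ⟨29, by decide, 0⟩,
   ⟨30, by decide, 0⟩, ⟨31, by decide, 0⟩, ⟨32, by decide, 0⟩, ⟨35, by decide, 0⟩,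
   ⟨36, by decide, 0⟩]

/-- One rounding step. -/
def round : Cmd :=
  .seq (fills prepare) (.seq (.loop 4 leverrierStep) (.seq (fills candidates)
    -- Clearing leaves the colouring as the only data that can grow from round to round.
    (.seq update (fills clear))))

/-- The colour of every item, or its number if there are more colours than items. -/
def output : List Assign := [⟨3, by decide,
  ite (cell 10) (var 0) (first 5 6 2 (entry 12 (var 0) 2 (var 6)))⟩]

def main : Cmd :=
  .seq (fills setup) (.seq (.loop 0 classify) (.seq (fills start) (.seq (.loop 4 round)
    (fills output))))

def program : Program := .seq (assigns sizes) (main.compile 0)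

theorem ordered_setup : ordered setup = true := by decide
theorem ordered_prepare : ordered prepare = true := by decide
theorem ordered_candidates : ordered candidates = true := by decide
theorem ordered_clear : ordered clear = true := by decide
theorem ordered_start : ordered start = true := by decide
theorem ordered_output : ordered output = true := by decide

end Algorithm

/-! ### Correctness of the parameters and of the truncation -/

theorem sum_ite_lt_eq {P : ℕ → Prop} [DecidablePred P] {B m : ℕ} (hm : m ≤ B)
    (h : ∀ q, P q ↔ q < m) : ∑ q ∈ range B, (if P q then 1 else 0) = m := by
  rw [← card_filter]
  have : (range B).filter P = range m := by
    ext q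
    rw [mem_filter, mem_range, mem_range, h]
    omega
  rw [this, card_range]

theorem sum_ite_lt_mul (a : ℕ → ℕ) {j n : ℕ} (hj : j ≤ n) :
    ∑ j' ∈ range n, (if j' < j then 1 else 0) * a j' = ∑ j' ∈ range j, a j' := by
  simp only [ite_mul, one_mul, zero_mul]
  rw [← sum_filter]
  refine sum_congr ?_ fun _ _ => rfl
  ext q
  rw [mem_filter, mem_range, mem_range]
  omega

theorem sum_truncated {a : ℕ → ℕ} (n s : ℕ) (ha : ∀ j < n, a j ≤ 1) :
    ∑ j ∈ range n, a j * (if ∑ j' ∈ range j, a j' < s then 1 else 0) =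
      min (∑ j ∈ range n, a j) s := by
  induction n with
  | zero => simp
  | succ n ih =>
    rw [sum_range_succ, sum_range_succ, ih fun j hj => ha j (by omega)]
    have := ha n (by omega)
    split_ifs <;> omega

namespace Algorithm

/-- The lengths in array `0` are as announced. -/
structure Ready (U : Store) : Prop where
  k_pos : 1 ≤ U 0 2
  c4 : U 0 4 = U 0 0 * U 0 2
  c5 : U 0 5 = U 0 4 * U 0 4
  c6 : U 0 6 = U 0 3 * U 0 0
  c7 : U 0 7 = 1
  c8 : U 0 8 = (U 0 3 + 1) * U 0 2
  c9 : U 0 9 = U 0 1 * U 0 2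
  c11 : U 0 11 = U 0 1 * U 0 4

theorem Ready.congr {U V : Store} (h : Ready U) (h0 : V 0 = U 0) : Ready V := by
  obtain ⟨a, b, c, d, e, f, g, i⟩ := h
  constructor <;> rw [h0] <;> assumption

section setup
variable {U : Store}

/-- What the preparation computes, in terms of the given membership matrix. -/
structure SetupSpec (U V : Store) : Prop where
  other : ∀ a, a ∉ ([33, 5, 6, 7, 8, 9, 4, 34] : List ℕ) → V a = U a
  nonempty : ∀ u < U 0 3, V 33 u = if ∑ j ∈ range (U 0 0), U 2 (u * U 0 0 + j) = 0 then 0 else 1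
  num : V 5 0 = ∑ u ∈ range (U 0 3), V 33 u
  degree : V 6 0 = 1 + (range (U 0 0)).sup fun j => ∑ u ∈ range (U 0 3), U 2 (u * U 0 0 + j)
  log : V 7 0 = (V 5 0 * U 0 2).size
  root : V 8 0 = (V 6 0 * U 0 2 - 1).sqrt + 1
  cutoff : V 9 0 = U 0 2 * (2 * V 7 0 + 2)
  member : ∀ u < U 0 3, ∀ j < U 0 0, V 4 (u * U 0 0 + j) = U 2 (u * U 0 0 + j) *
    if ∑ j' ∈ range j, U 2 (u * U 0 0 + j') < V 9 0 then 1 else 0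
  member_le : ∀ q, V 4 q ≤ 1
  big : ∀ u < U 0 3, V 34 u = if V 9 0 < ∑ j ∈ range (U 0 0), U 2 (u * U 0 0 + j) then 1 else 0

theorem setup_spec (hU : Ready U) (hraw : ∀ q, U 2 q ≤ 1) : SetupSpec U ((fills setup).run U) := by
  obtain ⟨hk, hc4, hc5, hc6, hc7, hc8, hc9, hc11⟩ := hU
  obtain ⟨hother, hsp⟩ := run_fills ordered_setup U
  set V := (fills setup).run U with hV
  have h0 : V 0 = U 0 := hother 0 (by decide)
  have h2 : V 2 = U 2 := hother 2 (by decide)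
  have f33 := hsp nonempty (by simp [setup])
  have f5 := hsp numNonempty (by simp [setup])
  have f6 := hsp degree (by simp [setup])
  have f7 := hsp logSize (by simp [setup])
  have f8 := hsp Algorithm.root (by simp [setup])
  have f9 := hsp Algorithm.cutoff (by simp [setup])
  have f4 := hsp Algorithm.member (by simp [setup])
  have f34 := hsp bigElem (by simp [setup])
  simp only [nonempty, numNonempty, Algorithm.degree, logSize, Algorithm.root, Algorithm.cutoff,
    Algorithm.member, bigElem, lengthCell] at f33 f5 f6 f7 f8 f9 f4 f34
  simp only [NatExpr.eval_sub, NatExpr.eval_add, NatExpr.eval_mul, NatExpr.eval_one,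
    NatExpr.eval_ofNat, NatExpr.eval_var, NatExpr.eval_read, NatExpr.eval_sum, NatExpr.eval_prod,
    NatExpr.eval_lt, NatExpr.eval_le, NatExpr.eval_div, eval_mod, eval_scalar, eval_entry,
    NatExpr.eval_cell, Function.update_apply, Nat.reduceEqDiff, if_true, if_false,
    OfNat.ofNat_ne_zero, OfNat.ofNat_ne_one, one_ne_zero, h0, h2] at f33 f5 f6 f7 f8 f9 f4 f34
  have hle : ∀ j, ∑ u ∈ range (U 0 3), U 2 (u * U 0 0 + j) ≤ U 0 3 := fun j =>
    (sum_le_card_nsmul _ _ 1 fun u _ => hraw _).trans (by simp)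
  have h33 : ∀ u, V 33 u ≤ 1 := fun u => by rw [f33]; dsimp only; split_ifs <;> omega
  have hnum : V 5 0 = ∑ u ∈ range (U 0 3), V 33 u := by rw [f5, hc7]; simp
  have hnum_le : V 5 0 ≤ U 0 3 := by
    rw [hnum]; exact (sum_le_card_nsmul _ _ 1 fun u _ => h33 _).trans (by simp)
  have hdeg : V 6 0 = 1 + (range (U 0 0)).sup fun j => ∑ u ∈ range (U 0 3), U 2 (u * U 0 0 + j) := by
    rw [f6, hc7]
    simp only [zero_lt_one, if_true]
    congr 1
    refine (sum_congr rfl fun q _ => ?_).trans (sum_ite_lt_eq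
      (P := fun q => q < (range (U 0 0)).sup fun j => ∑ u ∈ range (U 0 3), U 2 (u * U 0 0 + j))
      (Finset.sup_le fun j _ => hle j) fun q => Iff.rfl)
    split_ifs with h <;> rw [Finset.lt_sup_iff] at h
    · obtain ⟨j, hj, hq⟩ := h
      have : 1 ≤ ∑ x ∈ range (U 0 0), if q < ∑ u ∈ range (U 0 3), U 2 (u * U 0 0 + x) then 1 else 0 :=
        le_trans (by rw [if_pos hq]) (single_le_sum (f := fun x =>
          if q < ∑ u ∈ range (U 0 3), U 2 (u * U 0 0 + x) then 1 else 0) (fun _ _ => Nat.zero_le _) hj)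
      omega
    · rw [sum_eq_zero fun x hx => if_neg fun hq => h ⟨x, hx, hq⟩]
      rfl
  have hdeg_le : V 6 0 ≤ U 0 3 + 1 := by
    rw [hdeg, add_comm]; exact Nat.add_le_add_right (Finset.sup_le fun j _ => hle j) 1
  have hlog : V 7 0 = (V 5 0 * U 0 2).size := by
    rw [f7, hc7]
    simp only [zero_lt_one, if_true]
    -- The range of the search is entry `8`, equal to `(E + 1) * k`, which suffices because there
    -- are at most `E` nonempty elements.
    have hc : (V 5 0 * U 0 2).size ≤ U 0 8 := by
      rw [hc8]
      exact (size_le_self _).trans (Nat.mul_le_mul_right _ (by omega))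
    refine (sum_congr rfl fun x hx => ?_).trans (sum_ite_lt_eq hc fun q => Iff.rfl)
    refine if_congr ?_ rfl rfl
    rw [Nat.lt_size, prod_congr rfl fun q _ => (show (1 + if q < x then 1 else 0) = if q < x then 2 else 1 by
      split_ifs <;> rfl), prod_ite, prod_const_one, mul_one, prod_const]
    have : (range (U 0 8)).filter (fun q => q < x) = range x := by
      ext q; rw [mem_filter, mem_range, mem_range]; have := mem_range.1 hx; omega
    rw [this, card_range]
  have hcut : V 9 0 = U 0 2 * (2 * V 7 0 + 2) := by rw [f9, hc7]; simp
  refine ⟨fun a ha => hother a fun p hp h => ha ?_, fun u hu => ?_, hnum, hdeg, hlog, ?_, hcut,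
    fun u hu j hj => ?_, fun q => ?_, fun u hu => ?_⟩
  · subst h
    revert p
    decide
  · rw [f33]
    simp only [hu, if_true]
    split_ifs <;> omega
  · rw [f8, hc7]
    simp only [zero_lt_one, if_true]
    have hpos : 1 ≤ V 6 0 * U 0 2 := Nat.mul_pos (by omega) hk
    refine sum_ite_lt_eq ?_ fun q => ?_
    · have h1 := Nat.sqrt_le_self (V 6 0 * U 0 2 - 1)
      have h2 := Nat.mul_le_mul_right (U 0 2) hdeg_le
      omega
    · rw [Nat.lt_succ_iff, Nat.le_sqrt]
      omega
  · rw [f4, hc6]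
    simp only [index_lt hu hj, if_true, index_div hj, index_mod hj]
    rw [sum_ite_lt_mul _ hj.le]
  · rw [f4]
    dsimp only
    have := hraw q
    split_ifs <;> omega
  · rw [f34]
    simp only [hu, if_true]

end setup
end Algorithm

/-! ### Greedy division of the items into classes -/

namespace Algorithm

/-- The items before `i` are divided into classes of pairwise disjoint items. -/
structure ClassSpec (U V : Store) (i : ℕ) : Prop where
  other : ∀ a, a ≠ 10 → a ≠ 11 → V a = U a
  counter : V 11 0 = i
  lt : ∀ j, V 10 j ≤ U 0 0
  cls_lt : ∀ j < i, V 10 j < U 0 0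
  le : ∀ j < i, V 10 j ≤ ∑ u ∈ range (U 0 3), U 4 (u * U 0 0 + j) *
    ∑ j' ∈ range (U 0 0), U 4 (u * U 0 0 + j')
  proper : ∀ u < U 0 3, ∀ j < i, ∀ j' < i, U 4 (u * U 0 0 + j) ≠ 0 → U 4 (u * U 0 0 + j') ≠ 0 →
    V 10 j = V 10 j' → j = j'

/-- Each class below the first free one contains an earlier item in conflict with item `i`. Hence
its number is at most the number of such items, which is less than `n` and at most the total size of
the sets containing item `i`. -/
theorem ClassSpec.run {U V : Store} {i : ℕ} (h7 : U 0 7 = 1)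
    (h : ClassSpec U V i) (hi : i < U 0 0) : ClassSpec U (classify.run V) (i + 1) := by
  have h0 : V 0 = U 0 := h.other 0 (by decide) (by decide)
  have h4 : V 4 = U 4 := h.other 4 (by decide) (by decide)
  set f : ℕ → ℕ := fun c => 1 - ∑ j ∈ range (U 0 0), (if j < i then 1 else 0) *
    (if V 10 j = c then 1 else 0) *
      ∑ u ∈ range (U 0 3), U 4 (u * U 0 0 + j) * U 4 (u * U 0 0 + i) with hf
  have hrun : classify.run V = Function.update (Function.update V 10 fun q => if q < U 0 0 then
      (if q = i then firstIndex f (U 0 0) else V 10 q) else 0) 11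
        fun q => if q < 1 then i + 1 else 0 := by
    have e1 : ∀ q, (NatExpr.first 5 6 0 freeClass).eval V (Function.update 0 0 q) =
        firstIndex f (V 0 0) := fun q => NatExpr.eval_first f (by decide) fun q r => by
      simp only [freeClass, NatExpr.eval_sub, NatExpr.eval_mul, NatExpr.eval_one, NatExpr.eval_var,
        NatExpr.eval_read, NatExpr.eval_sum, NatExpr.eval_lt, NatExpr.eval_eq, eval_scalar,
        eval_entry, Function.update_apply, Nat.reduceEqDiff, if_true, if_false, h0, h4, h.counter]
      rfl
    simp only [classify, Cmd.run, lengthCell, NatExpr.eval_ite, NatExpr.eval_eq, NatExpr.eval_var,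
      NatExpr.eval_read, NatExpr.eval_add, NatExpr.eval_one, eval_scalar, e1, h0, h.counter,
      Function.update_self]
    have n1 : ∀ w, Function.update V 10 w 0 = U 0 := fun w => by
      rw [Function.update_of_ne (by decide), h0]
    have n2 : ∀ w, Function.update V 10 w 11 = V 11 := fun w => Function.update_of_ne (by decide) _ _
    simp only [n1, n2, h.counter, h7]
    congr 2
    funext q
    split_ifs <;> simp_all
  have hfi := firstIndex_le f (U 0 0)
  obtain ⟨hz, hnz⟩ := exists_firstIndex f (U 0 0)
  set c₀ := firstIndex f (U 0 0) with hc₀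
  have hconf : ∀ c < c₀, ∃ j < i, V 10 j = c ∧
      0 < ∑ u ∈ range (U 0 3), U 4 (u * U 0 0 + j) * U 4 (u * U 0 0 + i) := by
    intro c hc
    by_contra hcon
    push Not at hcon
    have := hz c hc
    rw [hf] at this
    simp only at this
    rw [sum_eq_zero] at this
    · simp at this
    · intro j _
      by_cases h1 : j < i
      · by_cases h2 : V 10 j = c
        · rw [Nat.le_zero.1 (hcon j h1 h2), mul_zero]
        · simp [h2]
      · simp [h1]
  have hcard : c₀ ≤ ((range i).filter fun j =>
      0 < ∑ u ∈ range (U 0 3), U 4 (u * U 0 0 + j) * U 4 (u * U 0 0 + i)).card := by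
    have : range c₀ ⊆ ((range i).filter fun j =>
        0 < ∑ u ∈ range (U 0 3), U 4 (u * U 0 0 + j) * U 4 (u * U 0 0 + i)).image (V 10) := by
      intro c hc
      obtain ⟨j, hj, h1, h2⟩ := hconf c (mem_range.1 hc)
      exact mem_image.2 ⟨j, mem_filter.2 ⟨mem_range.2 hj, h2⟩, h1⟩
    exact (card_range c₀).symm.le.trans ((card_le_card this).trans card_image_le)
  have hlt : c₀ < U 0 0 := by
    have := hcard.trans (card_filter_le _ _)
    rw [card_range] at this
    omega
  have hnew : ∀ j, classify.run V 10 j = if j < U 0 0 then (if j = i then c₀ else V 10 j) else 0 := by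
    intro j
    rw [hrun, Function.update_of_ne (by decide), Function.update_self]
  have hold : ∀ j < i, classify.run V 10 j = V 10 j := fun j hj => by
    rw [hnew, if_pos (by omega), if_neg (by omega)]
  have hnewi : classify.run V 10 i = c₀ := by rw [hnew, if_pos hi, if_pos rfl]
  have hne : ∀ u < U 0 3, ∀ j < i, U 4 (u * U 0 0 + j) ≠ 0 → U 4 (u * U 0 0 + i) ≠ 0 →
      V 10 j ≠ c₀ := by
    intro u hu j hj h1 h2 hc
    refine hnz hlt ?_
    rw [hf]
    have : 0 < ∑ j ∈ range (U 0 0), (if j < i then 1 else 0) * (if V 10 j = c₀ then 1 else 0) *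
        ∑ u ∈ range (U 0 3), U 4 (u * U 0 0 + j) * U 4 (u * U 0 0 + i) := by
      refine sum_pos' (fun _ _ => Nat.zero_le _) ⟨j, mem_range.2 (hj.trans hi), ?_⟩
      rw [if_pos hj, if_pos hc, one_mul, one_mul]
      exact sum_pos' (fun _ _ => Nat.zero_le _) ⟨u, mem_range.2 hu, Nat.mul_pos (by omega) (by omega)⟩
    simp only
    omega
  refine ⟨fun a h1 h2 => ?_, ?_, fun j => ?_, fun j hj => ?_, fun j hj => ?_,
    fun u hu j hj j' hj' h1 h2 hc => ?_⟩
  · rw [hrun, Function.update_of_ne h2, Function.update_of_ne h1, h.other a h1 h2]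
  · rw [hrun, Function.update_self]; simp
  · rw [hnew]
    have := h.lt j
    split_ifs <;> omega
  · rcases Nat.lt_succ_iff_lt_or_eq.1 hj with hj | rfl
    · rw [hold j hj]; exact h.cls_lt j hj
    · rwa [hnewi]
  · rcases Nat.lt_succ_iff_lt_or_eq.1 hj with hj | rfl
    · rw [hold j hj]; exact h.le j hj
    · rw [hnewi]
      refine hcard.trans ?_
      rw [card_filter]
      refine (sum_le_sum (g := fun j' => ∑ u ∈ range (U 0 3),
        U 4 (u * U 0 0 + j') * U 4 (u * U 0 0 + j)) fun j' _ => ?_).trans ?_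
      · split_ifs with h
        · exact h
        · exact Nat.zero_le _
      · rw [sum_comm]
        refine sum_le_sum fun u _ => ?_
        rw [← sum_mul, mul_comm]
        exact Nat.mul_le_mul_left _ (sum_le_sum_of_subset (range_mono hi.le))
  · rcases Nat.lt_succ_iff_lt_or_eq.1 hj with hj | rfl <;>
      rcases Nat.lt_succ_iff_lt_or_eq.1 hj' with hj' | rfl
    · rw [hold j hj, hold j' hj'] at hc
      exact h.proper u hu j hj j' hj' h1 h2 hc
    · rw [hold j hj, hnewi] at hc
      exact absurd hc (hne u hu j hj h1 h2)
    · rw [hold j' hj', hnewi] at hc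
      exact absurd hc.symm (hne u hu j' hj' h2 h1)
    · rfl

theorem ClassSpec.iterate {U : Store} (h7 : U 0 7 = 1)
    (h10 : ∀ j, U 10 j = 0) (h11 : U 11 0 = 0) {i : ℕ} (hi : i ≤ U 0 0) :
    ClassSpec U (classify.run^[i] U) i := by
  induction i with
  | zero =>
    exact ⟨fun _ _ _ => rfl, h11, fun j => by simp [h10], fun _ h => absurd h (Nat.not_lt_zero _),
      fun _ h => absurd h (Nat.not_lt_zero _), fun _ _ _ h => absurd h (Nat.not_lt_zero _)⟩
  | succ i ih =>
    rw [Function.iterate_succ_apply']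
    exact (ih (by omega)).run h7 hi

end Algorithm

/-! ### The layout of a store and the evaluation of its potential -/

namespace Layout

variable {S : Layout} {x x' : ℕ → ℕ → ℝ}

theorem dev_congr (b i : ℕ) {l : ℕ} (h : ∀ j < S.n, x j l = x' j l) :
    S.dev b x i l = S.dev b x' i l := by
  refine sum_congr rfl fun j hj => ?_
  rw [h j (mem_range.1 hj)]
  congr 2
  refine sum_congr rfl fun u _ => ?_
  congr 2
  refine prod_congr rfl fun j' hj' => ?_
  unfold cut
  rw [h j' (mem_range.1 hj')]

theorem potential_congr (h : ∀ j < S.n, ∀ l < S.k, x j l = x' j l) :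
    S.potential x = S.potential x' := by
  refine congrArg₂ (· + ·) (sum_congr rfl fun u _ => ?_) (sum_congr rfl fun u _ => ?_)
  · refine congrArg _ (sum_congr rfl fun l hl => ?_)
    simp only [dev_congr _ _ fun j hj => h j hj l (mem_range.1 hl)]
  · refine congrArg _ (sum_congr rfl fun l hl => congrArg _ (prod_congr rfl fun j hj => ?_))
    rw [h j (mem_range.1 hj) l (mem_range.1 hl)]

theorem good_of_uniform (hS : S.Valid) (h : ∀ j < S.n, ∀ l < S.k, x j l = 1 / S.k) : S.Good x where
  nonneg j hj l hl := by rw [h j hj l hl]; exact (inv_k_mem hS).1.le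
  sum_one j hj := by
    rw [sum_congr rfl fun l hl => h j hj l (mem_range.1 hl)]
    exact (good_uniform hS).sum_one j hj
  order _ _ j' hj' _ _ l' hl' _ _ := h j' hj' l' hl'
  bound b i l hl := .inl ((dev_congr b i fun j hj => h j hj l hl).trans (dev_uniform b i l))

end Layout

namespace Algorithm

/-- The layout described by a store. -/
noncomputable def layout (U : Store) : Layout where
  n := U 0 0
  k := U 0 2
  m := U 0 1
  E := U 0 3
  deg := U 6 0
  own := U 1
  mem u j := U 4 (u * U 0 0 + j)
  cls := U 10
  lam := 1 / (8 * U 6 0 * U 8 0)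
  nonempty := U 33
  big := U 34
  weight := 4 * (U 5 0 * U 0 2)

/-- The fractional colouring with the numerators in array `a` and the denominator in array `d`. -/
noncomputable def coloring (U : Store) (a d j l : ℕ) : ℝ := (U a (j * U 0 2 + l) : ℝ) / (U d 0 : ℝ)

theorem layout_congr {U V : Store} (h : ∀ a ∈ ([0, 1, 4, 5, 6, 8, 10, 33, 34] : List ℕ), V a = U a) :
    layout V = layout U := by
  unfold layout
  simp only [h 0 (by decide), h 1 (by decide), h 4 (by decide), h 5 (by decide), h 6 (by decide),
    h 8 (by decide), h 10 (by decide), h 33 (by decide), h 34 (by decide)]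

/-- For a good colouring the factors are nonnegative, so inserting positive parts gives the form
that `devExpr` computes. -/
theorem coef_eq {U : Store} (hS : (layout U).Valid) {x : ℕ → ℕ → ℝ} (hx : (layout U).Good x)
    (b u j : ℕ) {l : ℕ} (hl : l < U 0 2) : (layout U).coef b x u j l =
      ∏ j' ∈ range (U 0 0), max (1 - U 4 (u * U 0 0 + j') * (1 - if j' = j then 1 else 0 : ℕ) *
        (layout U).cut b x j' l) 0 := by
  refine prod_congr rfl fun j' hj' => ?_
  have := Layout.cut_mem hS hx b (mem_range.1 hj') hl
  have h2 := (Layout.factor_mem hS u j' this.1 this.2).1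
  by_cases h : j' = j
  · simp [h]
  · simp only [if_neg h, Nat.sub_zero, Nat.cast_one, mul_one]
    exact (max_eq_left h2).symm

theorem eval_devExpr {U : Store} (hS : (layout U).Valid) {a d : ℕ}
    (hx : (layout U).Good (coloring U a d)) {env : ℕ → ℕ} (hl : env 2 < U 0 2) :
    (devExpr a d).eval U env = (layout U).dev (env 5) (coloring U a d) (U 1 (env 4)) (env 2) := by
  have hcut : ∀ j', ((if U 10 j' < env 5 then U a (j' * U 0 2 + env 2) else 1 : ℕ) : ℝ) /
      ((if U 10 j' < env 5 then U d 0 else U 0 2 : ℕ) : ℝ) =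
      (layout U).cut (env 5) (coloring U a d) j' (env 2) := by
    intro j'
    simp only [Layout.cut, layout, coloring]
    by_cases h : U 10 j' < env 5 <;> simp [h]
  simp only [devExpr, RatExpr.eval_sum, RatExpr.eval_mul, RatExpr.eval_sub, RatExpr.eval_prod,
    RatExpr.eval_ratio, NatExpr.eval_eq, NatExpr.eval_mul, NatExpr.eval_sub, NatExpr.eval_one,
    NatExpr.eval_ite, NatExpr.eval_lt, NatExpr.eval_read, NatExpr.eval_cell, NatExpr.eval_var,
    eval_scalar, eval_entry, Function.update_apply, Nat.reduceEqDiff, if_true, if_false,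
    OfNat.ofNat_ne_one, OfNat.one_ne_ofNat, one_ne_zero, ite_eq_right_iff, Classical.not_imp, ne_eq, and_true, not_false_eq_true,
    Nat.cast_one, div_one, hcut, Nat.cast_mul]
  refine sum_congr rfl fun j _ => ?_
  by_cases h : U 10 j = env 5
  · rw [if_pos h, if_pos (show (layout U).cls j = env 5 from h), Layout.grad]
    simp only [coef_eq hS hx _ _ _ hl, Nat.cast_one, one_mul]
    refine congrArg₂ (· * ·) (sum_congr rfl fun u _ => ?_) rfl
    by_cases h' : U 1 u = U 1 (env 4)
    · rw [if_pos h', if_pos (show (layout U).own u = _ from h'), Nat.cast_one, one_mul]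
      rfl
    · rw [if_neg h', if_neg (show ¬ (layout U).own u = _ from h'), Nat.cast_zero, zero_mul, zero_mul]
  · rw [if_neg h, if_neg (show ¬ (layout U).cls j = env 5 from h), Nat.cast_zero, zero_mul, zero_mul]

theorem eval_potentialExpr {U : Store} (hS : (layout U).Valid) {a d : ℕ}
    (hx : (layout U).Good (coloring U a d)) (env : ℕ → ℕ) :
    (potentialExpr a d).eval U env = (layout U).potential (coloring U a d) := by
  have hdev : ∀ u b l, l < U 0 2 →
      (devExpr a d).eval U (Function.update (Function.update (Function.update env 4 u) 2 l) 5 b) =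
        (layout U).dev b (coloring U a d) (U 1 u) l := by
    intro u b l hl
    rw [eval_devExpr hS hx (by simpa [Function.update_apply] using hl)]
    simp
  simp only [potentialExpr, RatExpr.eval_sum, RatExpr.eval_mul, RatExpr.eval_sub, RatExpr.eval_prod,
    RatExpr.eval_add, RatExpr.eval_ratio, NatExpr.eval_mul, NatExpr.eval_one, NatExpr.eval_ofNat,
    NatExpr.eval_read, NatExpr.eval_cell, NatExpr.eval_var,
    eval_scalar, eval_entry, Function.update_apply, Nat.reduceEqDiff, if_true, if_false,
    OfNat.ofNat_ne_one, OfNat.one_ne_ofNat, Nat.cast_one, div_one, Nat.cast_mul]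
  refine congrArg₂ (· + ·) (sum_congr rfl fun u _ => congrArg _ (sum_congr rfl fun l hl => ?_))
    (sum_congr rfl fun u _ => congrArg _ (sum_congr rfl fun l hl => ?_))
  · refine congrArg₂ (· + ·) (prod_congr rfl fun b _ => ?_) (prod_congr rfl fun b _ => ?_) <;>
      rw [hdev u b l (mem_range.1 hl)] <;> simp [layout]
  · simp only [layout, coloring]
    push_cast
    rfl

end Algorithm

/-! ### The data of a rounding step -/

namespace Algorithm

theorem indicator_le_one (P : Prop) [Decidable P] : (if P then 1 else 0 : ℕ) ≤ 1 := by
  split_ifs <;> simp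

theorem frac_iff {U : Store} {a d : ℕ} (hD : 0 < U d 0) (j l : ℕ) :
    Layout.Frac (coloring U a d) j l ↔ 0 < U a (j * U 0 2 + l) ∧ U a (j * U 0 2 + l) < U d 0 := by
  have h : (0 : ℝ) < U d 0 := by exact_mod_cast hD
  rw [Layout.Frac, coloring, div_lt_one h, Nat.cast_lt, div_pos_iff_of_pos_right h, Nat.cast_pos]

/-- The data of one rounding step. -/
structure PrepareSpec (U V : Store) : Prop where
  other : ∀ a, a ∉ ([14, 15, 36, 16, 17, 18, 19, 20, 23, 25, 26] : List ℕ) → V a = U a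
  anyAlive : V 36 0 = ∑ q ∈ range (U 0 4), V 15 q
  none : (∀ j < U 0 0, ∀ l < U 0 2, ¬ Layout.Frac (coloring U 12 13) j l) → V 36 0 = 0
  current : (∃ j < U 0 0, ∃ l < U 0 2, Layout.Frac (coloring U 12 13) j l) →
    (layout U).Current (coloring U 12 13) (V 14 0)
  coords : (layout U).Current (coloring U 12 13) (V 14 0) →
    (layout U).Coords (V 14 0) (coloring U 12 13) (U 0 2 ^ U 0 0) (V 15)
      (fun i l => V 17 (i * U 0 2 + l)) (fun i j l => V 16 ((i * U 0 0 + j) * U 0 2 + l))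
  gram : ∀ q < U 0 4, ∀ q' < U 0 4, V 18 (q * U 0 4 + q') = gram (U 0 2) (U 0 1) (V 15)
    (fun i l => V 17 (i * U 0 2 + l)) (fun i j l => V 16 ((i * U 0 0 + j) * U 0 2 + l)) q q'
  gram_le : ∀ q, V 18 q ≤ 2 + U 0 1 * (U 0 3 * U 0 2 ^ U 0 0) ^ 2
  identity : ∀ q < U 0 4, ∀ q' < U 0 4, V 19 (q * U 0 4 + q') = if q = q' then 1 else 0
  zero : ∀ q, V 20 q = 0
  counter : V 23 0 = 0
  pos_zero : ∀ q, V 25 q = 0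
  neg_zero : ∀ q, V 26 q = 0

/-- The scale `k ^ n` makes gradients natural: each of the `n` factors of `coef` is `0`, `1` or `1 -
1 / k`, because earlier classes are rounded and the others are reset to the uniform distribution. -/
theorem prepare_spec {U : Store} (hU : Ready U) (hS : (layout U).Valid)
    (hx : (layout U).Good (coloring U 12 13)) (hD : 0 < U 13 0) :
    PrepareSpec U ((fills prepare).run U) := by
  obtain ⟨hk, hc4, hc5, hc6, hc7, hc8, hc9, hc11⟩ := hU
  obtain ⟨hother, hsp⟩ := run_fills ordered_prepare U
  set V := (fills prepare).run U with hV
  have h0 : V 0 = U 0 := hother 0 (by decide)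
  have h1 : V 1 = U 1 := hother 1 (by decide)
  have h4 : V 4 = U 4 := hother 4 (by decide)
  have h6 : V 6 = U 6 := hother 6 (by decide)
  have h10 : V 10 = U 10 := hother 10 (by decide)
  have h12 : V 12 = U 12 := hother 12 (by decide)
  have h13 : V 13 = U 13 := hother 13 (by decide)
  have f14 := hsp current (by simp [prepare])
  have f15 := hsp alive (by simp [prepare])
  have f36 := hsp anyAlive (by simp [prepare])
  have f16 := hsp gradient (by simp [prepare])
  have f17 := hsp active (by simp [prepare])
  have f18 := hsp gramMatrix (by simp [prepare])
  have f19 := hsp identity (by simp [prepare])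
  have f20 := hsp ⟨20, by decide, 0⟩ (by simp [prepare])
  have f23 := hsp ⟨23, by decide, 0⟩ (by simp [prepare])
  have f25 := hsp ⟨25, by decide, 0⟩ (by simp [prepare])
  have f26 := hsp ⟨26, by decide, 0⟩ (by simp [prepare])
  simp only [current, alive, anyAlive, gradient, active, gramMatrix, identity, gramExpr, gradEntry, scaledGrad, fractional,
    lengthCell] at f14 f15 f36 f16 f17 f18 f19 f20 f23 f25 f26
  simp only [NatExpr.eval_sub, NatExpr.eval_add, NatExpr.eval_mul, NatExpr.eval_one, NatExpr.eval_zero,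
    NatExpr.eval_ofNat, NatExpr.eval_var, NatExpr.eval_read, NatExpr.eval_sum, NatExpr.eval_prod,
    NatExpr.eval_lt, NatExpr.eval_div, NatExpr.eval_eq, NatExpr.eval_ite, eval_mod, eval_scalar, eval_entry,
    NatExpr.eval_cell, Function.update_apply, Nat.reduceEqDiff, if_true, if_false,
    OfNat.ofNat_ne_zero, one_ne_zero, h0, h1, h4, h6, h10, h12, h13, ite_self] at f14 f15 f36 f16 f17 f18 f19 f20 f23 f25 f26
  clear hsp
  set f : ℕ → ℕ := fun c => ∑ j ∈ range (U 0 0), (if U 10 j = c then 1 else 0) *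
    ∑ l ∈ range (U 0 2), (if 0 < U 12 (j * U 0 2 + l) then 1 else 0) *
      (if U 12 (j * U 0 2 + l) < U 13 0 then 1 else 0) with hf
  have hb : V 14 0 = firstIndex f (U 0 0) := by
    rw [f14, hc7]
    simp only [zero_lt_one, if_true]
    refine (NatExpr.eval_first f (by decide) fun q r => ?_).trans (by rw [h0])
    simp only [NatExpr.eval_mul, NatExpr.eval_zero, NatExpr.eval_add, NatExpr.eval_cell,
      NatExpr.eval_var, NatExpr.eval_read, NatExpr.eval_sum, NatExpr.eval_lt, NatExpr.eval_eq,
      eval_scalar, Function.update_apply, Nat.reduceEqDiff, if_true, if_false,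
      OfNat.one_ne_ofNat, h0, h10, h12, h13]
    rfl
  have hfrac := frac_iff (a := 12) hD
  have hf_ne : ∀ {c}, f c ≠ 0 ↔ ∃ j < U 0 0, ∃ l < U 0 2, U 10 j = c ∧
      Layout.Frac (coloring U 12 13) j l := by
    intro c
    simp only [hf, hfrac, ne_eq, sum_eq_zero_iff, mem_range, mul_eq_zero, not_forall, not_or,
      ite_eq_right_iff, one_ne_zero, imp_false, not_not, exists_prop]
    exact ⟨fun ⟨j, hj, hc, l, hl, h⟩ => ⟨j, hj, l, hl, hc, h⟩,
      fun ⟨j, hj, l, hl, hc, h⟩ => ⟨j, hj, hc, l, hl, h⟩⟩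
  classical
  have h15 : ∀ j < U 0 0, ∀ l < U 0 2, V 15 (j * U 0 2 + l) =
      if U 10 j = V 14 0 ∧ Layout.Frac (coloring U 12 13) j l then 1 else 0 := by
    intro j hj l hl
    rw [f15, hc4]
    simp only [index_lt hj hl, if_true, index_div hl]
    by_cases h1 : U 10 j = V 14 0 <;> by_cases h2 : 0 < U 12 (j * U 0 2 + l) <;>
      by_cases h3 : U 12 (j * U 0 2 + l) < U 13 0 <;> simp only [hfrac, h1, h2, h3, if_true, if_false,
        and_self, and_true, and_false, mul_one, mul_zero]
  refine ⟨fun a ha => hother a fun p hp h => ha ?_, ?_, fun h => ?_, fun h => ?_, fun hcur => ?_,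
    fun q hq q' hq' => ?_, fun q => ?_, fun q hq q' hq' => ?_, fun q => by rw [f20], by rw [f23],
    fun q => by rw [f25], fun q => by rw [f26]⟩
  · subst h
    revert p
    decide
  · rw [f36, hc7]; simp
  · rw [f36, hc7]
    simp only [zero_lt_one, if_true]
    rw [hc4, sum_range_mul]
    refine sum_eq_zero fun j hj => sum_eq_zero fun l hl => ?_
    rw [h15 j (mem_range.1 hj) l (mem_range.1 hl),
      if_neg fun h' => h j (mem_range.1 hj) l (mem_range.1 hl) h'.2]
  · obtain ⟨j, hj, l, hl, h⟩ := h
    obtain ⟨hz, hnz⟩ := exists_firstIndex f (U 0 0)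
    have hlt : firstIndex f (U 0 0) < U 0 0 := firstIndex_lt (hS.cls_lt j hj) (hf_ne.2 ⟨j, hj, l, hl, rfl, h⟩)
    rw [← hb] at hz hnz hlt
    refine ⟨hf_ne.1 (hnz hlt), fun j hj l hl h => ?_⟩
    by_contra hn
    exact hf_ne.2 ⟨j, hj, l, hl, rfl, h⟩ (hz _ (not_le.1 hn))
  · have hw : ∏ q ∈ range (U 0 0), U 0 2 = U 0 2 ^ U 0 0 := by simp
    refine ⟨pow_pos hk _, fun j hj l hl => ?_, fun i hi j hj l hl hc => ?_, fun i hi l hl => ?_⟩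
    · refine (h15 j hj l hl).trans ?_
      exact if_congr Iff.rfl rfl rfl
    · replace hi : i < U 0 1 := hi
      replace hj : j < U 0 0 := hj
      replace hl : l < U 0 2 := hl
      rw [f16, hc11, hc4, ← mul_assoc]
      have hlt : (i * U 0 0 + j) * U 0 2 + l < U 0 1 * U 0 0 * U 0 2 := index_lt (index_lt hi hj) hl
      simp only [hlt, if_true, index_div hl, index_mod hl, index_div hj, index_mod hj]
      rw [Layout.grad, mul_sum, Nat.cast_sum]
      refine sum_congr rfl fun u _ => ?_
      by_cases hown : U 1 u = i
      · rw [if_pos hown, if_pos (show (layout U).own u = i from hown), one_mul, Nat.cast_mul,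
          mul_left_comm]
        refine congrArg _ ?_
        rw [Layout.coef, Nat.cast_prod, Nat.cast_pow]
        have : (U 0 2 : ℝ) ^ U 0 0 = ∏ j ∈ range (U 0 0), (U 0 2 : ℝ) := by simp
        rw [this]
        refine Eq.trans ?_ prod_mul_distrib
        refine prod_congr rfl fun j' hj' => ?_
        by_cases h1 : j' = j
        · simp [h1]
        · simp only [h1, if_false, ne_eq, not_true_eq_false]
          rcases Nat.le_one_iff_eq_zero_or_eq_one.1 (hS.mem_le u j') with h2 | h2
          · have h2' : U 4 (u * U 0 0 + j') = 0 := h2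
            simp [h2, h2']
          · have h2' : U 4 (u * U 0 0 + j') = 1 := h2
            have hk0 : (U 0 2 : ℝ) ≠ 0 := by positivity
            rw [h2, h2']
            simp only [one_ne_zero, not_false_eq_true, if_true, Nat.cast_one, one_mul, Layout.cut]
            -- For a rounded item of an earlier class the numerator is `0` or the full denominator,
            -- so truncated `1 - numerator` equals `1 - x`.
            by_cases h3 : U 10 j' < V 14 0
            · have h4 : ¬ Layout.Frac (coloring U 12 13) j' l := fun h =>
                absurd (hcur.2 j' (mem_range.1 hj') l hl h) (not_le.2 h3)
              rw [if_pos (show (layout U).cls j' < V 14 0 from h3)]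
              rw [hfrac] at h4
              have h5 := hx.le_one (mem_range.1 hj') hl
              simp only [h3, if_true, one_ne_zero, not_false_eq_true, coloring]
              have hD' : (0 : ℝ) < U 13 0 := by exact_mod_cast hD
              rw [coloring, div_le_one hD', Nat.cast_le] at h5
              rcases Nat.eq_zero_or_pos (U 12 (j' * U 0 2 + l)) with h6 | h6
              · simp [h6]
              · have h7 : U 12 (j' * U 0 2 + l) = U 13 0 := by omega
                rw [h7, div_self hD'.ne', Nat.sub_eq_zero_of_le (by omega)]
                simp
            · rw [if_neg (show ¬ (layout U).cls j' < V 14 0 from h3)]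
              simp only [h3, if_false, not_true_eq_false]
              rw [Nat.cast_sub hk]
              simp only [layout]
              field_simp
              simp
      · rw [if_neg hown, if_neg (show ¬ (layout U).own u = i from hown), zero_mul, zero_mul]
        simp
    · replace hi : i < U 0 1 := hi
      replace hl : l < U 0 2 := hl
      rw [f17, hc9]
      simp only [index_lt hi hl, if_true, index_div hl, index_mod hl, hw]
      rfl
  · rw [f18, hc5]
    simp only [index_lt hq hq', if_true, index_div hq', index_mod hq']
    rfl
  -- The bound involves only the dimensions and not the numerators of the colouring; otherwise bit
  -- lengths would compound over the rounds.
  · have a15 : ∀ q, V 15 q ≤ 1 := fun q => by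
      rw [f15]
      dsimp only
      split_ifs <;> simp
    have a17 : ∀ q, V 17 q ≤ 1 := fun q => by
      rw [f17]
      dsimp only
      split_ifs <;> simp
    have a16 : ∀ q, V 16 q ≤ U 0 3 * U 0 2 ^ U 0 0 := fun q => by
      rw [f16]
      dsimp only
      by_cases hq : q < U 0 11
      · rw [if_pos hq]
        refine (sum_le_card_nsmul _ _ (U 0 2 ^ U 0 0) fun u _ => ?_).trans (by simp)
        have h1 : U 4 (u * U 0 0 + q / U 0 2 % U 0 0) ≤ 1 := hS.mem_le u _
        refine (Nat.mul_le_mul (Nat.mul_le_mul (indicator_le_one _) h1)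
          (prod_le_pow_card _ _ (U 0 2) fun j _ => ?_)).trans (by simp)
        have h2 : U 0 2 * (1 - U 12 (j * U 0 2 + q % U 0 2)) ≤ U 0 2 * 1 :=
          Nat.mul_le_mul_left _ (Nat.sub_le _ _)
        split_ifs <;> omega
      · rw [if_neg hq]
        exact Nat.zero_le _
    set g := U 0 3 * U 0 2 ^ U 0 0 with hg
    rw [f18]
    dsimp only
    by_cases hq : q < U 0 5
    · rw [if_pos hq]
      refine (Nat.add_le_add (Nat.mul_le_mul (Nat.mul_le_mul (a15 _) (a15 _))
        (Nat.add_le_add (indicator_le_one _) (Nat.mul_le_mul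
          (indicator_le_one _) (sum_le_card_nsmul _ _ (1 * g * g) fun i _ =>
            Nat.mul_le_mul (Nat.mul_le_mul (a17 _) (a16 _)) (a16 _)))))
        (Nat.mul_le_mul (Nat.sub_le _ _) (indicator_le_one _))).trans ?_
      rw [card_range, smul_eq_mul]
      apply le_of_eq
      ring
    · rw [if_neg hq]
      exact Nat.zero_le _
  · rw [f19, hc5]
    simp only [index_lt hq hq', if_true, index_div hq', index_mod hq']

end Algorithm

/-! ### Computing a kernel vector -/

namespace Algorithm

/-- The square matrix stored row by row in an array. -/
def storedMatrix (N : ℕ) (A : ℕ → ℕ) : Matrix (Fin N) (Fin N) ℝ :=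
  Matrix.of fun q q' => (A (q * N + q') : ℝ)

theorem storedMatrix_mul_apply (N : ℕ) (A B : ℕ → ℕ) (q q' : Fin N) :
    (storedMatrix N A * storedMatrix N B) q q' =
      (∑ p ∈ range N, A (q * N + p) * B (p * N + q') : ℕ) := by
  rw [Matrix.mul_apply, ← Fin.sum_univ_eq_sum_range fun p => A (q * N + p) * B (p * N + q')]
  push_cast
  rfl

theorem trace_storedMatrix_mul (N : ℕ) (A B : ℕ → ℕ) :
    (storedMatrix N A * storedMatrix N B).trace =
      (∑ q ∈ range N, ∑ p ∈ range N, A (q * N + p) * B (p * N + q) : ℕ) := by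
  rw [Matrix.trace, ← Fin.sum_univ_eq_sum_range fun q => ∑ p ∈ range N, A (q * N + p) * B (p * N + q),
    Nat.cast_sum]
  exact sum_congr rfl fun q _ => storedMatrix_mul_apply N A B q q

/-- After `i` steps the arrays `19` and `20` hold the parts of the `i`-th matrix of the recursion and
the arrays `25` and `26` hold those of a nonzero column of its last nonzero predecessor. -/
structure LeverrierSpec (U V : Store) (i : ℕ) : Prop where
  other : ∀ a, a ∉ ([19, 20, 21, 22, 23, 24, 25, 26] : List ℕ) → V a = U a
  counter : V 23 0 = i
  diff : storedMatrix (U 0 4) (V 19) - storedMatrix (U 0 4) (V 20) =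
    leverrier (storedMatrix (U 0 4) (U 18)) i
  vec : i ≠ 0 → ∃ i' < i, ∃ c : Fin (U 0 4),
    (∀ q : Fin (U 0 4), (V 25 q : ℝ) - V 26 q = leverrier (storedMatrix (U 0 4) (U 18)) i' q c) ∧
    (∃ q : Fin (U 0 4), V 25 q ≠ V 26 q) ∧
    (i' + 1 = i ∨ leverrier (storedMatrix (U 0 4) (U 18)) (i' + 1) = 0)

/-- The positions of the nonzero columns of the difference of two stored matrices. -/
def columnDiff (N : ℕ) (A B : ℕ → ℕ) (c : ℕ) : ℕ :=
  ∑ r ∈ range N, ((A (r * N + c) - B (r * N + c)) + (B (r * N + c) - A (r * N + c)))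

def traceMul (N : ℕ) (A B : ℕ → ℕ) : ℕ := ∑ q ∈ range N, ∑ p ∈ range N, A (q * N + p) * B (p * N + q)

/-- What one step of the recursion does. -/
structure LeverrierStep (V W : Store) (N : ℕ) : Prop where
  other : ∀ a, a ∉ ([19, 20, 21, 22, 23, 24, 25, 26] : List ℕ) → W a = V a
  counter : W 23 0 = V 23 0 + 1
  trace₁ : W 21 0 = traceMul N (V 18) (V 19)
  trace₂ : W 22 0 = traceMul N (V 18) (V 20)
  column : W 24 0 = firstIndex (columnDiff N (V 19) (V 20)) N
  mat₁ : ∀ q < N, ∀ q' < N, W 19 (q * N + q') = (V 23 0 + 1) *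
    ∑ p ∈ range N, V 18 (q * N + p) * V 19 (p * N + q') +
      (if q = q' then 1 else 0) * traceMul N (V 18) (V 20)
  mat₂ : ∀ q < N, ∀ q' < N, W 20 (q * N + q') = (V 23 0 + 1) *
    ∑ p ∈ range N, V 18 (q * N + p) * V 20 (p * N + q') +
      (if q = q' then 1 else 0) * traceMul N (V 18) (V 19)
  vec₁ : ∀ q < N, W 25 q = if firstIndex (columnDiff N (V 19) (V 20)) N < N then
    V 19 (q * N + firstIndex (columnDiff N (V 19) (V 20)) N) else V 25 q
  vec₂ : ∀ q < N, W 26 q = if firstIndex (columnDiff N (V 19) (V 20)) N < N then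
    V 20 (q * N + firstIndex (columnDiff N (V 19) (V 20)) N) else V 26 q

theorem leverrierStep_spec {V : Store} (hV : Ready V) :
    LeverrierStep V (leverrierStep.run V) (V 0 4) := by
  have hc7 : V 0 7 = 1 := hV.c7
  have hc5 : V 0 5 = V 0 4 * V 0 4 := hV.c5
  set l : List Assign := [column, ⟨21, by decide, traceExpr 19⟩, ⟨22, by decide, traceExpr 20⟩] with hl
  obtain ⟨hother, hsp⟩ := run_fills (l := l) (by decide) V
  set N := V 0 4 with hN
  set V₁ := (fills l).run V with hV₁
  have k0 : V₁ 0 = V 0 := hother 0 (by decide)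
  have k18 : V₁ 18 = V 18 := hother 18 (by decide)
  have k19 : V₁ 19 = V 19 := hother 19 (by decide)
  have k20 : V₁ 20 = V 20 := hother 20 (by decide)
  have k23 : V₁ 23 = V 23 := hother 23 (by decide)
  have k25 : V₁ 25 = V 25 := hother 25 (by decide)
  have k26 : V₁ 26 = V 26 := hother 26 (by decide)
  have f24 := hsp Algorithm.column (by simp [hl])
  have f21 := hsp ⟨21, by decide, traceExpr 19⟩ (by simp [hl])
  have f22 := hsp ⟨22, by decide, traceExpr 20⟩ (by simp [hl])
  have e24 : V₁ 24 0 = firstIndex (columnDiff N (V 19) (V 20)) N := by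
    rw [show V₁ 24 = _ from f24]
    simp only [Algorithm.column, lengthCell, hc7, zero_lt_one, if_true]
    refine (NatExpr.eval_first (columnDiff N (V 19) (V 20)) (by decide) fun q r => ?_).trans
      (by rw [k0])
    simp only [NatExpr.eval_add, NatExpr.eval_sub, NatExpr.eval_sum, NatExpr.eval_var, eval_entry,
      Function.update_apply, Nat.reduceEqDiff, if_true, if_false, k0, k19, k20]
    rfl
  have e21 : V₁ 21 0 = traceMul N (V 18) (V 19) := by
    rw [show V₁ 21 = _ from f21]
    simp only [lengthCell, hc7, zero_lt_one, if_true, traceExpr, NatExpr.eval_mul,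
      NatExpr.eval_sum, NatExpr.eval_var, eval_entry, Function.update_apply, Nat.reduceEqDiff, if_false,
      k0, k18, k19]
    rfl
  have e22 : V₁ 22 0 = traceMul N (V 18) (V 20) := by
    rw [show V₁ 22 = _ from f22]
    simp only [lengthCell, hc7, zero_lt_one, if_true, traceExpr, NatExpr.eval_mul,
      NatExpr.eval_sum, NatExpr.eval_var, eval_entry, Function.update_apply, Nat.reduceEqDiff, if_false,
      k0, k18, k20]
    rfl
  clear_value V₁
  have hrun : leverrierStep.run V = (Cmd.seq (.fill 25 (by decide) (copyColumn 25 19))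
    (.seq (.fill 26 (by decide) (copyColumn 26 20))
    (.seq (.fill 23 (by decide) (scalar 23 + 1))
    (.seq (.fill 19 (by decide) (recursion 19 22))
      (.fill 20 (by decide) (recursion 20 21)))))).run V₁ := by
    rw [hV₁]; rfl
  simp only [Cmd.run, copyColumn, recursion, lengthCell, NatExpr.eval_ite, NatExpr.eval_lt,
    NatExpr.eval_add, NatExpr.eval_mul, NatExpr.eval_one, NatExpr.eval_eq, NatExpr.eval_div, eval_mod,
    NatExpr.eval_sum, NatExpr.eval_cell, NatExpr.eval_read, NatExpr.eval_var, eval_scalar, eval_entry,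
    Function.update_apply, Nat.reduceEqDiff, if_true, if_false, OfNat.ofNat_ne_zero, OfNat.zero_ne_ofNat,
    k0, k18, k19, k20, k23, k25, k26, hc7, hc5, zero_lt_one, ← hN] at hrun
  clear hsp f24 f21 f22
  set W := leverrierStep.run V with hW
  refine ⟨fun a ha => ?_, ?_, ?_, ?_, ?_, fun q hq q' hq' => ?_, fun q hq q' hq' => ?_,
    fun q hq => ?_, fun q hq => ?_⟩
  · simp only [List.mem_cons, List.not_mem_nil, or_false, not_or] at ha
    rw [hrun, Function.update_of_ne (by tauto), Function.update_of_ne (by tauto),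
      Function.update_of_ne (by tauto), Function.update_of_ne (by tauto),
      Function.update_of_ne (by tauto), hother a fun p hp => ?_]
    simp only [hl, List.mem_cons, List.not_mem_nil, or_false] at hp
    rcases hp with rfl | rfl | rfl <;> simp only [Algorithm.column] <;> tauto
  · rw [hrun, Function.update_of_ne (by decide), Function.update_of_ne (by decide), Function.update_self]
    simp
  · rw [hrun, Function.update_of_ne (by decide), Function.update_of_ne (by decide),
      Function.update_of_ne (by decide), Function.update_of_ne (by decide),
      Function.update_of_ne (by decide), e21]
  · rw [hrun, Function.update_of_ne (by decide), Function.update_of_ne (by decide),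
      Function.update_of_ne (by decide), Function.update_of_ne (by decide),
      Function.update_of_ne (by decide), e22]
  · rw [hrun, Function.update_of_ne (by decide), Function.update_of_ne (by decide),
      Function.update_of_ne (by decide), Function.update_of_ne (by decide),
      Function.update_of_ne (by decide), e24]
  · rw [hrun, Function.update_of_ne (by decide), Function.update_self]
    simp only [index_lt hq hq', if_true, index_div hq', index_mod hq', e22]
  · rw [hrun, Function.update_self]
    simp only [index_lt hq hq', if_true, index_div hq', index_mod hq', e21]
  · rw [hrun, Function.update_of_ne (by decide), Function.update_of_ne (by decide),
      Function.update_of_ne (by decide), Function.update_of_ne (by decide), Function.update_self,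
      if_pos hq, e24]
    by_cases hc : firstIndex (columnDiff N (V 19) (V 20)) N < N <;> simp [hc]
  · rw [hrun, Function.update_of_ne (by decide), Function.update_of_ne (by decide),
      Function.update_of_ne (by decide), Function.update_self, if_pos hq, e24]
    by_cases hc : firstIndex (columnDiff N (V 19) (V 20)) N < N <;> simp [hc]

/-- Each matrix is kept as a difference of two natural ones. Adding the trace of the other part to
the diagonal replaces a subtraction. -/
theorem LeverrierSpec.run {U V : Store} {i : ℕ} (hU : Ready U) (h : LeverrierSpec U V i)
    (hi : i < U 0 4) : LeverrierSpec U (leverrierStep.run V) (i + 1) := by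
  have h0 : V 0 = U 0 := h.other 0 (by decide)
  have h18 : V 18 = U 18 := h.other 18 (by decide)
  have st := leverrierStep_spec (hU.congr h0)
  set W := leverrierStep.run V with hW
  rw [h0] at st
  set N := U 0 4 with hN
  set M := storedMatrix N (U 18) with hM
  set P := storedMatrix N (V 19) with hP
  set Q := storedMatrix N (V 20) with hQ
  have hdiff : P - Q = leverrier M i := h.diff
  have hf_ne : ∀ c, columnDiff N (V 19) (V 20) c ≠ 0 ↔ ∃ r < N, V 19 (r * N + c) ≠ V 20 (r * N + c) := by
    intro c
    simp only [columnDiff, ne_eq, sum_eq_zero_iff, mem_range, not_forall, exists_prop]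
    refine exists_congr fun r => and_congr_right fun _ => ?_
    omega
  refine ⟨fun a ha => (st.other a ha).trans (h.other a ha), by rw [st.counter, h.counter], ?_,
    fun _ => ?_⟩
  · change storedMatrix N (W 19) - storedMatrix N (W 20) = leverrier M (i + 1)
    rw [leverrier, ← hdiff, mul_sub, Matrix.trace_sub, hM, hP, hQ, trace_storedMatrix_mul,
      trace_storedMatrix_mul]
    ext q q'
    rw [Matrix.sub_apply, Matrix.sub_apply, Matrix.smul_apply, Matrix.smul_apply, Matrix.sub_apply,
      storedMatrix_mul_apply, storedMatrix_mul_apply, Matrix.one_apply]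
    simp only [storedMatrix, Matrix.of_apply, st.mat₁ q q.2 q' q'.2, st.mat₂ q q.2 q' q'.2,
      Fin.ext_iff, h18, h.counter, traceMul]
    push_cast
    simp only [smul_eq_mul]
    ring
  · obtain ⟨hz, hnz⟩ := exists_firstIndex (columnDiff N (V 19) (V 20)) N
    have w25 := st.vec₁
    have w26 := st.vec₂
    by_cases hc : firstIndex (columnDiff N (V 19) (V 20)) N < N
    · refine ⟨i, Nat.lt_succ_self i, ⟨_, hc⟩, fun q => ?_, ?_, .inl rfl⟩
      · rw [w25 q q.2, w26 q q.2, if_pos hc, if_pos hc, ← hdiff]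
        rfl
      · obtain ⟨r, hr, hne⟩ := (hf_ne _).1 (hnz hc)
        refine ⟨⟨r, hr⟩, ?_⟩
        rwa [w25 r hr, w26 r hr, if_pos hc, if_pos hc]
    -- No column is nonzero, so the previously saved vector is kept. It already comes from the last
    -- nonzero matrix.
    · have hzero : leverrier M i = 0 := by
        rw [← hdiff]
        ext q q'
        have h1 := hz q' (by have := q'.2; omega)
        by_contra hne
        refine (hf_ne q').2 ⟨q, q.2, fun heq => hne ?_⟩ h1
        simp [hP, hQ, storedMatrix, heq]
      -- The recursion starts with the identity, which is nonzero, so some vector has been saved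
      -- before.
      have hi0 : i ≠ 0 := by
        rintro rfl
        have := congrFun (congrFun hzero ⟨0, hi⟩) ⟨0, hi⟩
        simp [leverrier] at this
      obtain ⟨i', hi', c, h1, h2, h3⟩ := h.vec hi0
      refine ⟨i', by omega, c, fun q => ?_, ?_, ?_⟩
      · rw [w25 q q.2, w26 q q.2, if_neg hc, if_neg hc, h1]
      · obtain ⟨q, hq⟩ := h2
        exact ⟨q, by rwa [w25 q q.2, w26 q q.2, if_neg hc, if_neg hc]⟩
      · rcases h3 with h3 | h3
        · exact .inr (h3 ▸ hzero)
        · exact .inr h3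

theorem LeverrierSpec.iterate {U : Store} (hU : Ready U) (h23 : U 23 0 = 0) (h20 : ∀ q, U 20 q = 0)
    (h19 : ∀ q < U 0 4, ∀ q' < U 0 4, U 19 (q * U 0 4 + q') = if q = q' then 1 else 0) {i : ℕ}
    (hi : i ≤ U 0 4) : LeverrierSpec U (leverrierStep.run^[i] U) i := by
  induction i with
  | zero =>
    refine ⟨fun _ _ => rfl, h23, ?_, fun h => absurd rfl h⟩
    ext q q'
    simp [storedMatrix, leverrier, h20, h19 q q.2 q' q'.2, Matrix.one_apply, Fin.ext_iff]
  | succ i ih =>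
    rw [Function.iterate_succ_apply']
    exact (ih (by omega)).run hU hi

/-- The vector found by the recursion lies in the kernel. -/
theorem LeverrierSpec.mulVec_eq_zero {U V : Store} {N : ℕ} (hN : U 0 4 = N) (hpos : 0 < N)
    (h : LeverrierSpec U V N) (hM : (storedMatrix N (U 18)).IsSymm) {z : Fin N → ℝ} (hz : z ≠ 0)
    (hMz : (storedMatrix N (U 18)).mulVec z = 0) :
    (storedMatrix N (U 18)).mulVec (fun q => (V 25 q : ℝ) - V 26 q) = 0 ∧
      ∃ q < N, V 25 q ≠ V 26 q := by
  subst hN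
  obtain ⟨i', hi', c, h1, ⟨q, hq⟩, h3⟩ := h.vec hpos.ne'
  refine ⟨?_, q, q.2, hq⟩
  have h4 : leverrier (storedMatrix (U 0 4) (U 18)) (i' + 1) = 0 := by
    rcases h3 with h3 | h3
    · rw [h3]
      have := leverrier_card hM
      rwa [Fintype.card_fin] at this
    · exact h3
  have h5 := mul_leverrier_eq_zero hM hz hMz h4
  simp only [h1]
  funext q
  exact congrFun (congrFun h5 q) c

end Algorithm

/-! ### Moving until a coordinate vanishes -/

/-- The first coordinate of `X` that vanishes when moving along `P - R`. -/
def blockingIndex (X P R : ℕ → ℕ) (N : ℕ) : ℕ :=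
  firstIndex (fun q => (if P q < R q then 1 else 0) * ∏ q' ∈ range N,
    (1 - (if P q' < R q' then 1 else 0) *
      if X q' * (R q - P q) < X q * (R q' - P q') then 1 else 0)) N

/-- The minimum ratio test for `X q / (R q - P q)`, by cross-multiplication. The final inequality
says that the moved numerators are nonnegative, so the truncated subtraction in `moved` is exact. -/
theorem blockingIndex_spec {X P R : ℕ → ℕ} {N : ℕ} (h : ∃ q < N, P q < R q) :
    blockingIndex X P R N < N ∧ P (blockingIndex X P R N) < R (blockingIndex X P R N) ∧
    ∀ q < N, X (blockingIndex X P R N) * R q ≤ X q * (R (blockingIndex X P R N) - P (blockingIndex X P R N)) +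
      X (blockingIndex X P R N) * P q := by
  set f : ℕ → ℕ := fun q => (if P q < R q then 1 else 0) * ∏ q' ∈ range N,
    (1 - (if P q' < R q' then 1 else 0) *
      if X q' * (R q - P q) < X q * (R q' - P q') then 1 else 0) with hf
  have hf_ne : ∀ q, f q ≠ 0 ↔ P q < R q ∧ ∀ q' < N, P q' < R q' →
      X q * (R q' - P q') ≤ X q' * (R q - P q) := by
    intro q
    simp only [hf, ne_eq, mul_eq_zero, not_or, prod_eq_zero_iff, mem_range, not_exists, not_and,
      ite_eq_right_iff, one_ne_zero, imp_false, not_not]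
    refine and_congr_right fun _ => forall_congr' fun q' => forall_congr' fun _ => ?_
    by_cases h1 : P q' < R q' <;> by_cases h2 : X q' * (R q - P q) < X q * (R q' - P q') <;>
      simp [h1, h2, not_le.2, not_lt.1]
  have hex : ∃ q < N, f q ≠ 0 := by
    obtain ⟨q₀, hq₀, hlt⟩ := h
    obtain ⟨q, hq, hmin⟩ := exists_min_image ((range N).filter fun q => P q < R q)
      (fun q => (X q : ℝ) / ((R q - P q : ℕ) : ℝ)) ⟨q₀, mem_filter.2 ⟨mem_range.2 hq₀, hlt⟩⟩
    rw [mem_filter, mem_range] at hq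
    refine ⟨q, hq.1, (hf_ne q).2 ⟨hq.2, fun q' hq' hlt' => ?_⟩⟩
    have := hmin q' (mem_filter.2 ⟨mem_range.2 hq', hlt'⟩)
    rw [div_le_div_iff₀ (by exact_mod_cast Nat.sub_pos_of_lt hq.2)
      (by exact_mod_cast Nat.sub_pos_of_lt hlt')] at this
    exact_mod_cast this
  obtain ⟨q, hq, hne⟩ := hex
  have hlt := firstIndex_lt hq hne
  have h1 := (hf_ne _).1 ((exists_firstIndex f N).2 hlt)
  refine ⟨hlt, h1.1, fun q hq => ?_⟩
  change X (firstIndex f N) * R q ≤ X q * (R (firstIndex f N) - P (firstIndex f N)) +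
    X (firstIndex f N) * P q
  by_cases hq' : P q < R q
  · have h2 := h1.2 q hq hq'
    rw [Nat.mul_sub] at h2
    omega
  · exact (Nat.mul_le_mul_left _ (not_lt.1 hq')).trans (Nat.le_add_left _ _)

namespace Algorithm

/-- The arrays `a` and `d` arise from the colouring in the arrays `12` and `13` by moving along the
difference of the arrays `p` and `r` as far as possible. -/
structure Moved (U V : Store) (p r a d : ℕ) : Prop where
  num : ∀ q < U 0 4, V a q = U 12 q * (U r (blockingIndex (U 12) (U p) (U r) (U 0 4)) -
      U p (blockingIndex (U 12) (U p) (U r) (U 0 4))) +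
    U 12 (blockingIndex (U 12) (U p) (U r) (U 0 4)) * U p q -
    U 12 (blockingIndex (U 12) (U p) (U r) (U 0 4)) * U r q
  den : V d 0 = U 13 0 * (U r (blockingIndex (U 12) (U p) (U r) (U 0 4)) -
      U p (blockingIndex (U 12) (U p) (U r) (U 0 4)))

theorem Moved.exists_shift {U V : Store} {p r a d : ℕ} (hU : U.Supported) (hV : V.Supported)
    (hp : p = 25 ∧ r = 26 ∨ p = 26 ∧ r = 25) (ha : a = 29 ∨ a = 31)
    (h0 : V 0 = U 0) (h : Moved U V p r a d) (hD : 0 < U 13 0) (hex : ∃ q < U 0 4, U p q < U r q) :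
    0 < V d 0 ∧ ∃ c : ℝ, 0 ≤ c ∧ coloring V a d = Layout.shift (coloring U 12 13)
      (fun j l => (U p (j * U 0 2 + l) : ℝ) - U r (j * U 0 2 + l)) c ∧
      ∃ q < U 0 4, U p q ≠ U r q ∧ V a q = 0 := by
  obtain ⟨hlt, hne, hle⟩ := blockingIndex_spec (X := U 12) hex
  obtain ⟨hnum, hden⟩ := h
  set q₁ := blockingIndex (U 12) (U p) (U r) (U 0 4) with hq₁
  have hpos : 0 < U r q₁ - U p q₁ := Nat.sub_pos_of_lt hne
  have hsup : ∀ {W : Store} {e q : ℕ}, W.Supported → e ≠ 0 → lengthCell e = 4 → W 0 4 ≤ q → W e q = 0 :=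
    fun hW he hl hq => hW _ he _ (by rwa [hl])
  have hcast : (((U r q₁ - U p q₁ : ℕ)) : ℝ) = U r q₁ - U p q₁ := Nat.cast_sub hne.le
  have hpos' : (0 : ℝ) < U r q₁ - U p q₁ := by rw [← hcast]; exact_mod_cast hpos
  have hD' : (0 : ℝ) < U 13 0 := by exact_mod_cast hD
  -- The step length is the current weight at `q₁` divided by its rate of decrease, so this
  -- coordinate becomes exactly zero.
  refine ⟨hden ▸ Nat.mul_pos hD hpos, (U 12 q₁ : ℝ) / (U 13 0 * (U r q₁ - U p q₁)), by positivity,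
    ?_, q₁, hlt, hne.ne, ?_⟩
  · funext j l
    simp only [coloring, Layout.shift, hden, h0]
    set q := j * U 0 2 + l
    have key : (V a q : ℝ) = U 12 q * (U r q₁ - U p q₁) + U 12 q₁ * U p q - U 12 q₁ * U r q := by
      rcases lt_or_ge q (U 0 4) with hq | hq
      · rw [hnum q hq, Nat.cast_sub (hle q hq)]
        push_cast
        rw [hcast]
      · have e1 : V a q = 0 := hsup hV (by rcases ha with rfl | rfl <;> decide)
          (by rcases ha with rfl | rfl <;> rfl) (by rwa [h0])
        have e2 : U 12 q = 0 := hsup hU (by decide) rfl hq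
        have e3 : U p q = 0 := hsup hU (by rcases hp with ⟨rfl, -⟩ | ⟨rfl, -⟩ <;> decide)
          (by rcases hp with ⟨rfl, -⟩ | ⟨rfl, -⟩ <;> rfl) hq
        have e4 : U r q = 0 := hsup hU (by rcases hp with ⟨-, rfl⟩ | ⟨-, rfl⟩ <;> decide)
          (by rcases hp with ⟨-, rfl⟩ | ⟨-, rfl⟩ <;> rfl) hq
        simp [e1, e2, e3, e4]
    rw [key]
    push_cast
    rw [hcast]
    field_simp
    ring
  · rw [hnum q₁ hlt, Nat.mul_sub]
    have := Nat.mul_le_mul_left (U 12 q₁) hne.le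
    omega

theorem candidates_spec {U : Store} (hU : Ready U) :
    (∀ a, a ∉ ([27, 28, 29, 30, 31, 32] : List ℕ) → (fills candidates).run U a = U a) ∧
    Moved U ((fills candidates).run U) 25 26 29 30 ∧ Moved U ((fills candidates).run U) 26 25 31 32 := by
  obtain ⟨hother, hsp⟩ := run_fills ordered_candidates U
  have hc7 := hU.c7
  set V := (fills candidates).run U with hV
  have h0 : V 0 = U 0 := hother 0 (by decide)
  have h12 : V 12 = U 12 := hother 12 (by decide)
  have h13 : V 13 = U 13 := hother 13 (by decide)
  have h25 : V 25 = U 25 := hother 25 (by decide)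
  have h26 : V 26 = U 26 := hother 26 (by decide)
  have e : ∀ p r, V p = U p → V r = U r → ∀ q, (blocking p r).eval V (Function.update 0 0 q) =
      blockingIndex (U 12) (U p) (U r) (U 0 4) := by
    intro p r hp hr q
    refine (NatExpr.eval_first _ (by decide) fun q r => ?_).trans (by rw [h0]; rfl)
    simp only [NatExpr.eval_sub, NatExpr.eval_mul, NatExpr.eval_one, NatExpr.eval_var,
      NatExpr.eval_read, NatExpr.eval_prod, NatExpr.eval_lt,
      Function.update_apply, Nat.reduceEqDiff, if_true, if_false, h0, h12, hp, hr]
  have f27 := hsp ⟨27, by decide, blocking 25 26⟩ (by simp [candidates])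
  have f28 := hsp ⟨28, by decide, blocking 26 25⟩ (by simp [candidates])
  have f29 := hsp ⟨29, by decide, moved 27 25 26⟩ (by simp [candidates])
  have f30 := hsp ⟨30, by decide, scalar 13 * slope 27 25 26⟩ (by simp [candidates])
  have f31 := hsp ⟨31, by decide, moved 28 26 25⟩ (by simp [candidates])
  have f32 := hsp ⟨32, by decide, scalar 13 * slope 28 26 25⟩ (by simp [candidates])
  simp only [lengthCell, moved, slope, e 25 26 h25 h26, e 26 25 h26 h25, NatExpr.eval_sub,
    NatExpr.eval_add, NatExpr.eval_mul, NatExpr.eval_read, NatExpr.eval_var, eval_scalar,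
    Function.update_self, h12, h13, h25, h26, hc7] at f27 f28 f29 f30 f31 f32
  have b27 : V 27 0 = blockingIndex (U 12) (U 25) (U 26) (U 0 4) := by rw [f27]; simp
  have b28 : V 28 0 = blockingIndex (U 12) (U 26) (U 25) (U 0 4) := by rw [f28]; simp
  refine ⟨fun a ha => hother a fun p hp h => ha ?_, ⟨fun q hq => ?_, ?_⟩, ⟨fun q hq => ?_, ?_⟩⟩
  · subst h
    revert p
    decide
  · rw [f29]; simp only [hq, if_true, b27]
  · rw [f30]; simp only [zero_lt_one, if_true, b27]
  · rw [f31]; simp only [hq, if_true, b28]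
  · rw [f32]; simp only [zero_lt_one, if_true, b28]

end Algorithm

/-! ### Correctness of a rounding step -/

namespace Algorithm

theorem update_spec {U : Store} (hU : Ready U) (hsup : U.Supported) :
    (∀ a, a ∉ ([35, 12, 13] : List ℕ) → update.run U a = U a) ∧
    (U 36 0 = 0 → update.run U 12 = U 12 ∧ update.run U 13 0 = U 13 0) ∧
    (U 36 0 ≠ 0 → (potentialExpr 29 30).eval U 0 ≤ (potentialExpr 31 32).eval U 0 →
      update.run U 12 = U 29 ∧ update.run U 13 0 = U 30 0) ∧
    (U 36 0 ≠ 0 → ¬ (potentialExpr 29 30).eval U 0 ≤ (potentialExpr 31 32).eval U 0 →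
      update.run U 12 = U 31 ∧ update.run U 13 0 = U 32 0) := by
  have hc7 := hU.c7
  have hu : Function.update (0 : ℕ → ℕ) 0 0 = 0 := Function.update_eq_self _ _
  have e12 : update.run U 12 = fun q => if q < U 0 4 then if U 36 0 ≠ 0 then
      if (potentialExpr 29 30).eval U 0 ≤ (potentialExpr 31 32).eval U 0 then U 29 q else U 31 q
      else U 12 q else 0 := by
    simp only [update, Cmd.run, choose, lengthCell, NatExpr.eval_ite, RatExpr.eval_le,
      NatExpr.eval_read, NatExpr.eval_var, eval_scalar, Function.update_apply, Nat.reduceEqDiff,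
      if_true, if_false, OfNat.zero_ne_ofNat, hc7, zero_lt_one, hu, ite_ne_right_iff, ne_eq,
      one_ne_zero, not_false_eq_true, and_true]
  have e13 : update.run U 13 0 = if U 36 0 ≠ 0 then
      if (potentialExpr 29 30).eval U 0 ≤ (potentialExpr 31 32).eval U 0 then U 30 0 else U 32 0
      else U 13 0 := by
    simp only [update, Cmd.run, choose, lengthCell, NatExpr.eval_ite, RatExpr.eval_le,
      NatExpr.eval_read, NatExpr.eval_var, eval_scalar, Function.update_apply, Nat.reduceEqDiff,
      if_true, if_false, OfNat.zero_ne_ofNat, hc7, zero_lt_one, hu, ite_ne_right_iff, ne_eq,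
      one_ne_zero, not_false_eq_true, and_true]
  have ext : ∀ a, a ≠ 0 → lengthCell a = 4 → (fun q => if q < U 0 4 then U a q else 0) = U a := by
    intro a ha hl
    funext q
    split_ifs with h
    · rfl
    · exact (hsup a ha q (by rw [hl]; omega)).symm
  refine ⟨fun a ha => ?_, fun h => ?_, fun h h' => ?_, fun h h' => ?_⟩
  · simp only [List.mem_cons, List.not_mem_nil, or_false, not_or] at ha
    simp only [update, Cmd.run]
    rw [Function.update_of_ne ha.2.2, Function.update_of_ne ha.2.1, Function.update_of_ne ha.1]
  · simp only [e12, e13, h, ne_eq, not_true_eq_false, if_false, ext 12 (by decide) rfl, and_self]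
  · simp only [e12, e13, h, h', ne_eq, not_false_eq_true, if_true, ext 29 (by decide) rfl, and_self]
  · simp only [e12, e13, h, h', ne_eq, not_false_eq_true, if_true, if_false,
      ext 31 (by decide) rfl, and_self]

open Classical in
/-- The number of coordinates that are not yet rounded. -/
noncomputable def fracCount (n k : ℕ) (x : ℕ → ℕ → ℝ) : ℕ :=
  ((range (n * k)).filter fun q => Layout.Frac x (q / k) (q % k)).card

/-- Integral coordinates have zero direction and stay integral, while the vanishing coordinate was
fractional. Hence `n * k` rounds suffice. -/
theorem fracCount_lt {S : Layout} {b : ℕ} {x y : ℕ → ℕ → ℝ} (hy : S.Direction b x y) {c : ℝ}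
    {j l : ℕ} (hj : j < S.n) (hl : l < S.k) (hne : y j l ≠ 0) (h0 : Layout.shift x y c j l = 0) :
    fracCount S.n S.k (Layout.shift x y c) < fracCount S.n S.k x := by
  classical
  refine card_lt_card ⟨fun q hq => ?_, fun hsub => ?_⟩
  · rw [mem_filter, mem_range] at hq ⊢
    have hk : 0 < S.k := by omega
    exact ⟨hq.1, Layout.frac_of_frac_shift hy c (Nat.div_lt_of_lt_mul (by rw [mul_comm]; exact hq.1))
      (Nat.mod_lt _ hk) hq.2⟩
  · have h1 : j * S.k + l ∈ (range (S.n * S.k)).filter fun q => Layout.Frac x (q / S.k) (q % S.k) := by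
      rw [mem_filter, mem_range, index_div hl, index_mod hl]
      exact ⟨index_lt hj hl, (hy.support j hj l hl hne).2⟩
    have h2 := (mem_filter.1 (hsub h1)).2
    rw [index_div hl, index_mod hl, Layout.Frac, h0] at h2
    exact lt_irrefl _ h2.1

/-- The state of the rounding procedure, started on the store `U₀`, when at most `N` coordinates are
not yet rounded. -/
structure RoundSpec (U₀ U : Store) (N : ℕ) : Prop where
  other : ∀ a, a < 12 ∨ a = 33 ∨ a = 34 ∨ 36 < a → U a = U₀ a
  supported : U.Supported
  good : (layout U₀).Good (coloring U 12 13)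
  den_pos : 0 < U 13 0
  potential_le : (layout U₀).potential (coloring U 12 13) ≤
    (layout U₀).potential (coloring U₀ 12 13)
  count : fracCount (U₀ 0 0) (U₀ 0 2) (coloring U 12 13) ≤ N

end Algorithm

namespace Algorithm

theorem coloring_congr {U V : Store} {a d a' d' : ℕ} (h0 : V 0 = U 0) (ha : V a = U a')
    (hd : V d 0 = U d' 0) : coloring V a d = coloring U a' d' := by
  funext j l
  rw [coloring, coloring, h0, ha, hd]

theorem coloring_nonneg (U : Store) (a d j l : ℕ) : 0 ≤ coloring U a d j l := by
  rw [coloring]; positivity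

theorem shift_neg (x : ℕ → ℕ → ℝ) (f g : ℕ → ℕ → ℝ) (c : ℝ) :
    Layout.shift x (fun j l => f j l - g j l) c = Layout.shift x (fun j l => g j l - f j l) (-c) := by
  funext j l
  simp only [Layout.shift]
  ring

/-- The two candidates computed from a kernel vector. -/
structure CandidateSpec (U V : Store) : Prop where
  good₁ : (layout U).Good (coloring V 29 30)
  good₂ : (layout U).Good (coloring V 31 32)
  den₁ : 0 < V 30 0
  den₂ : 0 < V 32 0
  potential_le : min ((layout U).potential (coloring V 29 30)) ((layout U).potential (coloring V 31 32)) ≤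
    (layout U).potential (coloring U 12 13)
  count₁ : fracCount (U 0 0) (U 0 2) (coloring V 29 30) < fracCount (U 0 0) (U 0 2) (coloring U 12 13)
  count₂ : fracCount (U 0 0) (U 0 2) (coloring V 31 32) < fracCount (U 0 0) (U 0 2) (coloring U 12 13)

theorem candidateSpec_of_direction {U V W : Store} (hU : Ready U) (hV0 : V 0 = U 0)
    (hV12 : V 12 = U 12) (hV13 : V 13 = U 13) (hW0 : W 0 = U 0) (hVs : V.Supported)
    (hWs : W.Supported) (hS : (layout U).Valid) (hx : (layout U).Good (coloring U 12 13))
    (hD : 0 < U 13 0) {b : ℕ} (hb : (layout U).Current (coloring U 12 13) b)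
    (hy : (layout U).Direction b (coloring U 12 13)
      (fun j l => (V 25 (j * U 0 2 + l) : ℝ) - V 26 (j * U 0 2 + l)))
    (hne : ∃ q < U 0 4, V 25 q ≠ V 26 q) (h₁ : Moved V W 25 26 29 30) (h₂ : Moved V W 26 25 31 32) :
    CandidateSpec U W := by
  have hc4 := hU.c4
  have hk := hU.k_pos
  have hxV : coloring V 12 13 = coloring U 12 13 := coloring_congr hV0 hV12 (by rw [hV13])
  set y : ℕ → ℕ → ℝ := fun j l => (V 25 (j * U 0 2 + l) : ℝ) - V 26 (j * U 0 2 + l) with hydef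
  -- Item sums are preserved, so a nonzero kernel vector has entries of both signs and each
  -- orientation meets a vanishing coordinate.
  have hsum : ∑ q ∈ range (U 0 4), ((V 25 q : ℝ) - V 26 q) = 0 := by
    rw [hc4, sum_range_mul]
    exact sum_eq_zero fun j hj => hy.sum_zero j (mem_range.1 hj)
  obtain ⟨q₀, hq₀, hne₀⟩ := hne
  have hne' : ∃ q ∈ range (U 0 4), (V 25 q : ℝ) - V 26 q ≠ 0 :=
    ⟨q₀, mem_range.2 hq₀, by rw [sub_ne_zero]; exact_mod_cast hne₀⟩
  have hex₂ : ∃ q < V 0 4, V 26 q < V 25 q := by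
    obtain ⟨q, hq, h⟩ := exists_pos_of_sum_zero_of_exists_nonzero _ hsum hne'
    exact ⟨q, by rw [hV0]; exact mem_range.1 hq, by exact_mod_cast sub_pos.1 h⟩
  have hex₁ : ∃ q < V 0 4, V 25 q < V 26 q := by
    obtain ⟨q, hq, h⟩ := exists_pos_of_sum_zero_of_exists_nonzero
      (fun q => (V 26 q : ℝ) - V 25 q) (by
        rw [← neg_eq_zero, ← sum_neg_distrib, ← hsum]
        exact sum_congr rfl fun q _ => by ring)
      ⟨q₀, mem_range.2 hq₀, by rw [sub_ne_zero]; exact_mod_cast hne₀.symm⟩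
    exact ⟨q, by rw [hV0]; exact mem_range.1 hq, by exact_mod_cast sub_pos.1 h⟩
  have hDV : 0 < V 13 0 := by rwa [hV13]
  obtain ⟨d₁, c₁, hc₁, e₁, q₁, hq₁, hn₁, z₁⟩ := h₁.exists_shift hVs hWs (.inl ⟨rfl, rfl⟩) (.inl rfl)
    (hW0.trans hV0.symm) hDV hex₁
  obtain ⟨d₂, c₂, hc₂, e₂, q₂, hq₂, hn₂, z₂⟩ := h₂.exists_shift hVs hWs (.inr ⟨rfl, rfl⟩) (.inr rfl)
    (hW0.trans hV0.symm) hDV hex₂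
  rw [shift_neg] at e₂
  simp only [hxV, hV0, ← hydef] at e₁ e₂ hq₁ hq₂
  have g₁ : (layout U).Good (coloring W 29 30) := by
    rw [e₁]
    exact Layout.good_shift hS hx hb hy fun j _ l _ => by rw [← e₁]; exact coloring_nonneg _ _ _ _ _
  have g₂ : (layout U).Good (coloring W 31 32) := by
    rw [e₂]
    exact Layout.good_shift hS hx hb hy fun j _ l _ => by rw [← e₂]; exact coloring_nonneg _ _ _ _ _
  have count : ∀ {a d : ℕ} {c : ℝ}, coloring W a d = Layout.shift (coloring U 12 13) y c → ∀ q < U 0 4,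
      V 25 q ≠ V 26 q → W a q = 0 →
      fracCount (U 0 0) (U 0 2) (coloring W a d) < fracCount (U 0 0) (U 0 2) (coloring U 12 13) := by
    intro a d c e q hq hn z
    rw [hc4] at hq
    have hj : q / U 0 2 < U 0 0 := Nat.div_lt_of_lt_mul (by rwa [mul_comm])
    have hdm : q / U 0 2 * U 0 2 + q % U 0 2 = q := Nat.div_add_mod' q _
    rw [e]
    refine fracCount_lt hy (j := q / U 0 2) (l := q % U 0 2) hj (Nat.mod_lt _ hk) ?_ ?_
    · simp only [hydef, hdm, sub_ne_zero]
      exact_mod_cast hn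
    · rw [← e, coloring, hW0, hdm, z, Nat.cast_zero, zero_div]
  refine ⟨g₁, g₂, d₁, d₂, ?_, count e₁ q₁ hq₁ hn₁ z₁, count e₂ q₂ hq₂ hn₂.symm z₂⟩
  rw [e₁, e₂]
  exact Layout.potential_shift_le hS hx hb hy hc₁ (neg_nonpos.2 hc₂) (e₁ ▸ g₁) (e₂ ▸ g₂)

theorem RoundSpec.run {U₀ U : Store} {N : ℕ} (hU₀ : Ready U₀) (hS₀ : (layout U₀).Valid)
    (h : RoundSpec U₀ U (N + 1)) : RoundSpec U₀ (round.run U) N := by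
  have h0 : U 0 = U₀ 0 := h.other 0 (.inl (by decide))
  have hU : Ready U := hU₀.congr h0
  have hlay : layout U = layout U₀ := layout_congr fun a ha => h.other a (by
    revert a; decide)
  have hS : (layout U).Valid := hlay ▸ hS₀
  have hx : (layout U).Good (coloring U 12 13) := hlay ▸ h.good
  have hc4 := hU.c4
  set x := coloring U 12 13 with hxdef
  set V₁ := (fills prepare).run U with hV₁
  set V₂ := (Cmd.loop 4 leverrierStep).run V₁ with hV₂
  set V₃ := (fills candidates).run V₂ with hV₃
  set V₄ := update.run V₃ with hV₄
  have s₁ : V₁.Supported := Cmd.supported_run _ h.supported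
  have s₂ : V₂.Supported := Cmd.supported_run _ s₁
  have s₃ : V₃.Supported := Cmd.supported_run _ s₂
  have s₄ : V₄.Supported := Cmd.supported_run _ s₃
  have p := prepare_spec hU hS hx h.den_pos
  rw [← hV₁] at p
  have z₁ : V₁ 0 = U 0 := p.other 0 (by decide)
  have q₂ : LeverrierSpec V₁ V₂ (V₁ 0 4) := LeverrierSpec.iterate (hU.congr z₁) p.counter p.zero
    (by rw [z₁]; exact p.identity) le_rfl
  have z₂ : V₂ 0 = U 0 := (q₂.other 0 (by decide)).trans z₁
  obtain ⟨o₃, m₁, m₂⟩ := candidates_spec (hU.congr z₂)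
  rw [← hV₃] at o₃ m₁ m₂
  have z₃ : V₃ 0 = U 0 := (o₃ 0 (by decide)).trans z₂
  obtain ⟨o₄, u₁, u₂, u₃⟩ := update_spec (hU.congr z₃) s₃
  rw [← hV₄] at o₄ u₁ u₂ u₃
  have o₅ := (run_fills ordered_clear V₄).1
  have hround : round.run U = (fills clear).run V₄ := rfl
  have keep₃ : ∀ a, a < 14 ∨ a = 33 ∨ a = 34 ∨ 36 < a → V₃ a = U a := by
    intro a ha
    rw [o₃ a (by simp only [List.mem_cons, List.not_mem_nil, or_false]; omega),
      q₂.other a (by simp only [List.mem_cons, List.not_mem_nil, or_false]; omega),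
      p.other a (by simp only [List.mem_cons, List.not_mem_nil, or_false]; omega)]
  have keep₅ : ∀ a, a < 14 ∨ a = 33 ∨ a = 34 ∨ 36 < a → round.run U a = V₄ a := by
    intro a ha
    rw [hround, o₅ a]
    intro q hq
    have : ∀ q ∈ clear, ¬ (q.target < 14 ∨ q.target = 33 ∨ q.target = 34 ∨ 36 < q.target) := by decide
    exact fun he => this q hq (he ▸ ha)
  have hany : V₃ 36 0 = V₁ 36 0 := by rw [o₃ 36 (by decide), q₂.other 36 (by decide)]
  have other : ∀ a, a < 12 ∨ a = 33 ∨ a = 34 ∨ 36 < a → round.run U a = U₀ a := by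
    intro a ha
    rw [keep₅ a (by omega), o₄ a (by simp only [List.mem_cons, List.not_mem_nil, or_false]; omega),
      keep₃ a (by omega), h.other a ha]
  have sup : (round.run U).Supported := Cmd.supported_run _ h.supported
  have f0 : round.run U 0 = V₃ 0 := (other 0 (.inl (by decide))).trans (h0.symm.trans z₃.symm)
  have f12 := keep₅ 12 (.inl (by decide))
  have f13 := keep₅ 13 (.inl (by decide))
  have hpot := h.potential_le
  have hcount := h.count
  by_cases hfrac : ∃ j < U 0 0, ∃ l < U 0 2, Layout.Frac x j l
  · have hcur := p.current hfrac
    have hco := p.coords hcur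
    have hale := hco.alive_le hS
    have hact := hco.act_le
    have hNV : V₁ 0 4 = U 0 0 * U 0 2 := by rw [z₁, hc4]
    have hMg : storedMatrix (U 0 0 * U 0 2) (V₁ 18) = Matrix.of fun q q' : Fin (U 0 0 * U 0 2) =>
        (gram (U 0 2) (U 0 1) (V₁ 15) (fun i l => V₁ 17 (i * U 0 2 + l))
          (fun i j l => V₁ 16 ((i * U 0 0 + j) * U 0 2 + l)) q q' : ℝ) := by
      ext q q'
      have := p.gram q (by rw [hc4]; exact q.2) q' (by rw [hc4]; exact q'.2)
      rw [hc4] at this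
      simp only [storedMatrix, Matrix.of_apply, this]
    have hsymm : (storedMatrix (U 0 0 * U 0 2) (V₁ 18)).IsSymm := hMg ▸ isSymm_gram hale hact
    obtain ⟨z, hz, hzr⟩ := Layout.exists_kernel hS hx hcur hco
    have hzM : (storedMatrix (U 0 0 * U 0 2) (V₁ 18)).mulVec z = 0 := by
      rw [hMg]; exact (gram_mulVec_eq_zero hale hact z).2 hzr
    obtain ⟨j₀, hj₀, l₀, hl₀, hf₀⟩ := hfrac
    have hpos : 0 < U 0 0 * U 0 2 := Nat.mul_pos (by omega) (by omega)
    rw [hNV] at q₂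
    obtain ⟨hker, hne⟩ := q₂.mulVec_eq_zero hNV hpos hsymm hz hzM
    rw [hMg] at hker
    have hdir := Layout.direction_of_kernel (y := fun q => (V₂ 25 q : ℝ) - V₂ 26 q) hS hco
      ((gram_mulVec_eq_zero hale hact _).1 hker)
    have hcand : CandidateSpec U V₃ := candidateSpec_of_direction hU z₂
      ((q₂.other 12 (by decide)).trans (p.other 12 (by decide)))
      ((q₂.other 13 (by decide)).trans (p.other 13 (by decide))) z₃ s₂ s₃ hS hx h.den_pos hcur hdir
      (by rwa [hc4]) m₁ m₂
    have hany' : V₃ 36 0 ≠ 0 := by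
      rw [hany, p.anyAlive, hc4]
      obtain ⟨⟨j, hj, l, hl, hc⟩, -⟩ := hcur
      refine (sum_pos' (fun _ _ => Nat.zero_le _) ⟨_, mem_range.2 (index_lt hj hl), ?_⟩).ne'
      have := hco.alive_eq j hj l hl
      rw [if_pos hc] at this
      exact this ▸ Nat.one_pos
    have hlay₃ : layout V₃ = layout U := layout_congr fun a ha => keep₃ a (by revert a; decide)
    have ev₁ := eval_potentialExpr (U := V₃) (hlay₃ ▸ hS) (a := 29) (d := 30) (hlay₃ ▸ hcand.good₁) 0
    have ev₂ := eval_potentialExpr (U := V₃) (hlay₃ ▸ hS) (a := 31) (d := 32) (hlay₃ ▸ hcand.good₂) 0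
    rw [hlay₃] at ev₁ ev₂
    have hmin := hcand.potential_le
    by_cases hle : (potentialExpr 29 30).eval V₃ 0 ≤ (potentialExpr 31 32).eval V₃ 0
    · obtain ⟨e12, e13⟩ := u₂ hany' hle
      have e : coloring (round.run U) 12 13 = coloring V₃ 29 30 :=
        coloring_congr f0 (f12.trans e12) (by rw [f13, e13])
      refine ⟨other, sup, ?_, by rw [f13, e13]; exact hcand.den₁, ?_, ?_⟩
      · rw [e, ← hlay]; exact hcand.good₁
      · rw [ev₁, ev₂] at hle
        rw [min_eq_left hle] at hmin
        rw [e, ← hlay]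
        rw [← hlay] at hpot
        exact hmin.trans hpot
      · rw [e, ← h0]
        have := hcand.count₁
        rw [← h0] at hcount
        omega
    · obtain ⟨e12, e13⟩ := u₃ hany' hle
      have e : coloring (round.run U) 12 13 = coloring V₃ 31 32 :=
        coloring_congr f0 (f12.trans e12) (by rw [f13, e13])
      refine ⟨other, sup, ?_, by rw [f13, e13]; exact hcand.den₂, ?_, ?_⟩
      · rw [e, ← hlay]; exact hcand.good₂
      · rw [ev₁, ev₂] at hle
        rw [min_eq_right (not_le.1 hle).le] at hmin
        rw [e, ← hlay]
        rw [← hlay] at hpot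
        exact hmin.trans hpot
      · rw [e, ← h0]
        have := hcand.count₂
        rw [← h0] at hcount
        omega
  -- Once everything is rounded, `anyAlive` is zero and the remaining rounds keep the colouring.
  · have hnone : ∀ j < U 0 0, ∀ l < U 0 2, ¬ Layout.Frac x j l := fun j hj l hl hf =>
      hfrac ⟨j, hj, l, hl, hf⟩
    obtain ⟨e12, e13⟩ := u₁ (by rw [hany]; exact p.none hnone)
    have e : coloring (round.run U) 12 13 = x := coloring_congr (f0.trans z₃)
      ((f12.trans e12).trans (keep₃ 12 (by omega))) (by rw [f13, e13, keep₃ 13 (by omega)])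
    refine ⟨other, sup, e ▸ h.good, by rw [f13, e13, keep₃ 13 (by omega)]; exact h.den_pos,
      e ▸ hpot, ?_⟩
    classical
    rw [e, fracCount, filter_eq_empty_iff.2, card_empty]
    · exact Nat.zero_le _
    · intro q hq hf
      rw [mem_range, ← h0] at hq
      rw [← h0] at hf
      exact hnone _ (Nat.div_lt_of_lt_mul (by rwa [mul_comm])) _ (Nat.mod_lt _ hU.k_pos) hf

theorem RoundSpec.iterate {U : Store} (hU : Ready U) (hS : (layout U).Valid) (hsup : U.Supported)
    (hx : (layout U).Good (coloring U 12 13)) (hD : 0 < U 13 0) {i : ℕ} (hi : i ≤ U 0 4) :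
    RoundSpec U (round.run^[i] U) (U 0 4 - i) := by
  classical
  induction i with
  | zero =>
    refine ⟨fun _ _ => rfl, hsup, hx, hD, le_rfl, ?_⟩
    refine (Finset.card_le_card (filter_subset _ _)).trans ?_
    rw [card_range, hU.c4, Nat.sub_zero]
  | succ i ih =>
    rw [Function.iterate_succ_apply']
    have := ih (by omega)
    rw [show U 0 4 - i = U 0 4 - (i + 1) + 1 by omega] at this
    exact this.run hU hS

theorem RoundSpec.not_frac {U₀ U : Store} (h : RoundSpec U₀ U 0) {j l : ℕ} (hj : j < U₀ 0 0)
    (hl : l < U₀ 0 2) : ¬ Layout.Frac (coloring U 12 13) j l := by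
  classical
  intro hf
  have h1 := Nat.le_zero.1 h.count
  rw [fracCount, card_eq_zero, filter_eq_empty_iff] at h1
  refine h1 (mem_range.2 (index_lt hj hl)) ?_
  rwa [index_div hl, index_mod hl]

end Algorithm

/-! ### Bit lengths -/

theorem Store.Bounded.mono {Q R : ℕ} (h : Q ≤ R) {U : Store} (hU : U.Bounded Q) : U.Bounded R :=
  ⟨fun a i => (hU.1 a i).trans h, fun i => (hU.2 i).trans h⟩

theorem size_le_of_le_two_pow {x s : ℕ} (h : x ≤ 2 ^ s) : x.size ≤ s + 1 :=
  Nat.size_le.2 (h.trans_lt (Nat.pow_lt_pow_right (by decide) (Nat.lt_succ_self s)))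

theorem le_two_pow_of_size_le {x s : ℕ} (h : x.size ≤ s) : x ≤ 2 ^ s := (Nat.size_le.1 h).le

namespace Cmd

theorem Safe.mono {Q R : ℕ} (h : Q ≤ R) {b : Cmd} {U : Store} (hU : b.Safe Q U) : b.Safe R U := by
  induction b generalizing U with
  | skip => trivial
  | fill a ha e => exact Store.Bounded.mono h hU
  | seq b₁ b₂ h1 h2 => exact ⟨h1 hU.1, h2 hU.2⟩
  | loop c b ih => exact ⟨hU.1.mono h, fun i hi => ih (hU.2 i hi)⟩

def LoopFree : Cmd → Prop
  | skip => True
  | fill _ _ _ => True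
  | seq b₁ b₂ => b₁.LoopFree ∧ b₂.LoopFree
  | loop _ _ => False

/-- A bound for the binary lengths that a loop-free command produces. -/
def growth : Cmd → ℕ → ℕ
  | skip, Q => Q
  | fill _ _ e, Q => Q + e.sizeBound Q
  | seq b₁ b₂, Q => b₂.growth (b₁.growth Q)
  | loop _ _, Q => Q

theorem polyBounded_growth (b : Cmd) : PolyBounded b.growth := by
  induction b with
  | skip => exact .id
  | fill a ha e => exact PolyBounded.id.add e.polyBounded_sizeBound
  | seq b₁ b₂ h1 h2 => exact h2.comp h1
  | loop c b ih => exact .id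

theorem le_growth (b : Cmd) (Q : ℕ) : Q ≤ b.growth Q := by
  induction b generalizing Q with
  | skip => exact le_rfl
  | fill a ha e => exact Nat.le_add_right _ _
  | seq b₁ b₂ h1 h2 => exact (h1 Q).trans (h2 _)
  | loop c b ih => exact le_rfl

/-- A fixed number of fills composes finitely many polynomials. Iterating `growth` along a loop
would not stay polynomial, so the three loops get their own size invariants. -/
theorem LoopFree.safe {b : Cmd} (hb : b.LoopFree) {Q : ℕ} {U : Store} (hU : U.Bounded Q) :
    b.Safe (b.growth Q) U ∧ (b.run U).Bounded (b.growth Q) := by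
  induction b generalizing Q U with
  | skip => exact ⟨trivial, hU⟩
  | fill a ha e =>
    refine ⟨hU.mono (Nat.le_add_right _ _), fun a' i => ?_, fun i => ?_⟩
    · by_cases h : a' = a
      · subst h
        simp only [run, Function.update_self]
        split_ifs with hi
        · exact (e.size_eval_le hU (bounded_update (fun _ => Nat.zero_le _)
            (hi.le.trans (hU.2 _)))).trans (Nat.le_add_left _ _)
        · simp
      · simp only [run, Function.update_of_ne h]
        exact (hU.1 a' i).trans (Nat.le_add_right _ _)
    · simp only [run, Function.update_of_ne ha.symm]
      exact (hU.2 i).trans (Nat.le_add_right _ _)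
  | seq b₁ b₂ h1 h2 =>
    obtain ⟨s1, B1⟩ := h1 hb.1 hU
    obtain ⟨s2, B2⟩ := h2 hb.2 B1
    exact ⟨⟨s1.mono (le_growth b₂ _), s2⟩, B2⟩
  | loop c b ih => exact hb.elim

theorem loopFree_fills (l : List Assign) : (fills l).LoopFree := by
  induction l with
  | nil => trivial
  | cons p l ih => exact ⟨trivial, ih⟩

end Cmd

namespace Algorithm

theorem loop_classify_safe {Q : ℕ} {U : Store} (hU : U.Bounded Q) (hsup : U.Supported) (h7 : U 0 7 = 1)
    (h10 : ∀ j, U 10 j = 0) (h11 : U 11 0 = 0) :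
    (Cmd.loop 0 classify).Safe (classify.growth Q) U ∧ ((Cmd.loop 0 classify).run U).Bounded Q := by
  have hb : ∀ i ≤ U 0 0, (classify.run^[i] U).Bounded Q := by
    intro i hi
    have h := ClassSpec.iterate h7 h10 h11 hi
    have hs := Cmd.iterate_supported classify hsup i
    refine ⟨fun a q => ?_, fun q => by rw [Cmd.iterate_run_zero]; exact hU.2 q⟩
    by_cases h1 : a = 10
    · subst h1
      exact size_le_of_le ((h.lt q).trans (hU.2 0))
    by_cases h2 : a = 11
    · subst h2
      rcases Nat.eq_zero_or_pos q with rfl | hq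
      · exact size_le_of_le (h.counter.le.trans (hi.trans (hU.2 0)))
      · rw [hs 11 (by decide) q (by
          rw [Cmd.iterate_run_zero]; exact h7.le.trans hq)]
        simp
    rw [h.other a h1 h2]
    exact hU.1 a q
  exact ⟨⟨hU.mono (Cmd.le_growth _ _), fun i hi =>
    (Cmd.LoopFree.safe (b := classify) ⟨trivial, trivial⟩ (hb i hi.le)).1⟩, hb _ le_rfl⟩

/-- The bits that one step of the recursion adds. -/
def stepBits (Q μ : ℕ) : ℕ := 1 + 2 * Q + μ

/-- The sizes of the arrays after `i` steps of the recursion. -/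
structure LeverrierBound (s R i : ℕ) (V : Store) : Prop where
  supported : V.Supported
  mat₁ : ∀ q, V 19 q ≤ 2 ^ (s * i)
  mat₂ : ∀ q, V 20 q ≤ 2 ^ (s * i)
  vec₁ : ∀ q, V 25 q ≤ 2 ^ (s * i)
  vec₂ : ∀ q, V 26 q ≤ 2 ^ (s * i)
  rest : ∀ a ∈ ([21, 22, 24] : List ℕ), ∀ q, (V a q).size ≤ R

/-- The scaled product and the trace are each at most `N ^ 2 * 2 ^ μ * 2 ^ (s * i)` with `N ≤ 2 ^
Q`; adding the two costs one more bit. This explains `stepBits`. -/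
theorem LeverrierBound.run {Q μ R i : ℕ} {V : Store} (hV : Ready V) (hN : V 0 4 ≤ Q)
    (hμ : ∀ q, V 18 q ≤ 2 ^ μ) (hR : stepBits Q μ * Q + 1 ≤ R) (hi : i < V 0 4) (hc : V 23 0 = i)
    (h : LeverrierBound (stepBits Q μ) R i V) :
    LeverrierBound (stepBits Q μ) R (i + 1) (leverrierStep.run V) := by
  have st := leverrierStep_spec hV
  have hW0 : leverrierStep.run V 0 = V 0 := Cmd.run_zero _ _
  have hsup := Cmd.supported_run leverrierStep h.supported
  set W := leverrierStep.run V
  set N := V 0 4 with hNdef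
  set s := stepBits Q μ with hs
  have hN2 : N ≤ 2 ^ Q := hN.trans Nat.lt_two_pow_self.le
  have hmono : 2 ^ (s * i) ≤ 2 ^ (s * (i + 1)) :=
    Nat.pow_le_pow_right (by decide) (Nat.mul_le_mul_left _ (Nat.le_succ i))
  have hhalf : N * (N * (2 ^ μ * 2 ^ (s * i))) + N * (N * (2 ^ μ * 2 ^ (s * i))) ≤ 2 ^ (s * (i + 1)) := by
    have : 2 ^ (s * (i + 1)) = 2 ^ Q * (2 ^ Q * (2 ^ μ * 2 ^ (s * i))) +
        2 ^ Q * (2 ^ Q * (2 ^ μ * 2 ^ (s * i))) := by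
      rw [hs, stepBits, mul_add, mul_one, pow_add, pow_add, pow_add, two_mul, pow_add]
      ring
    rw [this]
    have := Nat.mul_le_mul hN2 (Nat.mul_le_mul_right (2 ^ μ * 2 ^ (s * i)) hN2)
    omega
  have htr : ∀ B : ℕ → ℕ, (∀ q, B q ≤ 2 ^ (s * i)) →
      traceMul N (V 18) B ≤ N * (N * (2 ^ μ * 2 ^ (s * i))) := by
    intro B hB
    refine (sum_le_card_nsmul _ _ (N * (2 ^ μ * 2 ^ (s * i))) fun q _ => ?_).trans (by simp)
    exact (sum_le_card_nsmul _ _ (2 ^ μ * 2 ^ (s * i)) fun p _ =>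
      Nat.mul_le_mul (hμ _) (hB _)).trans (by simp)
  have hrow : ∀ B : ℕ → ℕ, (∀ q, B q ≤ 2 ^ (s * i)) → ∀ q q',
      (V 23 0 + 1) * ∑ p ∈ range N, V 18 (q * N + p) * B (p * N + q') ≤
        N * (N * (2 ^ μ * 2 ^ (s * i))) := by
    intro B hB q q'
    refine Nat.mul_le_mul (by omega) ?_
    exact (sum_le_card_nsmul _ _ (2 ^ μ * 2 ^ (s * i)) fun p _ =>
      Nat.mul_le_mul (hμ _) (hB _)).trans (by simp)
  have hind : ∀ (P : Prop) [Decidable P] (x : ℕ), (if P then 1 else 0) * x ≤ x := fun P _ x => by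
    split_ifs <;> simp
  have hentry : ∀ a, a ≠ 0 → lengthCell a = 5 → (∀ q < N, ∀ q' < N, W a (q * N + q') ≤ 2 ^ (s * (i + 1))) →
      ∀ q, W a q ≤ 2 ^ (s * (i + 1)) := by
    intro a ha hl h q
    rcases lt_or_ge q (N * N) with hq | hq
    · have := h (q / N) (Nat.div_lt_of_lt_mul hq) (q % N) (Nat.mod_lt _ (by omega))
      rwa [Nat.div_add_mod'] at this
    · rw [hsup a ha q (by rw [hl, hW0, hV.c5]; exact hq)]
      exact Nat.zero_le _
  have hvec : ∀ a, a ≠ 0 → lengthCell a = 4 → (∀ q < N, W a q ≤ 2 ^ (s * (i + 1))) →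
      ∀ q, W a q ≤ 2 ^ (s * (i + 1)) := by
    intro a ha hl h q
    rcases lt_or_ge q N with hq | hq
    · exact h q hq
    · rw [hsup a ha q (by rw [hl, hW0]; exact hq)]
      exact Nat.zero_le _
  refine ⟨hsup, hentry 19 (by decide) rfl fun q hq q' hq' => ?_,
    hentry 20 (by decide) rfl fun q hq q' hq' => ?_, hvec 25 (by decide) rfl fun q hq => ?_,
    hvec 26 (by decide) rfl fun q hq => ?_, fun a ha q => ?_⟩
  · rw [st.mat₁ q hq q' hq']
    exact (Nat.add_le_add (hrow _ h.mat₁ q q') ((hind _ _).trans (htr _ h.mat₂))).trans hhalf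
  · rw [st.mat₂ q hq q' hq']
    exact (Nat.add_le_add (hrow _ h.mat₂ q q') ((hind _ _).trans (htr _ h.mat₁))).trans hhalf
  · rw [st.vec₁ q hq]
    split_ifs
    · exact (h.mat₁ _).trans hmono
    · exact (h.vec₁ _).trans hmono
  · rw [st.vec₂ q hq]
    split_ifs
    · exact (h.mat₂ _).trans hmono
    · exact (h.vec₂ _).trans hmono
  · have hpow : 2 ^ (s * (i + 1)) ≤ 2 ^ (s * Q) :=
      Nat.pow_le_pow_right (by decide) (Nat.mul_le_mul_left _ (by omega))
    have hlen : lengthCell a = 7 := by revert a; decide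
    have ha0 : a ≠ 0 := by revert a; decide
    rcases Nat.eq_zero_or_pos q with rfl | hq
    · have : W a 0 ≤ 2 ^ (s * Q) := by
        simp only [List.mem_cons, List.not_mem_nil, or_false] at ha
        rcases ha with rfl | rfl | rfl
        · rw [st.trace₁]; exact (htr _ h.mat₁).trans ((by omega : _ ≤ _).trans hpow)
        · rw [st.trace₂]; exact (htr _ h.mat₂).trans ((by omega : _ ≤ _).trans hpow)
        · rw [st.column]
          refine (firstIndex_le _ _).trans (hN.trans (Nat.lt_two_pow_self.le.trans ?_))
          refine Nat.pow_le_pow_right (by decide) (Nat.le_mul_of_pos_left _ ?_)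
          rw [hs, stepBits]; omega
      exact (size_le_of_le_two_pow this).trans hR
    · rw [hsup a ha0 q (by rw [hlen, hW0, hV.c7]; exact hq)]
      simp

theorem loop_leverrier_safe {Q Q' μ R : ℕ} {U : Store} (hU : Ready U) (hB : U.Bounded Q')
    (hsup : U.Supported) (hN : U 0 4 ≤ Q) (hμ : ∀ q, U 18 q ≤ 2 ^ μ)
    (hR : stepBits Q μ * Q + 1 + Q' ≤ R) (hQ : Q ≤ R) (h23 : U 23 0 = 0) (h20 : ∀ q, U 20 q = 0)
    (h19 : ∀ q < U 0 4, ∀ q' < U 0 4, U 19 (q * U 0 4 + q') = if q = q' then 1 else 0)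
    (h25 : ∀ q, U 25 q = 0) (h26 : ∀ q, U 26 q = 0) :
    (Cmd.loop 4 leverrierStep).Safe (leverrierStep.growth R) U ∧
    ((Cmd.loop 4 leverrierStep).run U).Bounded R ∧
    ∀ q, (Cmd.loop 4 leverrierStep).run U 25 q ≤ 2 ^ (stepBits Q μ * Q) ∧
      (Cmd.loop 4 leverrierStep).run U 26 q ≤ 2 ^ (stepBits Q μ * Q) := by
  have hspec : ∀ i ≤ U 0 4, LeverrierSpec U (leverrierStep.run^[i] U) i := fun i hi =>
    LeverrierSpec.iterate hU h23 h20 h19 hi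
  have hbound : ∀ i ≤ U 0 4, LeverrierBound (stepBits Q μ) R i (leverrierStep.run^[i] U) := by
    intro i
    induction i with
    | zero =>
      intro _
      refine ⟨hsup, fun q => ?_, fun q => by simp [h20], fun q => by simp [h25],
        fun q => by simp [h26], fun a _ q => (hB.1 a q).trans (by omega)⟩
      rw [mul_zero, pow_zero]
      rcases lt_or_ge q (U 0 4 * U 0 4) with hq | hq
      · have hpos : 0 < U 0 4 := Nat.pos_of_ne_zero fun h0 => by rw [h0] at hq; omega
        have := h19 (q / U 0 4) (Nat.div_lt_of_lt_mul hq) (q % U 0 4) (Nat.mod_lt _ hpos)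
        rw [Nat.div_add_mod'] at this
        exact this.le.trans (indicator_le_one _)
      · exact (hsup 19 (by decide) q (by rw [← hU.c5] at hq; exact hq)).le.trans (Nat.zero_le 1)
    | succ i ih =>
      intro hi
      have hsp := hspec i (by omega)
      have h0 : (leverrierStep.run^[i] U) 0 = U 0 := hsp.other 0 (by decide)
      rw [Function.iterate_succ_apply']
      refine (ih (by omega)).run (hU.congr h0) (by rwa [h0]) ?_ (by omega)
        (by rw [h0]; omega) hsp.counter
      intro q
      rw [hsp.other 18 (by decide)]
      exact hμ q
  have hpow : ∀ i ≤ U 0 4, 2 ^ (stepBits Q μ * i) ≤ 2 ^ (stepBits Q μ * Q) := fun i hi =>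
    Nat.pow_le_pow_right (by decide) (Nat.mul_le_mul_left _ (hi.trans hN))
  have hb : ∀ i ≤ U 0 4, (leverrierStep.run^[i] U).Bounded R := by
    intro i hi
    have hsp := hspec i hi
    have hbd := hbound i hi
    have hsz : ∀ x, x ≤ 2 ^ (stepBits Q μ * i) → x.size ≤ R := fun x hx =>
      (size_le_of_le_two_pow (hx.trans (hpow i hi))).trans (by omega)
    refine ⟨fun a q => ?_, fun q => by rw [Cmd.iterate_run_zero]; exact (hB.2 q).trans (by omega)⟩
    by_cases ha : a ∈ ([19, 20, 21, 22, 23, 24, 25, 26] : List ℕ)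
    · simp only [List.mem_cons, List.not_mem_nil, or_false] at ha
      rcases ha with rfl | rfl | rfl | rfl | rfl | rfl | rfl | rfl
      · exact hsz _ (hbd.mat₁ q)
      · exact hsz _ (hbd.mat₂ q)
      · exact hbd.rest _ (by decide) q
      · exact hbd.rest _ (by decide) q
      · rcases Nat.eq_zero_or_pos q with rfl | hq
        · exact size_le_of_le (hsp.counter.le.trans (hi.trans (hN.trans hQ)))
        · rw [hbd.supported 23 (by decide) q (by
            rw [hsp.other 0 (by decide)]; exact hU.c7.le.trans hq)]
          simp
      · exact hbd.rest _ (by decide) q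
      · exact hsz _ (hbd.vec₁ q)
      · exact hsz _ (hbd.vec₂ q)
    · rw [hsp.other a ha]
      exact (hB.1 a q).trans (by omega)
  exact ⟨⟨(hb 0 (Nat.zero_le _)).mono (Cmd.le_growth _ _), fun i hi =>
    (Cmd.LoopFree.safe (b := leverrierStep) ⟨Cmd.loopFree_fills _, trivial, trivial, trivial, trivial, trivial⟩
      (hb i hi.le)).1⟩, hb _ le_rfl, fun q =>
    ⟨((hbound _ le_rfl).vec₁ q).trans (hpow _ le_rfl), ((hbound _ le_rfl).vec₂ q).trans (hpow _ le_rfl)⟩⟩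

end Algorithm

/-! ### Bit lengths over all rounds -/

namespace Algorithm

/-- A bound for the binary lengths of the entries of the Gram matrices. -/
def gramBits (Q : ℕ) : ℕ := Q + 2 * (Q + Q * Q) + 2

theorem gram_bound {n m k E Q : ℕ} (hn : n ≤ Q) (hm : m ≤ Q) (hk : k ≤ Q) (hE : E ≤ Q) :
    2 + m * (E * k ^ n) ^ 2 ≤ 2 ^ gramBits Q := by
  have hQ : Q ≤ 2 ^ Q := Nat.lt_two_pow_self.le
  have hkn : k ^ n ≤ 2 ^ (Q * Q) := by
    rw [pow_mul]
    exact (Nat.pow_le_pow_left (hk.trans hQ) n).trans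
      (Nat.pow_le_pow_right (Nat.two_pow_pos Q) hn)
  have h1 : m * (E * k ^ n) ^ 2 ≤ 2 ^ (Q + 2 * (Q + Q * Q)) := by
    rw [pow_add, mul_comm 2 (Q + Q * Q), pow_mul, pow_add 2 Q (Q * Q)]
    exact Nat.mul_le_mul (hm.trans hQ) (Nat.pow_le_pow_left (Nat.mul_le_mul (hE.trans hQ) hkn) 2)
  have h2 : 1 ≤ 2 ^ (Q + 2 * (Q + Q * Q)) := Nat.one_le_two_pow
  rw [gramBits, pow_add 2 _ 2]
  omega

/-- A bound for the binary lengths of the kernel vectors. -/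
def kernelBits (Q : ℕ) : ℕ := stepBits Q (gramBits Q) * Q

/-- A bound for all binary lengths within one rounding step, when the colouring has at most `s` bits
and the other data at most `Q` bits. -/
def loopBits (Q s : ℕ) : ℕ := (fills prepare).growth (Q + s) + kernelBits Q + 1

def roundBits (Q s : ℕ) : ℕ := leverrierStep.growth (loopBits Q s) +
  (fills clear).growth (update.growth ((fills candidates).growth (loopBits Q s)))

/-- All arrays except those of the colouring are small. -/
def CleanBound (Q : ℕ) (U : Store) : Prop :=
  (∀ a, a ≠ 12 → a ≠ 13 → ∀ q, (U a q).size ≤ Q) ∧ ∀ q, U 0 q ≤ Q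

theorem Moved.size_le {U V : Store} {p r a d s y : ℕ} (h : Moved U V p r a d) (hV : V.Supported)
    (h0 : V 0 = U 0) (ha : a ≠ 0 ∧ lengthCell a = 4)
    (h12 : ∀ q, (U 12 q).size ≤ s) (h13 : (U 13 0).size ≤ s) (hp : ∀ q, U p q ≤ 2 ^ y)
    (hr : ∀ q, U r q ≤ 2 ^ y) :
    (∀ q, (V a q).size ≤ s + y + 2) ∧ (V d 0).size ≤ s + y + 2 := by
  have hs : ∀ q, U 12 q ≤ 2 ^ s := fun q => le_two_pow_of_size_le (h12 q)
  have hpow : 2 ^ (s + y + 1) = 2 ^ s * 2 ^ y + 2 ^ s * 2 ^ y := by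
    rw [pow_succ, pow_add]; ring
  constructor
  · intro q
    rcases lt_or_ge q (U 0 4) with hq | hq
    · refine size_le_of_le_two_pow ?_
      rw [h.num q hq, hpow]
      exact (Nat.sub_le _ _).trans (Nat.add_le_add
        (Nat.mul_le_mul (hs _) ((Nat.sub_le _ _).trans (hr _))) (Nat.mul_le_mul (hs _) (hp _)))
    · rw [hV a ha.1 q (by rw [ha.2, h0]; exact hq)]
      simp
  · refine size_le_of_le_two_pow ?_
    rw [h.den, hpow]
    exact (Nat.mul_le_mul (le_two_pow_of_size_le h13) ((Nat.sub_le _ _).trans (hr _))).trans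
      (Nat.le_add_left _ _)

theorem run_round_eq_zero (U : Store) {a : ℕ} (h : 14 ≤ a) (h' : a ≤ 36) (h33 : a ≠ 33) (h34 : a ≠ 34) :
    round.run U a = 0 := by
  have hmem : ∃ p ∈ clear, p.target = a ∧ p.expr = 0 := by
    simp only [clear, List.mem_cons, List.not_mem_nil, or_false, exists_eq_or_imp, exists_eq_left,
      and_true]
    omega
  obtain ⟨p, hp, rfl, he⟩ := hmem
  refine ((run_fills ordered_clear _).2 p hp).trans ?_
  funext q
  rw [he]
  exact ite_self _

/-- The length of the kernel vector depends on `Q` alone, so the colouring gains `kernelBits Q + 2`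
bits whatever `s` is. The much larger `roundBits` concerns only intermediate results, which are then
cleared. -/
theorem round_safe {U₀ U : Store} {N Q s : ℕ} (hU₀ : Ready U₀) (hS₀ : (layout U₀).Valid)
    (h : RoundSpec U₀ U N) (hc : CleanBound Q U) (h12 : ∀ q, (U 12 q).size ≤ s)
    (h13 : ∀ q, (U 13 q).size ≤ s) :
    round.Safe (roundBits Q s) U ∧
    (∀ q, (round.run U 12 q).size ≤ s + kernelBits Q + 2) ∧
    (∀ q, (round.run U 13 q).size ≤ s + kernelBits Q + 2) ∧
    ∀ a, 14 ≤ a → a ≤ 36 → a ≠ 33 → a ≠ 34 → round.run U a = 0 := by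
  have h0 : U 0 = U₀ 0 := h.other 0 (.inl (by decide))
  have hU : Ready U := hU₀.congr h0
  have hlay : layout U = layout U₀ := layout_congr fun a ha => h.other a (by
    revert a; decide)
  have hS : (layout U).Valid := hlay ▸ hS₀
  have hx : (layout U).Good (coloring U 12 13) := hlay ▸ h.good
  have b₀ : U.Bounded (Q + s) := by
    refine ⟨fun a q => ?_, fun q => (hc.2 q).trans (Nat.le_add_right _ _)⟩
    by_cases h1 : a = 12
    · subst h1; exact (h12 q).trans (Nat.le_add_left _ _)
    by_cases h2 : a = 13
    · subst h2; exact (h13 q).trans (Nat.le_add_left _ _)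
    exact (hc.1 a h1 h2 q).trans (Nat.le_add_right _ _)
  have p := prepare_spec hU hS hx h.den_pos
  obtain ⟨t₁, b₁⟩ := (Cmd.loopFree_fills prepare).safe b₀
  have s₁ : ((fills prepare).run U).Supported := Cmd.supported_run _ h.supported
  set V₁ := (fills prepare).run U with hV₁
  have z₁ : V₁ 0 = U 0 := p.other 0 (by decide)
  have hQ : Q ≤ loopBits Q s :=
    (Nat.le_add_right Q s).trans ((Cmd.le_growth (fills prepare) (Q + s)).trans (by rw [loopBits]; omega))
  have q₂ : LeverrierSpec V₁ ((Cmd.loop 4 leverrierStep).run V₁) (V₁ 0 4) :=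
    LeverrierSpec.iterate (hU.congr z₁) p.counter p.zero (by rw [z₁]; exact p.identity) le_rfl
  obtain ⟨t₂, b₂, y₂⟩ := loop_leverrier_safe (R := loopBits Q s) (hU.congr z₁) b₁ s₁
    (by rw [z₁]; exact hc.2 4)
    (fun q => (p.gram_le q).trans (gram_bound (hc.2 0) (hc.2 1) (hc.2 2) (hc.2 3)))
    (by rw [loopBits, kernelBits]; omega) hQ p.counter p.zero (by rw [z₁]; exact p.identity)
    p.pos_zero p.neg_zero
  have s₂ : ((Cmd.loop 4 leverrierStep).run V₁).Supported := Cmd.supported_run _ s₁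
  set V₂ := (Cmd.loop 4 leverrierStep).run V₁ with hV₂
  have z₂ : V₂ 0 = U 0 := (q₂.other 0 (by decide)).trans z₁
  obtain ⟨o₃, m₁, m₂⟩ := candidates_spec (hU.congr z₂)
  obtain ⟨t₃, b₃⟩ := (Cmd.loopFree_fills candidates).safe b₂
  have s₃ : ((fills candidates).run V₂).Supported := Cmd.supported_run _ s₂
  set V₃ := (fills candidates).run V₂ with hV₃
  have z₃ : V₃ 0 = U 0 := (o₃ 0 (by decide)).trans z₂
  obtain ⟨-, u₁, u₂, u₃⟩ := update_spec (hU.congr z₃) s₃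
  obtain ⟨t₄, b₄⟩ := Cmd.LoopFree.safe (b := update) ⟨trivial, trivial, trivial⟩ b₃
  have s₄ : (update.run V₃).Supported := Cmd.supported_run _ s₃
  have z₄ : update.run V₃ 0 = U 0 := (Cmd.run_zero _ _).trans z₃
  set V₄ := update.run V₃ with hV₄
  obtain ⟨t₅, -⟩ := (Cmd.loopFree_fills clear).safe b₄
  have o₅ := (run_fills ordered_clear V₄).1
  have g₁ := Cmd.le_growth (fills prepare) (Q + s)
  have g₃ := Cmd.le_growth (fills candidates) (loopBits Q s)
  have g₄ := Cmd.le_growth update ((fills candidates).growth (loopBits Q s))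
  have g₅ := Cmd.le_growth (fills clear) (update.growth ((fills candidates).growth (loopBits Q s)))
  have e12 : V₂ 12 = U 12 := (q₂.other 12 (by decide)).trans (p.other 12 (by decide))
  have e13 : V₂ 13 = U 13 := (q₂.other 13 (by decide)).trans (p.other 13 (by decide))
  obtain ⟨x₁, d₁⟩ := m₁.size_le s₃ (z₃.trans z₂.symm) ⟨by decide, rfl⟩ (by rwa [e12])
    (by rw [e13]; exact h13 0) (fun q => (y₂ q).1) (fun q => (y₂ q).2)
  obtain ⟨x₂, d₂⟩ := m₂.size_le s₃ (z₃.trans z₂.symm) ⟨by decide, rfl⟩ (by rwa [e12])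
    (by rw [e13]; exact h13 0) (fun q => (y₂ q).2) (fun q => (y₂ q).1)
  have key : (∀ q, (V₄ 12 q).size ≤ s + kernelBits Q + 2) ∧ (V₄ 13 0).size ≤ s + kernelBits Q + 2 := by
    by_cases hany : V₃ 36 0 = 0
    · obtain ⟨e, e'⟩ := u₁ hany
      rw [e, e', o₃ 12 (by decide), o₃ 13 (by decide), e12, e13]
      exact ⟨fun q => (h12 q).trans (by omega), (h13 0).trans (by omega)⟩
    · by_cases hle : (potentialExpr 29 30).eval V₃ 0 ≤ (potentialExpr 31 32).eval V₃ 0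
      · obtain ⟨e, e'⟩ := u₂ hany hle
        rw [e, e']
        exact ⟨x₁, d₁⟩
      · obtain ⟨e, e'⟩ := u₃ hany hle
        rw [e, e']
        exact ⟨x₂, d₂⟩
  have keep : ∀ a, a < 14 → round.run U a = V₄ a := fun a ha => o₅ a fun q hq he => by
    have : ∀ q ∈ clear, ¬ q.target < 14 := by decide
    exact this q hq (he ▸ ha)
  refine ⟨⟨t₁.mono ?_, t₂.mono ?_, t₃.mono ?_, t₄.mono ?_, t₅.mono ?_⟩, fun q => ?_, fun q => ?_,
    fun a h1 h2 h3 h4 => run_round_eq_zero U h1 h2 h3 h4⟩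
  · have : (fills prepare).growth (Q + s) ≤ loopBits Q s := by rw [loopBits]; omega
    rw [roundBits]; omega
  · rw [roundBits]; omega
  · rw [roundBits]; omega
  · rw [roundBits]; omega
  · rw [roundBits]; omega
  · rw [keep 12 (by decide)]; exact key.1 q
  · rw [keep 13 (by decide)]
    rcases Nat.eq_zero_or_pos q with rfl | hq
    · exact key.2
    · rw [s₄ 13 (by decide) q (by rw [z₄]; exact hU.c7.le.trans hq)]
      simp

end Algorithm

namespace Algorithm

/-- A bound for the binary lengths of the colouring during the whole procedure. -/
def colorBits (Q : ℕ) : ℕ := Q + Q * (kernelBits Q + 2)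

def loopRoundBits (Q : ℕ) : ℕ := roundBits Q (colorBits Q) + (Q + colorBits Q)

theorem loop_round_safe {Q : ℕ} {U : Store} (hU : Ready U) (hS : (layout U).Valid) (hsup : U.Supported)
    (hx : (layout U).Good (coloring U 12 13)) (hD : 0 < U 13 0) (hB : U.Bounded Q) :
    (Cmd.loop 4 round).Safe (loopRoundBits Q) U ∧
      ((Cmd.loop 4 round).run U).Bounded (Q + colorBits Q) := by
  have hspec : ∀ i ≤ U 0 4, RoundSpec U (round.run^[i] U) (U 0 4 - i) := fun i hi =>
    RoundSpec.iterate hU hS hsup hx hD hi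
  have hsize : ∀ i ≤ U 0 4, CleanBound Q (round.run^[i] U) ∧
      (∀ q, ((round.run^[i] U) 12 q).size ≤ Q + i * (kernelBits Q + 2)) ∧
      ∀ q, ((round.run^[i] U) 13 q).size ≤ Q + i * (kernelBits Q + 2) := by
    intro i
    induction i with
    | zero =>
      intro _
      exact ⟨⟨fun a _ _ q => hB.1 a q, hB.2⟩, fun q => by simpa using hB.1 12 q,
        fun q => by simpa using hB.1 13 q⟩
    | succ i ih =>
      intro hi
      obtain ⟨hc, h12, h13⟩ := ih (by omega)
      obtain ⟨-, g12, g13, hz⟩ := round_safe hU hS (hspec i (by omega)) hc h12 h13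
      have ho := (hspec (i + 1) hi).other
      rw [Function.iterate_succ_apply'] at ho ⊢
      refine ⟨⟨fun a h1 h2 q => ?_, fun q => ?_⟩, fun q => (g12 q).trans (by rw [add_mul]; omega),
        fun q => (g13 q).trans (by rw [add_mul]; omega)⟩
      · by_cases ha : a < 12 ∨ a = 33 ∨ a = 34 ∨ 36 < a
        · rw [ho a ha]
          exact hB.1 a q
        · rw [hz a (by omega) (by omega) (by omega) (by omega)]
          simp
      · rw [ho 0 (.inl (by decide))]
        exact hB.2 q
  have hle : ∀ i ≤ U 0 4, Q + i * (kernelBits Q + 2) ≤ colorBits Q := fun i hi =>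
    Nat.add_le_add_left (Nat.mul_le_mul_right _ (hi.trans (hB.2 4))) _
  refine ⟨⟨hB.mono (by rw [loopRoundBits]; omega), fun i hi => ?_⟩, ?_⟩
  · obtain ⟨hc, h12, h13⟩ := hsize i hi.le
    exact (round_safe hU hS (hspec i hi.le) hc (fun q => (h12 q).trans (hle i hi.le))
      (fun q => (h13 q).trans (hle i hi.le))).1.mono (Nat.le_add_right _ _)
  · obtain ⟨hc, h12, h13⟩ := hsize (U 0 4) le_rfl
    refine ⟨fun a q => ?_, fun q => (hc.2 q).trans (Nat.le_add_right _ _)⟩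
    change ((round.run^[U 0 4] U) a q).size ≤ _
    have hl := hle (U 0 4) le_rfl
    by_cases h1 : a = 12
    · subst h1; exact (h12 q).trans (by omega)
    by_cases h2 : a = 13
    · subst h2; exact (h13 q).trans (by omega)
    exact (hc.1 a h1 h2 q).trans (Nat.le_add_right _ _)

/-! ### From the initial store to the uniform colouring -/

/-- The stores on which the main part of the algorithm is started. -/
structure Initial (U : Store) : Prop where
  ready : Ready U
  supported : U.Supported
  mem_le : ∀ q, U 2 q ≤ 1
  own_lt : ∀ u < U 0 3, U 1 u < U 0 1
  zero : ∀ a, 3 ≤ a → ∀ q, U a q = 0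

/-- The store after the preparation. -/
def prepared (U : Store) : Store :=
  (fills start).run ((Cmd.loop 0 classify).run ((fills setup).run U))

structure PreparedSpec (U V : Store) : Prop where
  ready : Ready V
  zero : V 0 = U 0
  supported : V.Supported
  valid : (layout V).Valid
  uniform : ∀ j < U 0 0, ∀ l < U 0 2, coloring V 12 13 j l = 1 / U 0 2
  den_pos : 0 < V 13 0
  own : V 1 = U 1
  nonempty : ∀ u < U 0 3, V 33 u = if ∑ j ∈ range (U 0 0), U 2 (u * U 0 0 + j) = 0 then 0 else 1
  num : V 5 0 = ∑ u ∈ range (U 0 3), V 33 u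
  degree : V 6 0 = 1 + (range (U 0 0)).sup fun j => ∑ u ∈ range (U 0 3), U 2 (u * U 0 0 + j)
  root : V 8 0 = (V 6 0 * U 0 2 - 1).sqrt + 1
  cutoff : V 9 0 = U 0 2 * (2 * (V 5 0 * U 0 2).size + 2)
  member : ∀ u < U 0 3, ∀ j < U 0 0, V 4 (u * U 0 0 + j) = U 2 (u * U 0 0 + j) *
    if ∑ j' ∈ range j, U 2 (u * U 0 0 + j') < V 9 0 then 1 else 0
  big : ∀ u < U 0 3, V 34 u = if V 9 0 < ∑ j ∈ range (U 0 0), U 2 (u * U 0 0 + j) then 1 else 0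
  cls_le : ∀ j < U 0 0, V 10 j ≤ ∑ u ∈ range (U 0 3), V 4 (u * U 0 0 + j) *
    ∑ j' ∈ range (U 0 0), V 4 (u * U 0 0 + j')

def setupBits (Q : ℕ) : ℕ := (fills start).growth ((fills setup).growth Q)

theorem prepared_spec {U : Store} (h : Initial U) : PreparedSpec U (prepared U) := by
  have s := setup_spec h.ready h.mem_le
  have a0 : (fills setup).run U 0 = U 0 := Cmd.run_zero _ _
  have sA : ((fills setup).run U).Supported := Cmd.supported_run _ h.supported
  rw [prepared]
  set A := (fills setup).run U with hA
  have c : ClassSpec A ((Cmd.loop 0 classify).run A) (A 0 0) :=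
    ClassSpec.iterate (by rw [a0]; exact h.ready.c7)
      (fun j => by rw [s.other 10 (by decide)]; exact h.zero 10 (by decide) j)
      (by rw [s.other 11 (by decide)]; exact h.zero 11 (by decide) 0) le_rfl
  have sB : ((Cmd.loop 0 classify).run A).Supported := Cmd.supported_run _ sA
  set B := (Cmd.loop 0 classify).run A with hBdef
  have b0 : B 0 = U 0 := (c.other 0 (by decide) (by decide)).trans a0
  obtain ⟨o, f⟩ := run_fills ordered_start B
  have sC : ((fills start).run B).Supported := Cmd.supported_run _ sB
  set C := (fills start).run B with hC
  have keep : ∀ a, a ≠ 12 → a ≠ 13 → C a = B a := fun a h1 h2 => o a (by simp [start]; tauto)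
  have f12 : C 12 = fun q => if q < B 0 (lengthCell 12) then (1 : NatExpr).eval C (Function.update 0 0 q) else 0 :=
    f ⟨12, by decide, 1⟩ (by simp [start])
  have f13 : C 13 = fun q => if q < B 0 (lengthCell 13) then
      (NatExpr.cell 2).eval C (Function.update 0 0 q) else 0 :=
    f ⟨13, by decide, NatExpr.cell 2⟩ (by simp [start])
  have c0 : C 0 = U 0 := (keep 0 (by decide) (by decide)).trans b0
  have keepA : ∀ a, a ∉ ([10, 11, 12, 13] : List ℕ) → C a = A a := fun a ha => by
    simp only [List.mem_cons, List.not_mem_nil, or_false, not_or] at ha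
    rw [keep a ha.2.2.1 ha.2.2.2, c.other a ha.1 ha.2.1]
  simp only [lengthCell, NatExpr.eval_one, NatExpr.eval_cell, b0, c0, h.ready.c7] at f12 f13
  have h10 : C 10 = B 10 := keep 10 (by decide) (by decide)
  have h4 : C 4 = A 4 := keepA 4 (by decide)
  have h6 : C 6 = A 6 := keepA 6 (by decide)
  have h8 : C 8 = A 8 := keepA 8 (by decide)
  have hdeg : 1 ≤ C 6 0 := by rw [h6, s.degree]; omega
  have hroot : 1 ≤ C 8 0 := by rw [h8, s.root]; omega
  have d13 : C 13 0 = U 0 2 := by rw [f13]; simp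
  have hle4 : ∀ u < U 0 3, ∀ j < U 0 0, C 4 (u * U 0 0 + j) ≤ U 2 (u * U 0 0 + j) := by
    intro u hu j hj
    rw [h4, s.member u hu j hj]
    exact (Nat.mul_le_mul_left _ (indicator_le_one _)).trans (Nat.mul_one _).le
  refine ⟨h.ready.congr c0, c0, sC, ?_, fun j hj l hl => ?_, by rw [d13]; exact h.ready.k_pos,
    (keepA 1 (by decide)).trans (s.other 1 (by decide)),
    by rw [keepA 33 (by decide)]; exact s.nonempty,
    by rw [keepA 33 (by decide), keepA 5 (by decide)]; exact s.num,
    by rw [h6]; exact s.degree, by rw [h8, h6]; exact s.root,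
    by rw [keepA 9 (by decide), keepA 5 (by decide), s.cutoff, s.log],
    by rw [h4, keepA 9 (by decide)]; exact s.member,
    by rw [keepA 34 (by decide), keepA 9 (by decide)]; exact s.big, fun j hj => ?_⟩
  · refine ⟨?_, ?_, ?_, hdeg, ?_, ?_, ?_, ?_, ?_⟩
    · change 1 ≤ C 0 2
      rw [c0]
      exact h.ready.k_pos
    · intro u hu
      change C 1 u < C 0 1
      rw [keepA 1 (by decide), s.other 1 (by decide), c0]
      exact h.own_lt u (by rw [← c0]; exact hu)
    · intro u j
      change C 4 _ ≤ 1
      rw [h4]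
      exact s.member_le _
    · intro j hj
      change ∑ u ∈ range (C 0 3), C 4 (u * C 0 0 + j) ≤ C 6 0
      replace hj : j < C 0 0 := hj
      rw [c0] at hj ⊢
      rw [h6, s.degree]
      refine (sum_le_sum fun u hu => hle4 u (mem_range.1 hu) j hj).trans ?_
      exact (Finset.le_sup (f := fun j => ∑ u ∈ range (U 0 3), U 2 (u * U 0 0 + j))
        (mem_range.2 hj)).trans (Nat.le_add_left _ _)
    · intro j hj
      change C 10 j < C 0 0
      rw [h10, c0, ← a0]
      exact c.cls_lt j (by rw [a0, ← c0]; exact hj)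
    · intro u hu j hj j' hj' h1 h2 h3
      replace hj : j < C 0 0 := hj
      replace hj' : j' < C 0 0 := hj'
      replace hu : u < C 0 3 := hu
      change C 4 (u * C 0 0 + j) ≠ 0 at h1
      change C 4 (u * C 0 0 + j') ≠ 0 at h2
      change C 10 j = C 10 j' at h3
      rw [c0, ← a0] at hj hj' hu h1 h2
      rw [h4] at h1 h2
      rw [h10] at h3
      exact c.proper u hu j hj j' hj' h1 h2 h3
    · change (0 : ℝ) < 1 / (8 * C 6 0 * C 8 0)
      positivity
    -- The left side equals `1 / (2 * r)` for the rounded-up root `r ≥ 1`.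
    · change (1 : ℝ) / (8 * C 6 0 * C 8 0) * (4 * C 6 0) ≤ 1 / 2
      have e1 : (1 : ℝ) ≤ C 6 0 := by exact_mod_cast hdeg
      have e2 : (1 : ℝ) ≤ C 8 0 := by exact_mod_cast hroot
      rw [div_mul_eq_mul_div, one_mul, div_le_div_iff₀ (by positivity) (by norm_num)]
      nlinarith
  · have hlt : j * U 0 2 + l < U 0 4 := by rw [h.ready.c4]; exact index_lt hj hl
    rw [coloring, d13, c0, f12]
    simp only [hlt, if_true, Nat.cast_one]
  · rw [h10, h4, ← a0]
    exact c.le j (by rw [a0]; exact hj)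

theorem prepared_safe {Q : ℕ} {U : Store} (h : Initial U) (hB : U.Bounded Q) :
    (fills setup).Safe (setupBits Q) U ∧
    (Cmd.loop 0 classify).Safe (classify.growth (setupBits Q)) ((fills setup).run U) ∧
    (fills start).Safe (setupBits Q) ((Cmd.loop 0 classify).run ((fills setup).run U)) ∧
    (prepared U).Bounded (setupBits Q) := by
  have s := setup_spec h.ready h.mem_le
  obtain ⟨t₁, b₁⟩ := (Cmd.loopFree_fills setup).safe hB
  have g₁ := Cmd.le_growth (fills start) ((fills setup).growth Q)
  obtain ⟨t₂, b₂⟩ := loop_classify_safe b₁ (Cmd.supported_run _ h.supported)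
    (by rw [Cmd.run_zero]; exact h.ready.c7)
    (fun j => by rw [s.other 10 (by decide)]; exact h.zero 10 (by decide) j)
    (by rw [s.other 11 (by decide)]; exact h.zero 11 (by decide) 0)
  have t₂' := (loop_classify_safe (b₁.mono g₁) (Cmd.supported_run _ h.supported)
    (by rw [Cmd.run_zero]; exact h.ready.c7)
    (fun j => by rw [s.other 10 (by decide)]; exact h.zero 10 (by decide) j)
    (by rw [s.other 11 (by decide)]; exact h.zero 11 (by decide) 0)).1
  obtain ⟨t₃, b₃⟩ := (Cmd.loopFree_fills start).safe b₂
  exact ⟨t₁.mono g₁, t₂', t₃, b₃⟩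

/-- A bound for all binary lengths. -/
def mainBits (Q : ℕ) : ℕ := setupBits Q + classify.growth (setupBits Q) +
  loopRoundBits (setupBits Q) + (fills output).growth (setupBits Q + colorBits (setupBits Q))

theorem main_safe {Q : ℕ} {U : Store} (h : Initial U) (hB : U.Bounded Q) : main.Safe (mainBits Q) U := by
  obtain ⟨t₁, t₂, t₃, b₃⟩ := prepared_safe h hB
  have p := prepared_spec h
  have hx : (layout (prepared U)).Good (coloring (prepared U) 12 13) :=
    Layout.good_of_uniform p.valid fun j hj l hl => by
      have := p.uniform j (by rw [← p.zero]; exact hj) l (by rw [← p.zero]; exact hl)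
      rw [this, ← p.zero]
      rfl
  obtain ⟨t₄, b₄⟩ := loop_round_safe p.ready p.valid p.supported hx p.den_pos b₃
  have t₅ := ((Cmd.loopFree_fills output).safe b₄).1
  refine ⟨t₁.mono ?_, t₂.mono ?_, t₃.mono ?_, t₄.mono ?_, t₅.mono ?_⟩ <;> rw [mainBits] <;> omega

theorem polyBounded_mainBits : PolyBounded mainBits := by
  have q := PolyBounded.id
  have c := PolyBounded.const
  have gram : PolyBounded gramBits :=
    (q.add ((c 2).mul (q.add (q.mul q)))).add (c 2)
  have kernel : PolyBounded kernelBits := (((c 1).add ((c 2).mul q)).add gram).mul q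
  have color : PolyBounded colorBits := q.add (q.mul (kernel.add (c 2)))
  have loop : PolyBounded fun Q => loopBits Q (colorBits Q) :=
    ((((fills prepare).polyBounded_growth.comp (q.add color))).add kernel).add (c 1)
  have rounds : PolyBounded fun Q => roundBits Q (colorBits Q) :=
    (leverrierStep.polyBounded_growth.comp loop).add ((fills clear).polyBounded_growth.comp
      (update.polyBounded_growth.comp ((fills candidates).polyBounded_growth.comp loop)))
  have setups : PolyBounded setupBits :=
    (fills start).polyBounded_growth.comp (fills setup).polyBounded_growth
  have loopRound : PolyBounded loopRoundBits := rounds.add (q.add color)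
  exact ((setups.add (classify.polyBounded_growth.comp setups)).add (loopRound.comp setups)).add
    ((fills output).polyBounded_growth.comp (setups.add (color.comp setups)))

end Algorithm

/-! ### The input -/

namespace Expr

/-- A bound for the binary length of the value. -/
def sizeBound : Expr → ℕ → ℕ
  | const c, _ => c.size
  | read _ _, Q => Q
  | op _ e₁ e₂, Q => e₁.sizeBound Q + e₂.sizeBound Q + 1

def timeBound : Expr → ℕ → ℕ
  | const c, _ => 1 + c.size
  | read _ idx, Q => idx.timeBound Q + 1 + idx.sizeBound Q + Q
  | op _ e₁ e₂, Q => e₁.timeBound Q + e₂.timeBound Q + (1 + e₁.sizeBound Q) * (1 + e₂.sizeBound Q)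

theorem polyBounded_sizeBound (e : Expr) : PolyBounded e.sizeBound := by
  induction e with
  | const c => exact .const _
  | read a idx ih => exact .id
  | op o e₁ e₂ h1 h2 => exact (h1.add h2).add (.const 1)

theorem polyBounded_timeBound (e : Expr) : PolyBounded e.timeBound := by
  induction e with
  | const c => exact .const _
  | read a idx ih => exact ((ih.add (.const 1)).add idx.polyBounded_sizeBound).add .id
  | op o e₁ e₂ h1 h2 =>
    exact (h1.add h2).add (((PolyBounded.const 1).add e₁.polyBounded_sizeBound).mul
      ((PolyBounded.const 1).add e₂.polyBounded_sizeBound))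

variable {Q : ℕ} {σ : Store}

theorem size_eval_le (h : ∀ a i, (σ a i).size ≤ Q) (e : Expr) : (e.eval σ).size ≤ e.sizeBound Q := by
  induction e with
  | const c => exact le_rfl
  | read a idx ih => exact h _ _
  | op o e₁ e₂ h1 h2 =>
    exact (o.size_apply_le _ _).trans (Nat.add_le_add_right (Nat.add_le_add h1 h2) 1)

theorem cost_le (h : ∀ a i, (σ a i).size ≤ Q) (e : Expr) : e.cost σ ≤ e.timeBound Q := by
  induction e with
  | const c => exact le_rfl
  | read a idx ih =>
    exact Nat.add_le_add (Nat.add_le_add (Nat.add_le_add_right ih 1) (size_eval_le h idx)) (h _ _)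
  | op o e₁ e₂ h1 h2 =>
    exact Nat.add_le_add (Nat.add_le_add h1 h2) (Nat.mul_le_mul
      (Nat.add_le_add_left (size_eval_le h e₁) 1) (Nat.add_le_add_left (size_eval_le h e₂) 1))

end Expr

namespace Algorithm

/-- The effect of `assigns`. -/
def assignAll : List (ℕ × Expr) → Store → Store
  | [], σ => σ
  | p :: l, σ => assignAll l (σ.write 0 p.1 (p.2.eval σ))

def assignsTime : List (ℕ × Expr) → ℕ → ℕ
  | [], _ => 1
  | p :: l, Q => 1 + p.1.size + p.2.timeBound Q + 1 + assignsTime l (Q + p.2.sizeBound Q)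

theorem polyBounded_assignsTime (l : List (ℕ × Expr)) : PolyBounded (assignsTime l) := by
  induction l with
  | nil => exact .const 1
  | cons p l ih =>
    exact (((PolyBounded.const _).add p.2.polyBounded_timeBound).add (.const 1)).add
      (ih.comp (PolyBounded.id.add p.2.polyBounded_sizeBound))

theorem exec_assigns (l : List (ℕ × Expr)) {Q : ℕ} {σ : Store} (h : ∀ a i, (σ a i).size ≤ Q)
    (r : List Bool) :
    ∃ T, Exec (assigns l) σ r (assignAll l σ) r T ∧ T ≤ assignsTime l Q := by
  induction l generalizing Q σ with
  | nil => exact ⟨1, .skip _ _, le_rfl⟩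
  | cons p l ih =>
    have a := Exec.assign 0 (.const p.1) p.2 σ r
    obtain ⟨T, hx, hT⟩ := ih (Q := Q + p.2.sizeBound Q) (σ := σ.write 0 p.1 (p.2.eval σ)) (by
      intro b i
      by_cases hb : b = 0
      · subst hb
        by_cases hi : i = p.1
        · subst hi
          simpa [Store.write] using (p.2.size_eval_le h).trans (Nat.le_add_left _ Q)
        · simpa [Store.write, Function.update_of_ne hi] using (h 0 i).trans (Nat.le_add_right _ _)
      · simpa [Store.write, Function.update_of_ne hb] using (h b i).trans (Nat.le_add_right _ _))
    refine ⟨_, .seq a hx, Nat.add_le_add (Nat.add_le_add_right (Nat.add_le_add le_rfl ?_) 1) hT⟩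
    exact p.2.cost_le h

theorem assignAll_of_ne (l : List (ℕ × Expr)) (σ : Store) {a : ℕ} (ha : a ≠ 0) :
    assignAll l σ a = σ a := by
  induction l generalizing σ with
  | nil => rfl
  | cons p l ih => exact (ih _).trans (Function.update_of_ne ha _ _)

/-- The input occupies low arrays only, so the renumbering of user arrays and the empty auxiliary
arrays are invisible at the start. -/
theorem machine_self {U : Store} (h : ∀ a, 4 ≤ a → U a = 0) : machine U 0 0 0 0 = U := by
  funext a
  rcases a with _ | _ | _ | _ | _ | _ | _ | _ | a
  · rfl
  · rfl
  · rfl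
  · rfl
  · exact (h 4 (by omega)).symm
  · exact (h 5 (by omega)).symm
  · exact (h 6 (by omega)).symm
  · exact (h 7 (by omega)).symm
  · exact (h (a + 4) (by omega)).trans (h (a + 8) (by omega)).symm

/-- The entries of array `0` after `sizes`. -/
def initialSizes (n m k E : ℕ) : ℕ → ℕ
  | 0 => n
  | 1 => m
  | 2 => min k (n + 1)
  | 3 => E
  | 4 => n * min k (n + 1)
  | 5 => n * min k (n + 1) * (n * min k (n + 1))
  | 6 => E * n
  | 7 => 1
  | 8 => (E + 1) * min k (n + 1)
  | 9 => m * min k (n + 1)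
  | 10 => 1 - (n + 1 - k)
  | 11 => m * (n * min k (n + 1))
  | _ => 0

variable {n m : ℕ} (F : CoverageFamily n m) (k : ℕ)

/-- The store on which the main part of the algorithm is started. -/
def initial : Store := assignAll sizes (F.input k)

theorem initial_zero : initial F k 0 = initialSizes n m k F.numElems := by
  have hk : k - (k - (n + 1)) = min k (n + 1) := by omega
  have h0 : F.input k 0 0 = n := rfl
  have h1 : F.input k 0 1 = m := rfl
  have h2 : F.input k 0 2 = k := rfl
  have h3 : F.input k 0 3 = F.numElems := rfl
  funext i
  simp only [initial, sizes, size, assignAll, Store.write, Expr.eval, Op.apply, Function.update_apply,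
    if_true, Nat.reduceEqDiff, if_false, OfNat.zero_ne_ofNat, OfNat.one_ne_ofNat, h0, h1, h2, h3, hk]
  rcases i with _ | _ | _ | _ | _ | _ | _ | _ | _ | _ | _ | _ | i <;>
    simp [h0, h1, h3, initialSizes]
  rfl

theorem initial_of_ne {a : ℕ} (ha : a ≠ 0) : initial F k a = F.input k a := assignAll_of_ne _ _ ha

theorem input_of_three_le {a : ℕ} (ha : 3 ≤ a) : F.input k a = 0 := by
  obtain ⟨a, rfl⟩ := Nat.exists_eq_add_of_le' ha
  rfl

theorem input_one (u : ℕ) :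
    F.input k 1 u = if h : u < F.numElems then (F.owner ⟨u, h⟩ : ℕ) else 0 := rfl

theorem input_two (q : ℕ) : F.input k 2 q = if h : q / n < F.numElems ∧ q % n < n then
    if (⟨q % n, h.2⟩ : Fin n) ∈ F.dual ⟨q / n, h.1⟩ then 1 else 0 else 0 := rfl

theorem input_two_le (q : ℕ) : F.input k 2 q ≤ 1 := by
  rw [input_two]
  split_ifs <;> simp

theorem input_mem {u j : ℕ} (hu : u < F.numElems) (hj : j < n) : F.input k 2 (u * n + j) =
    if (⟨j, hj⟩ : Fin n) ∈ F.dual ⟨u, hu⟩ then 1 else 0 := by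
  have h1 : (u * n + j) / n = u := index_div hj
  have h2 : (u * n + j) % n = j := index_mod hj
  rw [input_two]
  simp only [h1, h2]
  rw [dif_pos ⟨hu, hj⟩]

theorem initial_spec (hk : 1 ≤ k) : Initial (initial F k) := by
  have e := initial_zero F k
  refine ⟨⟨?_, ?_, ?_, ?_, ?_, ?_, ?_, ?_⟩, fun a ha i hi => ?_, fun q => ?_, fun u hu => ?_,
    fun a ha q => ?_⟩
  · rw [e]
    exact le_min hk (Nat.le_add_left 1 n)
  · rw [e]; rfl
  · rw [e]; rfl
  · rw [e]; rfl
  · rw [e]; rfl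
  · rw [e]; rfl
  · rw [e]; rfl
  · rw [e]; rfl
  · rw [e] at hi
    rw [initial_of_ne F k ha]
    rcases Nat.lt_or_ge 2 a with h | h
    · rw [input_of_three_le F k h]; rfl
    obtain rfl | rfl : a = 1 ∨ a = 2 := by omega
    · rw [input_one, dif_neg (Nat.not_lt.2 (show F.numElems ≤ i from hi))]
    · rw [input_two, dif_neg]
      rintro ⟨h1, h2⟩
      exact absurd ((Nat.div_lt_iff_lt_mul (by omega)).1 h1) (Nat.not_lt.2 hi)
  · rw [initial_of_ne F k (by decide)]
    exact input_two_le F k q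
  · rw [e] at hu ⊢
    rw [initial_of_ne F k (by decide), input_one, dif_pos (show u < F.numElems from hu)]
    exact (F.owner _).2
  · rw [initial_of_ne F k (by omega), input_of_three_le F k ha]; rfl

theorem input_bounded (a i : ℕ) : (F.input k a i).size ≤ F.inputSize k := by
  rcases Nat.lt_or_ge 2 a with h | h
  · rw [input_of_three_le F k h]; simp
  · have hs : F.inputSize k = n + m + F.numElems + k.size := rfl
    interval_cases a
    · rcases i with _ | _ | _ | _ | i
      · exact (size_le_self n).trans (by omega)
      · exact (size_le_self m).trans (by omega)
      · exact (by omega : k.size ≤ F.inputSize k)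
      · exact (size_le_self F.numElems).trans (by omega)
      · change Nat.size 0 ≤ _
        simp
    · rw [input_one]
      split_ifs with h
      · exact (size_le_self _).trans ((F.owner _).2.le.trans (by omega))
      · simp
    · refine (size_le_self _).trans ?_
      rw [input_two]
      split_ifs with h1 h2
      · omega
      · omega
      · omega

/-- A bound for the entries of the initial store. -/
def initialBound (s : ℕ) : ℕ := (s + 1) * (s + 1) * ((s + 1) * (s + 1))

theorem initial_bounded : (initial F k).Bounded (initialBound (F.inputSize k)) := by
  obtain ⟨s, hs⟩ : ∃ s, F.inputSize k = s := ⟨_, rfl⟩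
  have hs' : n + m + F.numElems + k.size = s := hs
  have h1 : ∀ {x}, x ≤ s + 1 → x ≤ initialBound s := fun h => h.trans (by
    rw [initialBound]; nlinarith [Nat.zero_le s, Nat.zero_le (s * s), Nat.zero_le (s * s * s)])
  have h2 : ∀ {x y}, x ≤ s + 1 → y ≤ s + 1 → x * y ≤ initialBound s := fun hx hy =>
    (Nat.mul_le_mul hx hy).trans (Nat.le_mul_of_pos_right _ (by positivity))
  have hmin : min k (n + 1) ≤ s + 1 := (min_le_right _ _).trans (by omega)
  have hb : ∀ i, initial F k 0 i ≤ initialBound s := by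
    intro i
    rw [initial_zero]
    have hn : n ≤ s + 1 := by omega
    have hm : m ≤ s + 1 := by omega
    have hE : F.numElems ≤ s + 1 := by omega
    rcases i with _ | _ | _ | _ | _ | _ | _ | _ | _ | _ | _ | _ | i
    · exact h1 hn
    · exact h1 hm
    · exact h1 hmin
    · exact h1 hE
    · exact h2 hn hmin
    · exact Nat.mul_le_mul (Nat.mul_le_mul hn hmin) (Nat.mul_le_mul hn hmin)
    · exact h2 hE hn
    · exact h1 (Nat.le_add_left 1 s)
    · exact h2 (by omega) hmin
    · exact h2 hm hmin
    · exact h1 ((Nat.sub_le _ _).trans (Nat.le_add_left 1 s))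
    · exact (Nat.mul_le_mul hm (Nat.mul_le_mul hn hmin)).trans
        ((Nat.mul_le_mul_left _ (Nat.le_mul_of_pos_left _ (by omega : 0 < s + 1))).trans_eq (by
          rw [initialBound]; ring))
    · exact h1 (Nat.zero_le _)
  rw [hs]
  refine ⟨fun a i => ?_, hb⟩
  by_cases ha : a = 0
  · subst ha
    exact (size_le_self _).trans (hb i)
  · rw [initial_of_ne F k ha]
    exact (input_bounded F k a i).trans (h1 (by omega))

/-- The algorithm runs in polynomial time. -/
theorem exists_polynomial : ∃ p : Polynomial ℕ, ∀ (n m k : ℕ), 1 ≤ k → ∀ (F : CoverageFamily n m)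
    (r : List Bool), ∃ (σ : Store) (T : ℕ), Exec program (F.input k) r σ r T ∧
      T ≤ p.eval (F.inputSize k) ∧ σ 3 = main.run (initial F k) 3 := by
  have hb : PolyBounded initialBound :=
    ((PolyBounded.id.add (.const 1)).mul (PolyBounded.id.add (.const 1))).mul
      ((PolyBounded.id.add (.const 1)).mul (PolyBounded.id.add (.const 1)))
  obtain ⟨p, hp⟩ := (polyBounded_assignsTime sizes).add
    ((main.polyBounded_timeBound 0).comp (polyBounded_mainBits.comp hb))
  refine ⟨p, fun n m k hk F r => ?_⟩
  have hI := initial_spec F k hk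
  obtain ⟨T₁, x₁, hT₁⟩ := exec_assigns sizes (input_bounded F k) r
  obtain ⟨t, s, c, T₂, x₂, hT₂, -⟩ := main.exec_compile 0 hI.supported
    (main_safe hI (initial_bounded F k)) 0 0 0 r
  rw [machine_self fun a ha => (initial_of_ne F k (by omega)).trans (input_of_three_le F k (by omega))]
    at x₂
  exact ⟨_, _, .seq x₁ x₂, (Nat.add_le_add hT₁ hT₂).trans (hp _), rfl⟩

end Algorithm

/-! ### Properties of the rounded colouring -/

namespace Algorithm

section
variable {U : Store}

/-- The store after all roundings. -/
def rounded (U : Store) : Store := (Cmd.loop 4 round).run (prepared U)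

theorem good_prepared (h : Initial U) :
    (layout (prepared U)).Good (coloring (prepared U) 12 13) := by
  have p := prepared_spec h
  refine Layout.good_of_uniform p.valid fun j hj l hl => ?_
  have := p.uniform j (by rw [← p.zero]; exact hj) l (by rw [← p.zero]; exact hl)
  rw [this, ← p.zero]
  rfl

theorem rounded_spec (h : Initial U) : RoundSpec (prepared U) (rounded U) 0 := by
  have p := prepared_spec h
  have := RoundSpec.iterate p.ready p.valid p.supported (good_prepared h) p.den_pos
    (le_refl (prepared U 0 4))
  rw [Nat.sub_self] at this
  exact this

theorem PreparedSpec.sum_member (h : Initial U) {V : Store} (p : PreparedSpec U V) {u : ℕ}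
    (hu : u < U 0 3) : ∑ j ∈ range (U 0 0), V 4 (u * U 0 0 + j) =
      min (∑ j ∈ range (U 0 0), U 2 (u * U 0 0 + j)) (V 9 0) := by
  rw [← sum_truncated _ _ fun j _ => h.mem_le (u * U 0 0 + j)]
  exact sum_congr rfl fun j hj => p.member u hu j (mem_range.1 hj)

theorem potential_rounded_le (h : Initial U) :
    (layout (prepared U)).potential (coloring (rounded U) 12 13) ≤
      2 * (prepared U 5 0 * U 0 2 : ℕ) + 1 := by
  have p := prepared_spec h
  refine (rounded_spec h).potential_le.trans ?_
  have e : (layout (prepared U)).potential (coloring (prepared U) 12 13) =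
      (layout (prepared U)).potential fun _ _ => 1 / (layout (prepared U)).k := by
    refine Layout.potential_congr fun j hj l hl => ?_
    rw [p.uniform j (by rw [← p.zero]; exact hj) l (by rw [← p.zero]; exact hl), ← p.zero]
    rfl
  have hnum : ∑ u ∈ range (layout (prepared U)).E, (layout (prepared U)).nonempty u =
      prepared U 5 0 := by
    rw [p.num, ← p.zero]
    rfl
  have hk : (layout (prepared U)).k = U 0 2 := congrFun p.zero 2
  rw [e]
  refine (Layout.potential_uniform_le p.valid (L := (prepared U 5 0 * U 0 2).size) ?_ ?_ ?_ ?_).trans_eq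
    (by rw [hnum, hk])
  · rw [hnum, hk]
    exact (Nat.lt_size_self _).le
  · rw [hnum]
    rfl
  · intro u hu
    replace hu : u < prepared U 0 3 := hu
    rw [p.zero] at hu
    change prepared U 34 u ≤ prepared U 33 u
    rw [p.big u hu, p.nonempty u hu]
    split_ifs <;> omega
  · intro u hu hb
    replace hu : u < prepared U 0 3 := hu
    replace hb : prepared U 34 u ≠ 0 := hb
    change prepared U 0 2 * _ ≤ ∑ j ∈ range (prepared U 0 0), prepared U 4 (u * prepared U 0 0 + j)
    rw [p.zero] at hu ⊢
    rw [p.big u hu] at hb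
    rw [p.sum_member h hu, p.cutoff]
    split_ifs at hb with hlt
    · rw [p.cutoff] at hlt
      exact le_min hlt.le le_rfl
    · exact absurd rfl hb

/-- A truncated set has at most `k * (2L + 2)` items and an item lies in fewer than `τ` sets, so
fewer than `τ * k * (2L + 2)` classes bound the class numbers in `abs_sum_dev_le`. -/
theorem abs_sum_dev_rounded_le (h : Initial U) {u l : ℕ} (hu : u < U 0 3) (hl : l < U 0 2)
    (hne : prepared U 33 u ≠ 0) :
    |∑ b ∈ range (U 0 0), (layout (prepared U)).dev b (coloring (rounded U) 12 13) (U 1 u) l| ≤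
      8 * prepared U 6 0 * prepared U 8 0 * (Real.log (2 * (prepared U 5 0 * U 0 2 : ℕ) + 1) +
        (prepared U 5 0 * U 0 2).size + 1) := by
  have p := prepared_spec h
  set V := prepared U with hV
  set τ := V 6 0 with hτ
  set r := V 8 0 with hr
  set L := (V 5 0 * U 0 2).size with hL
  have hτ1 : 1 ≤ τ := by rw [hτ, p.degree]; omega
  have hr1 : 1 ≤ r := by rw [hr, p.root]; omega
  have hrsq : τ * U 0 2 ≤ r * r := by
    have h1 := Nat.sqrt_lt'.1 (Nat.lt_succ_self (τ * U 0 2 - 1).sqrt)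
    rw [hr, p.root, ← pow_two]
    exact Nat.le_of_pred_lt h1
  have hcls : ∀ j < (layout V).n, (layout V).cls j < τ * (U 0 2 * (2 * L + 2)) := by
    intro j hj
    replace hj : j < V 0 0 := hj
    rw [p.zero] at hj
    have hk := h.ready.k_pos
    calc V 10 j ≤ ∑ u ∈ range (U 0 3), V 4 (u * U 0 0 + j) *
          ∑ j' ∈ range (U 0 0), V 4 (u * U 0 0 + j') := p.cls_le j hj
      _ ≤ ∑ u ∈ range (U 0 3), U 2 (u * U 0 0 + j) * (U 0 2 * (2 * L + 2)) := by
          refine sum_le_sum fun u hu => Nat.mul_le_mul ?_ ?_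
          · rw [p.member u (mem_range.1 hu) j hj]
            exact (Nat.mul_le_mul_left _ (indicator_le_one _)).trans (Nat.mul_one _).le
          · rw [p.sum_member h (mem_range.1 hu), p.cutoff]
            exact min_le_right _ _
      _ = (∑ u ∈ range (U 0 3), U 2 (u * U 0 0 + j)) * (U 0 2 * (2 * L + 2)) := (sum_mul _ _ _).symm
      _ < τ * (U 0 2 * (2 * L + 2)) := by
          refine Nat.mul_lt_mul_of_pos_right ?_ (by positivity)
          rw [hτ, p.degree, add_comm]
          exact Nat.lt_succ_of_le (Finset.le_sup (f := fun j => ∑ u ∈ range (U 0 3), U 2 (u * U 0 0 + j))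
            (mem_range.2 hj))
  have main := Layout.abs_sum_dev_le p.valid (rounded_spec h).good (potential_rounded_le h) hcls
    (u := u) (l := l) (by change u < V 0 3; rw [p.zero]; exact hu)
    (by change l < V 0 2; rw [p.zero]; exact hl) hne
  have hn : (layout V).n = U 0 0 := congrFun p.zero 0
  have hown : (layout V).own u = U 1 u := congrFun p.own u
  have hlam : (layout V).lam = 1 / (8 * τ * r) := rfl
  have hdeg : (layout V).deg = τ := rfl
  rw [hn, hown, hlam, hdeg] at main
  have hτ' : (0 : ℝ) < τ := by exact_mod_cast hτ1
  have hr' : (0 : ℝ) < r := by exact_mod_cast hr1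
  have hsq : (τ : ℝ) * U 0 2 ≤ r * r := by exact_mod_cast hrsq
  -- Here `4 * lam * τ = 1 / (2 * r)`, and `τ * k ≤ r * r` by the choice of the root.
  have e : 2 * ((τ * (U 0 2 * (2 * L + 2)) : ℕ) : ℝ) * (1 / (8 * τ * r) * (4 * τ)) ^ 2 ≤ L + 1 := by
    have e1 : (1 / (8 * τ * r) * (4 * τ) : ℝ) = 1 / (2 * r) := by field_simp; norm_num
    rw [e1]
    push_cast
    rw [div_pow, one_pow, mul_one_div, div_le_iff₀ (by positivity)]
    nlinarith [mul_le_mul_of_nonneg_right hsq (by positivity : (0 : ℝ) ≤ L + 1)]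
  rw [one_div_mul_eq_div, div_le_iff₀ (by positivity)] at main
  refine main.trans ?_
  rw [mul_comm]
  exact mul_le_mul_of_nonneg_left (by linarith) (by positivity)

/-- The colour of an item in the rounded colouring. -/
def colour (U : Store) (j : ℕ) : ℕ := firstIndex (fun l => rounded U 12 (j * U 0 2 + l)) (U 0 2)

theorem rounded_eq (h : Initial U) {j : ℕ} (hj : j < U 0 0) : colour U j < U 0 2 ∧
    ∀ l < U 0 2, coloring (rounded U) 12 13 j l = if l = colour U j then 1 else 0 := by
  have p := prepared_spec h
  have s := rounded_spec h
  have w0 : rounded U 0 = U 0 := (s.other 0 (.inl (by decide))).trans p.zero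
  have hj' : j < (layout (prepared U)).n := by change j < prepared U 0 0; rw [p.zero]; exact hj
  have hk' : (layout (prepared U)).k = U 0 2 := congrFun p.zero 2
  have hfrac : ∀ l < U 0 2, ¬ Layout.Frac (coloring (rounded U) 12 13) j l := fun l hl =>
    s.not_frac (by rw [p.zero]; exact hj) (by rw [p.zero]; exact hl)
  have hval : ∀ l, rounded U 12 (j * U 0 2 + l) = 0 ↔ coloring (rounded U) 12 13 j l = 0 := by
    intro l
    have hd : (rounded U 13 0 : ℝ) ≠ 0 := by exact_mod_cast s.den_pos.ne'
    rw [coloring, w0, div_eq_zero_iff, or_iff_left hd, Nat.cast_eq_zero]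
  have hsum := s.good.sum_one j hj'
  rw [hk'] at hsum
  have hone : ∀ l < U 0 2, coloring (rounded U) 12 13 j l ≠ 0 → coloring (rounded U) 12 13 j l = 1 := by
    intro l hl h0
    have h1 := s.good.nonneg j hj' l (by rw [hk']; exact hl)
    have h2 := s.good.le_one hj' (by rw [hk']; exact hl : l < _)
    by_contra hne
    exact hfrac l hl ⟨lt_of_le_of_ne h1 (Ne.symm h0), lt_of_le_of_ne h2 hne⟩
  have hlt : colour U j < U 0 2 := by
    by_contra hno
    rw [sum_eq_zero fun l hl => ?_] at hsum
    · exact zero_ne_one hsum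
    · by_contra h0
      exact hno (firstIndex_lt (mem_range.1 hl) fun h => h0 ((hval l).1 h))
  have hc : coloring (rounded U) 12 13 j (colour U j) = 1 :=
    hone _ hlt fun h0 => (exists_firstIndex _ _).2 hlt ((hval _).2 h0)
  refine ⟨hlt, fun l hl => ?_⟩
  split_ifs with hlc
  · rw [hlc, hc]
  · rw [← add_sum_erase _ _ (mem_range.2 hlt), hc, add_eq_left] at hsum
    exact (sum_eq_zero_iff_of_nonneg fun l' hl' => s.good.nonneg j hj' l'
      (by rw [hk']; exact mem_range.1 (mem_erase.1 hl').2)).1 hsum l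
        (mem_erase.2 ⟨hlc, mem_range.2 hl⟩)

open Classical in
theorem missing_rounded (h : Initial U) {u l : ℕ} (hu : u < U 0 3) (hl : l < U 0 2) :
    (layout (prepared U)).missing (coloring (rounded U) 12 13) u l =
      if ∃ j < U 0 0, U 2 (u * U 0 0 + j) ≠ 0 ∧ colour U j = l then 0 else 1 := by
  have p := prepared_spec h
  have s := rounded_spec h
  set V := prepared U with hV
  have key : (∃ j < U 0 0, U 2 (u * U 0 0 + j) ≠ 0 ∧ colour U j = l) →
      ∃ j < U 0 0, V 4 (u * U 0 0 + j) ≠ 0 ∧ colour U j = l := by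
    rintro ⟨j, hj, hm, hc⟩
    by_cases hb : V 34 u = 0
    · refine ⟨j, hj, ?_, hc⟩
      have hle : ∑ j ∈ range (U 0 0), U 2 (u * U 0 0 + j) ≤ V 9 0 := by
        rw [p.big u hu] at hb
        split_ifs at hb with hlt
        exact Nat.not_lt.1 hlt
      rw [p.member u hu j hj, if_pos, mul_one]
      · exact hm
      · refine lt_of_lt_of_le ?_ hle
        have h1 : ∑ j' ∈ range (j + 1), U 2 (u * U 0 0 + j') ≤
            ∑ j ∈ range (U 0 0), U 2 (u * U 0 0 + j) :=
          sum_le_sum_of_subset (range_subset_range.2 hj)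
        rw [sum_range_succ] at h1
        omega
    -- For a truncated set the covering item may have been cut off. But the potential, at most `2ek
    -- + 1`, is below the weight `4ek`, so another item of colour `l` lies in the truncated set.
    -- This needs `ek ≥ 1`.
    · have hpos : 0 < V 5 0 * U 0 2 := by
        refine Nat.mul_pos ?_ h.ready.k_pos
        rw [p.num]
        refine sum_pos' (fun _ _ => Nat.zero_le _) ⟨u, mem_range.2 hu, ?_⟩
        rw [p.nonempty u hu, if_neg]
        · exact one_pos
        · intro h0
          exact hm (sum_eq_zero_iff.1 h0 j (mem_range.2 hj))
      obtain ⟨j', hj', hm', hx'⟩ := Layout.exists_of_big (S := layout V) s.good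
        (fun j hj l hl => s.not_frac hj hl)
        ((potential_rounded_le h).trans_lt (by
          change _ < ((4 * (V 5 0 * V 0 2) : ℕ) : ℝ)
          rw [p.zero]
          have : (1 : ℝ) ≤ (V 5 0 * U 0 2 : ℕ) := by exact_mod_cast hpos
          push_cast at this ⊢
          linarith))
        (u := u) (l := l) (by change u < V 0 3; rw [p.zero]; exact hu)
        (by change l < V 0 2; rw [p.zero]; exact hl) hb
      replace hj' : j' < V 0 0 := hj'
      replace hm' : V 4 (u * V 0 0 + j') ≠ 0 := hm'
      rw [p.zero] at hj' hm'
      refine ⟨j', hj', hm', ?_⟩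
      rw [(rounded_eq h hj').2 l hl] at hx'
      by_contra hne
      rw [if_neg (Ne.symm hne)] at hx'
      exact zero_ne_one hx'
  have hmem : ∀ j, (layout V).mem u j = V 4 (u * U 0 0 + j) := fun j => by
    change V 4 (u * V 0 0 + j) = _
    rw [p.zero]
  have hn : (layout V).n = U 0 0 := congrFun p.zero 0
  rw [Layout.missing, hn]
  split_ifs with hex
  · obtain ⟨j, hj, hm, hc⟩ := key hex
    refine prod_eq_zero (mem_range.2 hj) ?_
    have h1 : V 4 (u * U 0 0 + j) = 1 := by
      have := p.valid.mem_le u j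
      rw [hmem] at this
      omega
    rw [hmem, h1, (rounded_eq h hj).2 l hl, if_pos hc.symm]
    norm_num
  · refine prod_eq_one fun j hj => ?_
    have hj := mem_range.1 hj
    rw [hmem, (rounded_eq h hj).2 l hl, p.member u hu j hj]
    by_cases hm : U 2 (u * U 0 0 + j) = 0
    · simp [hm]
    · rw [if_neg fun hc : l = colour U j => hex ⟨j, hj, hm, hc.symm⟩]
      simp

theorem output_spec (h : Initial U) {j : ℕ} (hj : j < U 0 0) :
    main.run U 3 j = if U 0 10 = 0 then colour U j else j := by
  have w0 : rounded U 0 = U 0 :=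
    ((rounded_spec h).other 0 (.inl (by decide))).trans (prepared_spec h).zero
  have hrun : main.run U = (fills output).run (rounded U) := rfl
  obtain ⟨o, f⟩ := run_fills ordered_output (rounded U)
  have f3 := f ⟨3, by decide, NatExpr.ite (.cell 10) (.var 0) (.first 5 6 2 (entry 12 (.var 0) 2 (.var 6)))⟩
    (by simp [output])
  have h0 : (fills output).run (rounded U) 0 = rounded U 0 := Cmd.run_zero _ _
  have h12 : (fills output).run (rounded U) 12 = rounded U 12 := o 12 (by simp [output])
  have hj3 : j < rounded U 0 (lengthCell 3) := by rw [w0]; exact hj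
  rw [hrun]
  refine (congrFun f3 j).trans ?_
  rw [if_pos hj3, NatExpr.eval_ite, NatExpr.eval_first (fun l => rounded U 12 (j * U 0 2 + l)) (by decide)
    fun q r => by simp [h0, h12, w0]]
  simp only [NatExpr.eval_cell, NatExpr.eval_var, Function.update_self, h0, w0, ne_eq, ite_not]
  rfl

end

end Algorithm

/-! ### The discrepancy -/

section
variable {n m : ℕ} (F : CoverageFamily n m)

open Classical in
theorem CoverageFamily.value_eq {k : ℕ} (χ : Fin n → Fin k) (i : Fin m) (l : Fin k) :
    F.value i (colorClass χ l) = ∑ u, if F.owner u = i then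
      (if ∃ j ∈ F.dual u, χ j = l then (1 : ℝ) else 0) else 0 := by
  rw [value, sum_filter]
  push_cast
  refine sum_congr rfl fun u _ => ?_
  split_ifs with hi hex
  · obtain ⟨j, hj, hc⟩ := hex
    have : 0 < (F.dual u ∩ colorClass χ l).card :=
      card_pos.2 ⟨j, mem_inter.2 ⟨hj, mem_filter.2 ⟨mem_univ _, hc⟩⟩⟩
    rw [min_eq_right (by exact_mod_cast this)]
  · have : F.dual u ∩ colorClass χ l = ∅ := by
      refine eq_empty_of_forall_notMem fun j hj => hex ⟨j, (mem_inter.1 hj).1, ?_⟩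
      exact (mem_filter.1 (mem_inter.1 hj).2).2
    rw [this]
    simp
  · rfl

/-- A colour class has at most one item, which covers at most `t` elements. -/
theorem CoverageFamily.value_le_of_injective {k t : ℕ} (hF : F.Sparse t) {χ : Fin n → Fin k}
    (hχ : Function.Injective χ) (i : Fin m) (l : Fin k) :
    0 ≤ F.value i (colorClass χ l) ∧ F.value i (colorClass χ l) ≤ t := by
  refine ⟨Nat.cast_nonneg _, Nat.cast_le.2 ?_⟩
  by_cases hl : ∃ j, χ j = l
  · obtain ⟨j, hj⟩ := hl
    refine le_trans ?_ (hF j)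
    rw [card_filter]
    refine (sum_le_sum_of_subset (filter_subset _ _)).trans (sum_le_sum fun u _ => ?_)
    split_ifs with hm
    · exact min_le_right _ _
    · have : F.dual u ∩ colorClass χ l = ∅ := by
        refine eq_empty_of_forall_notMem fun j' hj' => hm ?_
        obtain ⟨h1, h2⟩ := mem_inter.1 hj'
        rwa [← hχ ((mem_filter.1 h2).2.trans hj.symm)]
      rw [this]
      simp
  · rw [sum_eq_zero fun u _ => ?_]
    · exact Nat.zero_le _
    · have : colorClass χ l = ∅ := eq_empty_of_forall_notMem fun j hj => hl ⟨j, (mem_filter.1 hj).2⟩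
      rw [this]
      simp

end

namespace Algorithm

variable {n m : ℕ} (F : CoverageFamily n m) (k : ℕ)

theorem colorOf_lt (hk : 1 ≤ k) (j : Fin n) :
    (if initial F k 0 10 = 0 then colour (initial F k) j else j) < k := by
  have e := initial_zero F k
  have h := (rounded_eq (initial_spec F k hk) (j := j) (by rw [e]; exact j.2)).1
  have h2 : initial F k 0 2 = min k (n + 1) := by rw [e]; rfl
  have h10 : initial F k 0 10 = 1 - (n + 1 - k) := by rw [e]; rfl
  have := j.2
  split_ifs with h0 <;> omega

/-- The colouring that the algorithm computes. -/
def colorOf (hk : 1 ≤ k) (j : Fin n) : Fin k := ⟨_, colorOf_lt F k hk j⟩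

theorem colorOf_eq (hk : 1 ≤ k) (hkn : k ≤ n) (j : Fin n) :
    (colorOf F k hk j : ℕ) = colour (initial F k) j := by
  have h10 : initial F k 0 10 = 1 - (n + 1 - k) := by rw [initial_zero]; rfl
  exact if_pos (by omega)

theorem colorOf_injective (hk : 1 ≤ k) (hkn : n < k) : Function.Injective (colorOf F k hk) := by
  have h10 : initial F k 0 10 = 1 - (n + 1 - k) := by rw [initial_zero]; rfl
  have h : ∀ j, (colorOf F k hk j : ℕ) = j := fun j => if_neg (by omega)
  intro j j' hj
  exact Fin.ext (by rw [← h, ← h, hj])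

/-- A colour covers all elements of a function except those that it misses. -/
theorem value_colorOf (hk : 1 ≤ k) (hkn : k ≤ n) (i : Fin m) (l : Fin k) :
    F.value i (colorClass (colorOf F k hk) l) =
      ∑ u : Fin F.numElems, (if F.owner u = i then (1 : ℝ) else 0) -
      ∑ u ∈ range F.numElems, if initial F k 1 u = i then
        (layout (prepared (initial F k))).missing (coloring (rounded (initial F k)) 12 13) u l
        else 0 := by
  classical
  have e := initial_zero F k
  have e0 : initial F k 0 0 = n := by rw [e]; rfl
  have hl : (l : ℕ) < initial F k 0 2 := by
    have h2 : initial F k 0 2 = min k (n + 1) := by rw [e]; rfl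
    have := l.2
    omega
  rw [F.value_eq, ← Fin.sum_univ_eq_sum_range fun u => if initial F k 1 u = i then
    (layout (prepared (initial F k))).missing (coloring (rounded (initial F k)) 12 13) u l else 0,
    ← sum_sub_distrib]
  refine sum_congr rfl fun u _ => ?_
  have hown : initial F k 1 u = F.owner u := by
    rw [initial_of_ne F k (by decide), input_one, dif_pos u.2]
  have hu : (u : ℕ) < initial F k 0 3 := by rw [e]; exact u.2
  by_cases hi : F.owner u = i
  · rw [if_pos hi, if_pos hi, if_pos (show initial F k 1 u = (i : ℕ) by rw [hown, hi]), missing_rounded (initial_spec F k hk) hu hl]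
    have hiff : (∃ j < initial F k 0 0, initial F k 2 (u * initial F k 0 0 + j) ≠ 0 ∧
        colour (initial F k) j = l) ↔ ∃ j ∈ F.dual u, colorOf F k hk j = l := by
      rw [e0, initial_of_ne F k (by decide)]
      constructor
      · rintro ⟨j, hj, hm, hc⟩
        rw [input_mem F k u.2 hj] at hm
        refine ⟨⟨j, hj⟩, ?_, Fin.ext ((colorOf_eq F k hk hkn _).trans hc)⟩
        by_contra hn
        exact hm (if_neg hn)
      · rintro ⟨j, hj, hc⟩
        refine ⟨j, j.2, ?_, ?_⟩
        · rw [input_mem F k u.2 j.2, if_pos hj]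
          exact one_ne_zero
        · rw [← hc, colorOf_eq F k hk hkn]
    rw [if_congr hiff rfl rfl]
    split_ifs <;> norm_num
  · rw [if_neg hi, if_neg hi, if_neg (by rw [hown]; exact fun h => hi (Fin.ext h)), sub_zero]

/-- The number of elements and the uniform missing probabilities do not depend on the colour and
cancel. -/
theorem value_sub_colorOf (hk : 1 ≤ k) (hkn : k ≤ n) (i : Fin m) (l l' : Fin k) :
    F.value i (colorClass (colorOf F k hk) l) - F.value i (colorClass (colorOf F k hk) l') =
      ∑ b ∈ range n, (layout (prepared (initial F k))).dev b
        (coloring (rounded (initial F k)) 12 13) i l -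
      ∑ b ∈ range n, (layout (prepared (initial F k))).dev b
        (coloring (rounded (initial F k)) 12 13) i l' := by
  have p := prepared_spec (initial_spec F k hk)
  have h := fun l => Layout.sum_dev p.valid (coloring (rounded (initial F k)) 12 13) i l
  have hE : (layout (prepared (initial F k))).E = F.numElems := by
    change prepared (initial F k) 0 3 = _
    rw [p.zero, initial_zero]; rfl
  have hn : (layout (prepared (initial F k))).n = n := by
    change prepared (initial F k) 0 0 = _
    rw [p.zero, initial_zero]; rfl
  have hown : (layout (prepared (initial F k))).own = initial F k 1 := p.own
  rw [hE, hn, hown] at h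
  have hu : ∀ u, (layout (prepared (initial F k))).missing
      (fun _ _ => 1 / (layout (prepared (initial F k))).k) u l =
      (layout (prepared (initial F k))).missing
      (fun _ _ => 1 / (layout (prepared (initial F k))).k) u l' := fun _ => rfl
  have h1 := h l
  have h2 := h l'
  simp only [hu] at h1
  rw [value_colorOf F k hk hkn, value_colorOf F k hk hkn, h1, h2]
  ring

end Algorithm

/-! ### Numerical estimates for the bound -/

theorem log_size_le {N : ℕ} (hN : 1 ≤ N) :
    Real.log (2 * (N : ℕ) + 1) + N.size + 1 ≤ 4 + 3 * Real.log N := by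
  have hN' : (1 : ℝ) ≤ N := by exact_mod_cast hN
  have h1 : Real.log (2 * N + 1) ≤ 2 + Real.log N := by
    have h3 : Real.log 3 ≤ 2 := by
      have := Real.log_le_sub_one_of_pos (show (0 : ℝ) < 3 by norm_num)
      linarith
    calc Real.log (2 * N + 1) ≤ Real.log (3 * N) := Real.log_le_log (by linarith) (by linarith)
      _ = Real.log 3 + Real.log N := Real.log_mul (by norm_num) (by linarith)
      _ ≤ _ := by linarith
  have hpos : 0 < N.size := Nat.size_pos.2 hN
  have h2 : 2 ^ (N.size - 1) ≤ N := Nat.lt_size.1 (by omega)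
  have h3 : ((N.size - 1 : ℕ) : ℝ) * Real.log 2 ≤ Real.log N := by
    rw [← Real.log_pow]
    exact Real.log_le_log (by positivity) (by exact_mod_cast h2)
  rw [Nat.cast_sub hpos, Nat.cast_one] at h3
  have h4 := Real.log_two_gt_d9
  have h5 : (1 : ℝ) ≤ N.size := by exact_mod_cast hpos
  nlinarith [Real.log_nonneg hN']

/-- The shape of the discrepancy bound. -/
noncomputable def bound (n t k : ℕ) : ℝ :=
  Real.sqrt ((t : ℝ) ^ 3 * k) * Real.log ((n : ℝ) * t * k)

theorem bound_nonneg (n t k : ℕ) : 0 ≤ bound n t k := by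
  refine mul_nonneg (Real.sqrt_nonneg _) ?_
  rw [← Nat.cast_mul, ← Nat.cast_mul]
  exact Real.log_natCast_nonneg _

theorem sqrt_cube_mul (t k : ℕ) : Real.sqrt ((t : ℝ) ^ 3 * k) = t * Real.sqrt (t * k) := by
  rw [show (t : ℝ) ^ 3 * k = t ^ 2 * (t * k) by ring, Real.sqrt_mul (by positivity),
    Real.sqrt_sq (by positivity)]

theorem one_le_two_mul_log {M : ℕ} (hM : 2 ≤ M) : 1 ≤ 2 * Real.log M := by
  have h1 := Real.log_two_gt_d9
  have h2 : Real.log 2 ≤ Real.log M := Real.log_le_log (by norm_num) (by exact_mod_cast hM)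
  linarith

theorem le_bound {n t k : ℕ} (hn : 1 ≤ n) (ht : 1 ≤ t) (hk : 2 ≤ k) : (t : ℝ) ≤ 2 * bound n t k := by
  have ht' : (1 : ℝ) ≤ t := by exact_mod_cast ht
  have hk' : (1 : ℝ) ≤ k := by exact_mod_cast (by omega : 1 ≤ k)
  have h1 : 1 ≤ Real.sqrt (t * k) := by
    rw [Real.one_le_sqrt]
    nlinarith
  have h2 := one_le_two_mul_log (M := n * t * k)
    (hk.trans (Nat.le_mul_of_pos_left _ (Nat.mul_pos hn ht)))
  push_cast at h2
  rw [bound, sqrt_cube_mul]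
  have h3 : 1 ≤ Real.sqrt (t * k) * (2 * Real.log ((n : ℝ) * t * k)) := by nlinarith
  nlinarith

/-- With `s = √(tk) ≥ 1`, the root satisfies `r ≤ 1 + 3s/2 ≤ 5s/2`, so `8τr ≤ 40ts`. The logarithmic
factor is at most `4 + 3 log (ntk) ≤ 11 log (ntk)`, since `1 ≤ 2 log (ntk)` for `k ≥ 2`. This gives
`440`. -/
theorem deviation_le_bound {n t k τ r N : ℕ} (hn : 1 ≤ n) (ht : 1 ≤ t) (hk : 2 ≤ k) (hτ : τ ≤ 2 * t)
    (hr : r = (τ * k - 1).sqrt + 1) (hN : 1 ≤ N) (hNn : N ≤ n * t * k) :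
    8 * τ * r * (Real.log (2 * (N : ℕ) + 1) + N.size + 1) ≤ 440 * bound n t k := by
  have ht' : (1 : ℝ) ≤ t := by exact_mod_cast ht
  have hk' : (1 : ℝ) ≤ k := by exact_mod_cast (by omega : 1 ≤ k)
  set s := Real.sqrt (t * k) with hs
  have hs1 : 1 ≤ s := by
    rw [hs, Real.one_le_sqrt]
    nlinarith
  have hssq : s * s = t * k := Real.mul_self_sqrt (by positivity)
  have hr' : (r : ℝ) ≤ 5 / 2 * s := by
    have h1 : ((τ * k - 1).sqrt : ℝ) ^ 2 ≤ 2 * (t * k) := by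
      have h2 : (τ * k - 1).sqrt ^ 2 ≤ 2 * (t * k) := (Nat.sqrt_le' _).trans
        ((Nat.sub_le _ _).trans ((Nat.mul_le_mul_right k hτ).trans_eq (by ring)))
      exact_mod_cast h2
    have h3 : ((τ * k - 1).sqrt : ℝ) ≤ 3 / 2 * s := by
      refine le_of_sq_le_sq ?_ (by positivity)
      nlinarith
    rw [hr]
    push_cast
    nlinarith
  have hM := one_le_two_mul_log (M := n * t * k)
    (hk.trans (Nat.le_mul_of_pos_left _ (Nat.mul_pos hn ht)))
  have hlog : Real.log N ≤ Real.log (n * t * k : ℕ) :=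
    Real.log_le_log (by exact_mod_cast hN) (by exact_mod_cast hNn)
  push_cast at hM hlog
  have h1 : Real.log (2 * (N : ℕ) + 1) + N.size + 1 ≤ 11 * Real.log ((n : ℝ) * t * k) := by
    linarith [log_size_le hN]
  have hτ' : (τ : ℝ) ≤ 2 * t := by exact_mod_cast hτ
  have h2 : (8 * τ * r : ℝ) ≤ 40 * (t * s) := by
    have := mul_le_mul hτ' hr' (Nat.cast_nonneg r) (by positivity)
    linarith
  have h3 : 0 ≤ Real.log (2 * (N : ℕ) + 1) + N.size + 1 := by
    have : 0 ≤ Real.log (2 * (N : ℕ) + 1) := Real.log_nonneg (by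
      have := Nat.cast_nonneg (α := ℝ) N
      linarith)
    positivity
  rw [bound, sqrt_cube_mul]
  refine (mul_le_mul h2 h1 h3 (by positivity)).trans_eq ?_
  rw [← hs]
  ring

/-! ### The discrepancy of the computed colouring -/

namespace Algorithm

variable {n m : ℕ} (F : CoverageFamily n m) (k : ℕ)

theorem sum_input_le {t : ℕ} (hF : F.Sparse t) (j : Fin n) :
    ∑ u ∈ range F.numElems, F.input k 2 (u * n + j) ≤ t := by
  refine le_trans (le_of_eq ?_) (hF j)
  rw [card_filter, ← Fin.sum_univ_eq_sum_range fun u => F.input k 2 (u * n + j)]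
  exact sum_congr rfl fun u _ => input_mem F k u.2 j.2

theorem abs_value_sub_le (hk : 1 ≤ k) {t : ℕ} (hF : F.Sparse t) (i : Fin m) (l l' : Fin k) :
    |F.value i (colorClass (colorOf F k hk) l) - F.value i (colorClass (colorOf F k hk) l')| ≤
      880 * bound n t k := by
  have hb := bound_nonneg n t k
  by_cases hll : l = l'
  · rw [hll, sub_self, abs_zero]
    positivity
  have hk2 : 2 ≤ k := by
    have h1 := l.2
    have h2 := l'.2
    have h3 : (l : ℕ) ≠ l' := fun h => hll (Fin.ext h)
    omega
  -- A function without nonempty sets is zero. Otherwise `n` and `t` are positive, and the function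
  -- is seen by the potential.
  by_cases hex : ∃ u, F.owner u = i ∧ (F.dual u).Nonempty
  swap
  · have h0 : ∀ l, F.value i (colorClass (colorOf F k hk) l) = 0 := by
      classical
      intro l
      rw [F.value_eq]
      refine sum_eq_zero fun u _ => ?_
      split_ifs with h1 h2
      · obtain ⟨j, hj, -⟩ := h2
        exact absurd ⟨u, h1, j, hj⟩ hex
      · rfl
      · rfl
    rw [h0, h0, sub_self, abs_zero]
    positivity
  obtain ⟨u, hu, j, hj⟩ := hex
  have hn : 1 ≤ n := Nat.one_le_of_lt j.2
  have ht : 1 ≤ t := le_trans (card_pos.2 ⟨u, mem_filter.2 ⟨mem_univ _, hj⟩⟩) (hF j)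
  rcases Nat.lt_or_ge n k with hkn | hkn
  · have hi := colorOf_injective F k hk hkn
    obtain ⟨h1, h2⟩ := F.value_le_of_injective hF hi i l
    obtain ⟨h3, h4⟩ := F.value_le_of_injective hF hi i l'
    have h5 := le_bound hn ht hk2
    rw [abs_le]
    constructor <;> linarith
  have hI := initial_spec F k hk
  have p := prepared_spec hI
  have e : initial F k 0 = initialSizes n m k F.numElems := initial_zero F k
  have e0 : initial F k 0 0 = n := by rw [e]; rfl
  have e2 : initial F k 0 2 = k := by rw [e]; exact min_eq_left (by omega)
  have e3 : initial F k 0 3 = F.numElems := by rw [e]; rfl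
  have i2 : initial F k 2 = F.input k 2 := initial_of_ne F k (by decide)
  have i1 : initial F k 1 u = i := by
    rw [initial_of_ne F k (by decide), input_one, dif_pos u.2, ← hu]
  have hne : prepared (initial F k) 33 u ≠ 0 := by
    rw [p.nonempty u (by rw [e3]; exact u.2), if_neg]
    · exact one_ne_zero
    · intro h0
      have := sum_eq_zero_iff.1 h0 j (mem_range.2 (by rw [e0]; exact j.2))
      rw [e0, i2, input_mem F k u.2 j.2, if_pos hj] at this
      exact one_ne_zero this
  have hcol : ∀ j ∈ range n, ∑ u ∈ range F.numElems, F.input k 2 (u * n + j) ≤ t := fun j hj =>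
    sum_input_le F k hF ⟨j, mem_range.1 hj⟩
  -- The degree parameter is at most `t + 1`, and `t ≥ 1`.
  have hτ : prepared (initial F k) 6 0 ≤ 2 * t := by
    rw [p.degree, e0, e3, i2]
    have := Finset.sup_le hcol
    omega
  have hnum : prepared (initial F k) 5 0 ≤ n * t := by
    rw [p.num, e3]
    calc _ ≤ ∑ u ∈ range F.numElems, ∑ j ∈ range n, F.input k 2 (u * n + j) := by
          refine sum_le_sum fun u hu => ?_
          rw [p.nonempty u (by rw [e3]; exact mem_range.1 hu), e0, i2]
          split_ifs <;> omega
      _ = ∑ j ∈ range n, ∑ u ∈ range F.numElems, F.input k 2 (u * n + j) := sum_comm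
      _ ≤ ∑ j ∈ range n, t := sum_le_sum hcol
      _ = n * t := by simp
  have hpos : 1 ≤ prepared (initial F k) 5 0 := by
    rw [p.num, e3]
    exact (Nat.one_le_iff_ne_zero.2 hne).trans (single_le_sum
      (f := fun u => prepared (initial F k) 33 u) (fun _ _ => Nat.zero_le _) (mem_range.2 u.2))
  have hdev : ∀ l : Fin k, |∑ b ∈ range n, (layout (prepared (initial F k))).dev b
      (coloring (rounded (initial F k)) 12 13) i l| ≤ 440 * bound n t k := by
    intro l
    have h1 := abs_sum_dev_rounded_le hI (u := u) (l := l) (by rw [e3]; exact u.2)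
      (by rw [e2]; exact l.2) hne
    rw [i1, e0, e2] at h1
    refine h1.trans (deviation_le_bound hn ht hk2 hτ ?_ (Nat.mul_pos hpos hk)
      (Nat.mul_le_mul_right k hnum))
    rw [p.root, e2]
  rw [value_sub_colorOf F k hk hkn]
  refine (abs_sub _ _).trans ?_
  linarith [hdev l, hdev l']

theorem disc_colorOf_le (hk : 1 ≤ k) {t : ℕ} (hF : F.Sparse t) :
    disc F.value (colorOf F k hk) ≤ 880 * bound n t k :=
  -- Nonnegativity of the bound is needed for an empty index set, where the supremum is `0`.
  Real.iSup_le (fun p => abs_value_sub_le F k hk hF p.1 p.2.1 p.2.2)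
    (mul_nonneg (by norm_num) (bound_nonneg n t k))

theorem outputs_colorOf : ∃ p : Polynomial ℕ, ∀ (n m k : ℕ) (hk : 1 ≤ k) (F : CoverageFamily n m)
    (r : List Bool), program.Outputs F r (p.eval (F.inputSize k)) (colorOf F k hk) := by
  obtain ⟨p, hp⟩ := exists_polynomial
  refine ⟨p, fun n m k hk F r => ?_⟩
  obtain ⟨σ, T, hx, hT, h3⟩ := hp n m k hk F r
  refine ⟨σ, r, T, hx, hT, fun j => ?_⟩
  rw [h3]
  exact output_spec (initial_spec F k hk) (by rw [initial_zero]; exact j.2)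

end Algorithm

theorem coinProb_of_forall {L : ℕ} {E : (Fin L → Bool) → Prop} (h : ∀ r, E r) : coinProb E = 1 := by
  have : Nat.card {r // E r} = 2 ^ L := by
    rw [Nat.card_congr (Equiv.subtypeUnivEquiv h)]
    simp
  rw [coinProb, this]
  push_cast
  exact div_self (by positivity)

end

end SparseCoverage

theorem theorem2 (c : ℕ) :
    ∃ (P : SparseCoverage.Program) (p : Polynomial ℕ) (C : ℝ),
      ∀ (n m k : ℕ) (_hk : 1 ≤ k) (F : SparseCoverage.CoverageFamily n m),
        ∃ χ : (Fin (p.eval (F.inputSize k)) → Bool) → Fin n → Fin k,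
          (∀ r, P.Outputs F (List.ofFn r) (p.eval (F.inputSize k)) (χ r)) ∧
          ∀ t : ℕ, F.Sparse t →
            1 - 1 / (n : ℝ) ^ c ≤
              SparseCoverage.coinProb (fun r =>
                SparseCoverage.disc F.value (χ r) ≤
                  C * (Real.sqrt ((t : ℝ) ^ 3 * (k : ℝ)) *
                    Real.log ((n : ℝ) * (t : ℝ) * (k : ℝ)))) := by
  obtain ⟨p, hp⟩ := SparseCoverage.Algorithm.outputs_colorOf
  refine ⟨SparseCoverage.Algorithm.program, p, 880, fun n m k hk F =>
    ⟨fun _ => SparseCoverage.Algorithm.colorOf F k hk, fun r => hp n m k hk F _, fun t hF => ?_⟩⟩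
  -- The event is certain, so only `1 - 1 / n ^ c ≤ 1` remains; it also holds for `n = 0`, where
  -- division by zero gives `0`.
  refine le_trans ?_ (SparseCoverage.coinProb_of_forall fun _ =>
    SparseCoverage.Algorithm.disc_colorOf_le F k hk hF).ge
  rw [sub_le_self_iff]
  positivity
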